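/- **Setting.** Inputs are finite simple undirected graphs $G=(V,E)$ with $V\neq\emptyset$ and without isolated vertices; $n=|V|$, and $d=2|E|/n$ is the average degree. The vertices are labelled by natural numbers, and $V$ is an arbitrary set of $n$ labels that is not known to the algorithm; the number $n$ is known. A (randomized, adaptive) algorithm may use internal randomness at no cost and the following queries: $\mathbf{RandVert}()$ returns a uniformly random vertex; $\mathbf{RandEdge}()$ returns a uniformly random edge; $\mathbf{RandNbr}(x)$ returns a uniformly random neighbour of $x$; $\mathbf{Degree}(x)$ returns $\deg(x)$; each of these costs $1$. In addition $\mathbf{Additive}(S)$, for a finite set $S$ of vertices, returns the number of edges with both endpoints in $S$, at cost $|S|$. This is the advanced model with $n$ known and $\mathbf{RandEdge}$ queries. In the full neighbourhood access model there is moreover the query $\mathbf{FullNbrHood}(x)$, which returns the set of all neighbours of $x$, at cost $1$. For $c\ge 1$, a number $a$ is a $c$-approximation to $d$ if $d/c\le a\le c\,d$. The number of queries of an algorithm means the total cost of its queries. **Theorem.** (a) There are constants $C$ and $k$ such that for all $n$ and all $\varepsilon\in(0,1)$ there is an algorithm in the advanced model with $\mathbf{RandEdge}$ that, on every $n$-vertex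 input graph $G$, with probability greater than $0.99$ outputs a $(1+\varepsilon)$-approximation to $d$ and makes at most $$C\,(\log n)^k\,\varepsilon^{-2}\min\!\left(d,\ (n/d)^{1/4}\right)$$ queries. In particular, there are constants $C$ and $k$ such that for all $n$ and all $\varepsilon\in(0,1)$ there is such an algorithm that, on every $n$-vertex input graph, with probability greater than $0.99$ outputs a $(1+\varepsilon)$-approximation to $d$ and makes at most $C(\log n)^k\varepsilon^{-2}n^{1/5}$ queries. (b) For all constants $c\ge 1$ and $p>1/2$ there are $\kappa>0$ and $N$ such that the following holds for all $n\ge N$. If an algorithm for $n$-vertex graphs, even with full neighbourhood access in addition to the queries of the advanced model and $\mathbf{RandEdge}$, on every $n$-vertex input graph with probability at least $p$ outputs a $c$-approximation to $d$ and makes at most $q$ queries, then $q\ge \kappa\, n^{1/5}$. -/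

import Mathlib

open scoped ENNReal

noncomputable section

namespace AvgDeg

/-- A finite nonempty simple undirected graph without isolated vertices. The vertices carry labels
from the universe `ℕ`; the vertex set `verts` is an arbitrary finite set of labels, so that an
algorithm that has to work for all such graphs does not know it in advance. -/
structure Graph where
  verts : Finset ℕ
  toSimple : SimpleGraph ℕ
  nonempty : verts.Nonempty
  mem_of_adj : ∀ x y, toSimple.Adj x y → x ∈ verts
  exists_adj : ∀ x ∈ verts, ∃ y, toSimple.Adj x y

namespace Graph

variable (G : Graph)

/-- The number of vertices. -/
def n : ℕ := G.verts.card

open Classical in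
/-- The neighbourhood of `x` (empty if `x` is not a vertex). -/
def nbrs (x : ℕ) : Finset ℕ := G.verts.filter fun y => G.toSimple.Adj x y

open Classical in
/-- The edges with both endpoints in `S`. -/
def edgesIn (S : Finset ℕ) : Finset (Sym2 ℕ) := S.sym2.filter fun e => e ∈ G.toSimple.edgeSet

/-- All edges. -/
def edges : Finset (Sym2 ℕ) := G.edgesIn G.verts

/-- The average degree `d`. -/
def avgDeg : ℝ := (∑ x ∈ G.verts, ((G.nbrs x).card : ℝ)) / (G.n : ℝ)

theorem edges_nonempty : G.edges.Nonempty := by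
  obtain ⟨x, hx⟩ := G.nonempty
  obtain ⟨y, hy⟩ := G.exists_adj x hx
  refine ⟨s(x, y), ?_⟩
  simp only [edges, edgesIn, Finset.mem_filter, Finset.mk_mem_sym2_iff, SimpleGraph.mem_edgeSet]
  exact ⟨⟨hx, G.mem_of_adj y x hy.symm⟩, hy⟩

end Graph

/-- The oracle queries. -/
inductive Query : Type
  | randVert
  | randEdge
  | randNbr (x : ℕ)
  | degree (x : ℕ)
  | additive (S : Finset ℕ)
  | fullNbr (x : ℕ)

/-- The type of the answer to a query. -/
abbrev Query.Answer : Query → Type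
  | .randVert => ℕ
  | .randEdge => Sym2 ℕ
  | .randNbr _ => ℕ
  | .degree _ => ℕ
  | .additive _ => ℕ
  | .fullNbr _ => Finset ℕ

/-- `Additive(S)` costs `|S|`, every other query has unit cost. -/
def Query.cost : Query → ℕ
  | .additive S => S.card
  | _ => 1

open Classical in
/-- The distribution of the answer to a query:
a uniform vertex; a uniform edge; a uniform neighbour of `x` (the label `x` itself is returned
exactly when `x` is not a vertex); the degree of `x`; the number of edges inside `S`;
the set of all neighbours of `x`. -/
def Graph.answer (G : Graph) : (q : Query) → PMF q.Answer
  | .randVert => PMF.uniformOfFinset G.verts G.nonempty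
  | .randEdge => PMF.uniformOfFinset G.edges G.edges_nonempty
  | .randNbr x =>
      if h : (G.nbrs x).Nonempty then PMF.uniformOfFinset (G.nbrs x) h else PMF.pure x
  | .degree x => PMF.pure (G.nbrs x).card
  | .additive S => PMF.pure (G.edgesIn S).card
  | .fullNbr x => PMF.pure (G.nbrs x)

/-- Randomized adaptive query algorithms with a real output whose queries all belong to `M`:
decision trees whose nodes either output a number, or make a free internal random choice, or
make a query and continue depending on the answer. -/
inductive Alg (M : Set Query) : Type
  | ret (r : ℝ) : Alg M
  | toss (p : PMF ℕ) (k : ℕ → Alg M) : Alg M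
  | query (q : Query) (hq : q ∈ M) (k : q.Answer → Alg M) : Alg M

/-- The joint distribution of the output and of the total query cost of an algorithm on `G`, where
the answers to the queries and the internal random choices are mutually independent. -/
def Alg.run {M : Set Query} (G : Graph) : Alg M → PMF (ℝ × ℕ)
  | .ret r => PMF.pure (r, 0)
  | .toss p k => p.bind fun i => (k i).run G
  | .query q _ k =>
      (G.answer q).bind fun a => ((k a).run G).map fun o => (o.1, o.2 + q.cost)

/-- The advanced model together with random edge samples. -/
def advancedModel : Set Query :=
  {q | match q with
    | .fullNbr _ => False
    | _ => True}

/-- The advanced model with random edge samples, strengthened by full neighbourhood access. -/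
def fullNbrModel : Set Query := Set.univ

/-- `a` is a `c`-approximation to `d`. -/
def IsApprox (c d a : ℝ) : Prop := d / c ≤ a ∧ a ≤ c * d

/-- The probability that on input `G` the algorithm `A` outputs a `c`-approximation to the average
degree of `G` at total query cost at most `q`. -/
def successProb {M : Set Query} (A : Alg M) (G : Graph) (c q : ℝ) : ℝ≥0∞ :=
  (A.run G).toOuterMeasure {o | IsApprox c G.avgDeg o.1 ∧ (o.2 : ℝ) ≤ q}

end AvgDeg

end

/-! Lower bound. The inputs are disjoint unions of single edges and of large cliques, each occupying
a block of labels, with the blocks chosen at random among far more blocks than are used. With `r`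
about `n^(1/5)`, the cliques have size about `r^2` and there are about `b * r^2` of them, so that
the average degree is of order `b * r`. A random vertex then lies in a clique with probability
`O(1/r)`, a random edge lies outside the cliques with probability `O(1/r)`, a sampled edge falls in
a clique already seen with probability `O(1/r)` as long as at most `r` were seen, and a guessed
label is almost never a vertex. Outside these events a vertex sample reveals a new single edge and
an edge sample reveals a new clique, whatever `b` is. The simulated oracle `simE` always answers in
this way and does not know the numbers of edges and cliques. By induction on the decision tree,
`sum_colVal_le` bounds the average success probability by that against `simE` plus an error `O(1/r)`
per unit of cost. Two values of `b` whose ratio exceeds `c^2` up to a constant have disjoint sets of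
admissible outputs, so against `simE` the two success probabilities add up to at most `1`; hence `2
* p ≤ 1 + O(q/r)`.

Upper bound. A random end of a random edge is a vertex chosen with probability proportional to its
degree. So the mean of the inverse degrees of the ends is `1/d`, and `O(d/ε^2)` samples suffice. For
large `d`, work at a scale `t` and call a vertex heavy if its degree exceeds `n/t^3`. If a constant
fraction of edge ends is light, then `d` is the ratio of the mean light degree of a random vertex to
the fraction `φ` of light ends (`edgeE_statF`), and the cap `n/t^3` controls the variance. Otherwise
many edges join heavy vertices. Take two samples of `N` edges with `N` of order `t`, weight their
ends by approximate inverse degrees, and count the adjacent pairs between the samples: the mean is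
`h/d`, where `h` is the mean of `statH` and is estimated directly (`edgeE_edgeE_edgeKer`). There are
`N^2` pairs but only `N` labels to pay for in `Additive`, which gives the exponent `1/4`. Weights
are powers of two, so the weighted count splits by binary digits into polylogarithmically many
unweighted ones.

Every estimate has error relative to the maximum of its mean and a threshold, so comparing it with
twice the threshold certifies it (`decideAt_spec`). An answer found at a wrong scale is therefore
still correct, and the algorithm doubles `t` until an answer appears; this happens by `t < 8 *
min(d, (n/d)^(1/4))` (`exists_scale`). -/

namespace AvgDeg

/-- The probability that `A` outputs an element of `T` at cost at most `q` on input `G`. -/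
noncomputable def val {M : Set Query} (G : Graph) (T : Set ℝ) (A : Alg M) (q : ℕ) : ℝ≥0∞ :=
  (A.run G).toOuterMeasure {o | o.1 ∈ T ∧ o.2 ≤ q}

/-! ### Success probability along the decision tree -/

section val
variable {M : Set Query} (G : Graph) (T : Set ℝ)

theorem val_le_one (A : Alg M) (q : ℕ) : val G T A q ≤ 1 := by
  unfold val
  rw [PMF.toOuterMeasure_apply]
  calc _ ≤ ∑' x, (A.run G) x := ENNReal.tsum_le_tsum fun x => Set.indicator_le_self _ _ _
    _ = 1 := PMF.tsum_coe _

theorem val_ne_top (A : Alg M) (q : ℕ) : val G T A q ≠ ⊤ :=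
  ne_top_of_le_ne_top ENNReal.one_ne_top (val_le_one G T A q)

theorem val_mono (A : Alg M) {q q' : ℕ} (h : q ≤ q') : val G T A q ≤ val G T A q' :=
  (A.run G).toOuterMeasure.mono fun _ ho => ⟨ho.1, ho.2.trans h⟩

open Classical in
theorem val_ret (r : ℝ) (q : ℕ) : val (M := M) G T (.ret r) q = if r ∈ T then 1 else 0 := by
  simp [val, Alg.run, PMF.toOuterMeasure_pure_apply]

theorem val_toss (p : PMF ℕ) (k : ℕ → Alg M) (q : ℕ) :
    val G T (.toss p k) q = ∑' i, p i * val G T (k i) q := by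
  simp [val, Alg.run, PMF.toOuterMeasure_bind_apply]

theorem val_query_of_lt (x : Query) (hx : x ∈ M) (k : x.Answer → Alg M) {q : ℕ} (h : q < x.cost) :
    val G T (.query x hx k) q = 0 := by
  simp only [val, Alg.run, PMF.toOuterMeasure_bind_apply, PMF.toOuterMeasure_map_apply]
  refine ENNReal.tsum_eq_zero.2 fun a => ?_
  have : (fun o : ℝ × ℕ => (o.1, o.2 + x.cost)) ⁻¹' {o | o.1 ∈ T ∧ o.2 ≤ q} = ∅ := by
    ext o; simp; intro _; omega
  rw [this]; simp

theorem val_query_add (x : Query) (hx : x ∈ M) (k : x.Answer → Alg M) (q : ℕ) :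
    val G T (.query x hx k) (q + x.cost) = ∑' a, G.answer x a * val G T (k a) q := by
  simp only [val, Alg.run, PMF.toOuterMeasure_bind_apply, PMF.toOuterMeasure_map_apply]
  refine tsum_congr fun a => ?_
  congr 2
  ext o; simp

theorem successProb_eq_val {M : Set Query} (A : Alg M) (c : ℝ) {q : ℝ} (hq : 0 ≤ q) :
    successProb A G c q = val G {a | IsApprox c G.avgDeg a} A ⌊q⌋₊ := by
  unfold successProb val
  congr 1
  ext o
  simp [Nat.le_floor_iff hq]

end val

theorem tsum_pure_mul {α : Type*} (a : α) (f : α → ℝ≥0∞) : ∑' b, PMF.pure a b * f b = f a := by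
  rw [tsum_eq_single a]
  · simp
  · intro b hb; simp [PMF.pure_apply, hb]

theorem tsum_uniformOfFinset_mul {α : Type*} (s : Finset α) (hs : s.Nonempty) (f : α → ℝ≥0∞) :
    ∑' a, PMF.uniformOfFinset s hs a * f a = (s.card : ℝ≥0∞)⁻¹ * ∑ a ∈ s, f a := by
  rw [tsum_eq_sum (s := s), Finset.mul_sum]
  · exact Finset.sum_congr rfl fun a ha => by rw [PMF.uniformOfFinset_apply_of_mem _ ha]
  · intro b hb; rw [PMF.uniformOfFinset_apply_of_notMem _ hb, zero_mul]

section val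
variable {M : Set Query} (G : Graph) (T : Set ℝ)

theorem val_randVert (hx : Query.randVert ∈ M) (k : ℕ → Alg M) (q : ℕ) :
    val G T (.query .randVert hx k) (q + 1) =
      (G.verts.card : ℝ≥0∞)⁻¹ * ∑ x ∈ G.verts, val G T (k x) q :=
  (val_query_add G T .randVert hx k q).trans (tsum_uniformOfFinset_mul G.verts G.nonempty _)

theorem val_randEdge (hx : Query.randEdge ∈ M) (k : Sym2 ℕ → Alg M) (q : ℕ) :
    val G T (.query .randEdge hx k) (q + 1) =
      (G.edges.card : ℝ≥0∞)⁻¹ * ∑ e ∈ G.edges, val G T (k e) q :=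
  (val_query_add G T .randEdge hx k q).trans (tsum_uniformOfFinset_mul G.edges G.edges_nonempty _)

end val

/-! ### Disjoint unions of cliques -/

/-- A colouring `(L, H)` of blocks of labels: the blocks in `L` carry an edge, the blocks in `H` a
clique on all labels of the block, and the other blocks are empty. -/
abbrev Col := Finset ℕ × Finset ℕ

namespace Col

/-- The size of the clique on the block `b`. -/
def sz (s : ℕ) (c : Col) (b : ℕ) : ℕ := if b ∈ c.2 then s else if b ∈ c.1 then 2 else 0

/-- The clique on the block `b`. -/
def blk (s b m : ℕ) : Finset ℕ := Finset.Ico (b * s) (b * s + m)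

/-- The pairs of distinct labels of the clique on the block `b`. -/
def pairs (s b m : ℕ) : Finset (Sym2 ℕ) := (blk s b m).offDiag.image fun p => s(p.1, p.2)

def verts (s : ℕ) (c : Col) : Finset ℕ := (c.1 ∪ c.2).biUnion fun b => blk s b (c.sz s b)

def graph (s : ℕ) (c : Col) : SimpleGraph ℕ where
  Adj x y := x ≠ y ∧ x / s = y / s ∧ x % s < c.sz s (x / s) ∧ y % s < c.sz s (y / s)
  symm := ⟨fun _ _ h => ⟨h.1.symm, h.2.1.symm, h.2.2.2, h.2.2.1⟩⟩
  loopless := ⟨fun _ h => h.1 rfl⟩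

variable {s : ℕ} (hs : 2 < s) (c : Col)

theorem card_blk (b m : ℕ) : (blk s b m).card = m := by simp [blk]

theorem card_pairs (b m : ℕ) : (pairs s b m).card = m.choose 2 := by
  have := Sym2.card_image_offDiag (blk s b m)
  rw [card_blk] at this
  exact this

section toGraph
include hs

theorem sz_le (b : ℕ) : c.sz s b ≤ s := by unfold sz; split_ifs <;> omega

theorem mem_blk {b m x : ℕ} (hm : m ≤ s) : x ∈ blk s b m ↔ x / s = b ∧ x % s < m := by
  have h := Nat.div_add_mod x s
  have h2 := Nat.mod_lt x (show 0 < s by omega)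
  unfold blk
  rw [Finset.mem_Ico]
  constructor
  · rintro ⟨h3, h4⟩
    have hb : x / s = b := by
      apply Nat.div_eq_of_lt_le
      · exact h3
      · rw [Nat.add_mul]; omega
    rw [hb, Nat.mul_comm] at h
    exact ⟨hb, by omega⟩
  · rintro ⟨h3, h4⟩
    rw [h3, Nat.mul_comm] at h
    omega

theorem mem_verts {x : ℕ} : x ∈ c.verts s ↔ x % s < c.sz s (x / s) := by
  simp only [verts, Finset.mem_biUnion, mem_blk hs (sz_le hs c _)]
  constructor
  · rintro ⟨b, _, rfl, h⟩; exact h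
  · intro h
    refine ⟨x / s, ?_, rfl, h⟩
    by_contra h'
    rw [Finset.mem_union, not_or] at h'
    rw [sz, if_neg h'.2, if_neg h'.1] at h
    omega

theorem sum_verts (hc : Disjoint c.1 c.2) {M : Type*} [AddCommMonoid M] (f : ℕ → M) :
    ∑ x ∈ c.verts s, f x = ∑ b ∈ c.1, ∑ x ∈ blk s b 2, f x + ∑ b ∈ c.2, ∑ x ∈ blk s b s, f x := by
  rw [verts, Finset.sum_biUnion, Finset.sum_union hc]
  · congr 1
    · refine Finset.sum_congr rfl fun b hb => ?_
      rw [sz, if_neg (Finset.disjoint_left.1 hc hb), if_pos hb]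
    · refine Finset.sum_congr rfl fun b hb => ?_
      rw [sz, if_pos hb]
  · intro b _ b' _ hbb
    rw [Function.onFun, Finset.disjoint_left]
    intro x h1 h2
    rw [mem_blk hs (sz_le hs c _)] at h1 h2
    exact hbb (h1.1.symm.trans h2.1)

/-- The clique graph as an input graph. -/
def toGraph (hne : (c.1 ∪ c.2).Nonempty) : Graph where
  verts := c.verts s
  toSimple := c.graph s
  nonempty := by
    obtain ⟨b, hb⟩ := hne
    refine ⟨b * s, ?_⟩
    rw [mem_verts hs, Nat.mul_mod_left, Nat.mul_div_cancel _ (by omega), sz]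
    rw [Finset.mem_union] at hb
    split_ifs <;> first | omega | tauto
  mem_of_adj x y h := (mem_verts hs c).2 h.2.2.1
  exists_adj x hx := by
    rw [mem_verts hs] at hx
    have h2 : 2 ≤ c.sz s (x / s) := by
      unfold sz at hx ⊢
      split_ifs at hx ⊢ <;> omega
    have key : ∀ i < 2, (x / s * s + i) / s = x / s ∧ (x / s * s + i) % s = i := by
      intro i hi
      have := (mem_blk hs (b := x / s) (m := 2) (x := x / s * s + i) (by omega)).1
        (by simp [blk]; omega)
      exact ⟨this.1, by rw [Nat.mul_comm, Nat.mul_add_mod, Nat.mod_eq_of_lt (by omega)]⟩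
    obtain ⟨i, hi, hxi⟩ : ∃ i < 2, x ≠ x / s * s + i := by
      by_cases h : x = x / s * s + 0
      · exact ⟨1, by omega, by omega⟩
      · exact ⟨0, by omega, h⟩
    refine ⟨x / s * s + i, hxi, (key i hi).1.symm, hx, ?_⟩
    rw [(key i hi).1, (key i hi).2]; omega

omit hs in
theorem mem_edgeSet_graph {x y : ℕ} : s(x, y) ∈ (c.graph s).edgeSet ↔
    x ≠ y ∧ x / s = y / s ∧ x % s < c.sz s (x / s) ∧ y % s < c.sz s (y / s) := Iff.rfl

theorem mem_pairs {b m x y : ℕ} (hm : m ≤ s) :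
    s(x, y) ∈ pairs s b m ↔ x ≠ y ∧ (x / s = b ∧ x % s < m) ∧ (y / s = b ∧ y % s < m) := by
  simp only [pairs, Finset.mem_image, Finset.mem_offDiag, mem_blk hs hm, Prod.exists,
    Sym2.eq_iff]
  constructor
  · rintro ⟨a, b', ⟨h1, h2, h3⟩, (⟨rfl, rfl⟩ | ⟨rfl, rfl⟩)⟩
    · exact ⟨h3, h1, h2⟩
    · exact ⟨h3.symm, h2, h1⟩
  · rintro ⟨h1, h2, h3⟩
    exact ⟨x, y, ⟨h2, h3, h1⟩, Or.inl ⟨rfl, rfl⟩⟩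

theorem edges_toGraph (hne : (c.1 ∪ c.2).Nonempty) :
    (c.toGraph hs hne).edges = (c.1 ∪ c.2).biUnion fun b => pairs s b (c.sz s b) := by
  ext e
  induction e using Sym2.ind with | _ x y => ?_
  simp only [Graph.edges, Graph.edgesIn, Finset.mem_filter, Finset.mk_mem_sym2_iff,
    Finset.mem_biUnion, mem_pairs hs (sz_le hs c _)]
  change (x ∈ c.verts s ∧ y ∈ c.verts s) ∧ s(x, y) ∈ (c.graph s).edgeSet ↔ _
  rw [mem_edgeSet_graph, mem_verts hs, mem_verts hs]
  constructor
  · rintro ⟨⟨h1, h2⟩, h3, h4, _⟩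
    refine ⟨x / s, ?_, h3, ⟨rfl, h1⟩, ⟨h4.symm, h4 ▸ h2⟩⟩
    have := (mem_verts hs c).2 h1
    simp only [verts, Finset.mem_biUnion, mem_blk hs (sz_le hs c _)] at this
    obtain ⟨b, hb, hb', _⟩ := this
    rwa [hb']
  · rintro ⟨b, _, h3, ⟨rfl, h1⟩, h4, h2⟩
    rw [← h4] at h2
    exact ⟨⟨h1, h2⟩, h3, h4.symm, h1, h2⟩

theorem sum_edges (hc : Disjoint c.1 c.2) (hne : (c.1 ∪ c.2).Nonempty) {M : Type*}
    [AddCommMonoid M] (f : Sym2 ℕ → M) :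
    ∑ e ∈ (c.toGraph hs hne).edges, f e =
      ∑ b ∈ c.1, ∑ e ∈ pairs s b 2, f e + ∑ b ∈ c.2, ∑ e ∈ pairs s b s, f e := by
  rw [edges_toGraph, Finset.sum_biUnion, Finset.sum_union hc]
  · congr 1
    · refine Finset.sum_congr rfl fun b hb => ?_
      rw [sz, if_neg (Finset.disjoint_left.1 hc hb), if_pos hb]
    · refine Finset.sum_congr rfl fun b hb => ?_
      rw [sz, if_pos hb]
  · intro b _ b' _ hbb
    rw [Function.onFun, Finset.disjoint_left]
    intro e
    induction e using Sym2.ind with | _ x y => ?_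
    intro h1 h2
    rw [mem_pairs hs (sz_le hs c _)] at h1 h2
    exact hbb (h1.2.1.1.symm.trans h2.2.1.1)

theorem n_toGraph (hc : Disjoint c.1 c.2) (hne : (c.1 ∪ c.2).Nonempty) :
    (c.toGraph hs hne).n = 2 * c.1.card + s * c.2.card := by
  have := sum_verts hs c hc (fun _ => 1)
  rw [Finset.sum_const, smul_eq_mul, mul_one] at this
  change (c.verts s).card = _
  rw [this]
  simp [card_blk, mul_comm]

theorem card_edges_toGraph (hc : Disjoint c.1 c.2) (hne : (c.1 ∪ c.2).Nonempty) :
    (c.toGraph hs hne).edges.card = c.1.card + s.choose 2 * c.2.card := by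
  rw [Finset.card_eq_sum_ones, sum_edges hs c hc]
  simp [card_pairs, mul_comm]

theorem card_nbrs_toGraph (hne : (c.1 ∪ c.2).Nonempty) {x : ℕ} (hx : x ∈ c.verts s) :
    ((c.toGraph hs hne).nbrs x).card = c.sz s (x / s) - 1 := by
  have hx' := (mem_verts hs c).1 hx
  have : (c.toGraph hs hne).nbrs x = (blk s (x / s) (c.sz s (x / s))).erase x := by
    ext y
    simp only [Graph.nbrs, Finset.mem_filter, Finset.mem_erase, mem_blk hs (sz_le hs c _)]
    change y ∈ c.verts s ∧ (x ≠ y ∧ x / s = y / s ∧ _ ∧ _) ↔ _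
    rw [mem_verts hs]
    constructor
    · rintro ⟨h1, h2, h3, -⟩; exact ⟨h2.symm, h3.symm, h3 ▸ h1⟩
    · rintro ⟨h1, h2, h3⟩; rw [← h2] at h3; exact ⟨h3, h1.symm, h2.symm, hx', h3⟩
  rw [this, Finset.card_erase_of_mem, card_blk]
  rw [mem_blk hs (sz_le hs c _)]
  exact ⟨rfl, hx'⟩

theorem avgDeg_toGraph (hc : Disjoint c.1 c.2) (hne : (c.1 ∪ c.2).Nonempty) :
    (c.toGraph hs hne).avgDeg * ((c.toGraph hs hne).n : ℝ) =
      2 * c.1.card + s * (s - 1) * c.2.card := by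
  have hn : ((c.toGraph hs hne).n : ℝ) ≠ 0 :=
    Nat.cast_ne_zero.2 (Finset.card_pos.2 (c.toGraph hs hne).nonempty).ne'
  rw [Graph.avgDeg, div_mul_cancel₀ _ hn]
  change ∑ x ∈ c.verts s, _ = _
  rw [sum_verts hs c hc]
  congr 1
  · rw [Finset.sum_congr rfl (g := fun _ => (2 : ℝ)), Finset.sum_const, nsmul_eq_mul, mul_comm]
    intro b hb
    rw [Finset.sum_congr rfl (g := fun _ => (1 : ℝ)), Finset.sum_const, card_blk]
    · simp
    intro x hx
    rw [mem_blk hs hs.le] at hx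
    have hsz : c.sz s (x / s) = 2 := by
      rw [hx.1, sz, if_neg (Finset.disjoint_left.1 hc hb), if_pos hb]
    rw [card_nbrs_toGraph hs c hne ((mem_verts hs c).2 (by rw [hsz]; exact hx.2)), hsz]
    norm_num
  · rw [Finset.sum_congr rfl (g := fun _ => (s * (s - 1) : ℝ)), Finset.sum_const, nsmul_eq_mul,
      mul_comm]
    intro b hb
    rw [Finset.sum_congr rfl (g := fun _ => (s - 1 : ℝ)), Finset.sum_const, card_blk]
    · simp
    intro x hx
    rw [mem_blk hs le_rfl] at hx
    have hsz : c.sz s (x / s) = s := by rw [hx.1, sz, if_pos hb]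
    rw [card_nbrs_toGraph hs c hne ((mem_verts hs c).2 (by rw [hsz]; exact hx.2)), hsz,
      Nat.cast_sub (by omega)]
    norm_num

end toGraph

open Classical in
/-- The neighbourhood of `x` in the clique graph. -/
noncomputable def nbrs (s : ℕ) (c : Col) (x : ℕ) : Finset ℕ := (c.verts s).filter fun y => (c.graph s).Adj x y

open Classical in
/-- The answers of the clique graph to the queries that do not sample from the whole graph
(with dummy values for the others). -/
noncomputable def answer (s : ℕ) (c : Col) : (q : Query) → PMF q.Answer
  | .randVert => PMF.pure 0
  | .randEdge => PMF.pure s(0, 0)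
  | .randNbr x =>
      if h : (c.nbrs s x).Nonempty then PMF.uniformOfFinset (c.nbrs s x) h else PMF.pure x
  | .degree x => PMF.pure (c.nbrs s x).card
  | .additive S => PMF.pure (S.sym2.filter fun e => e ∈ (c.graph s).edgeSet).card
  | .fullNbr x => PMF.pure (c.nbrs s x)

/-- The labels about which a query asks. -/
def _root_.AvgDeg.Query.labels : Query → Finset ℕ
  | .randVert => ∅
  | .randEdge => ∅
  | .randNbr x => {x}
  | .degree x => {x}
  | .additive S => S
  | .fullNbr x => {x}

theorem _root_.AvgDeg.Query.card_labels_le (q : Query) : q.labels.card ≤ q.cost := by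
  cases q <;> simp [Query.labels, Query.cost]

include hs in
theorem nbrs_congr {c c' : Col} {x : ℕ} (h : c.sz s (x / s) = c'.sz s (x / s)) :
    c.nbrs s x = c'.nbrs s x := by
  ext y
  simp only [nbrs, Finset.mem_filter, mem_verts hs]
  change _ ∧ (x ≠ y ∧ x / s = y / s ∧ _ ∧ _) ↔ _ ∧ (x ≠ y ∧ x / s = y / s ∧ _ ∧ _)
  by_cases hxy : x / s = y / s
  · rw [← hxy, h]
  · simp [hxy]

-- Cliques stay inside their blocks, so a query that does not sample from the whole graph depends
-- only on the colours of the blocks of its labels. A partial colouring that knows these blocks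
-- answers it exactly.
open Classical in
include hs in
theorem answer_congr {c c' : Col} {q : Query} (h : ∀ x ∈ q.labels, c.sz s (x / s) = c'.sz s (x / s)) :
    c.answer s q = c'.answer s q := by
  cases q with
  | randVert => rfl
  | randEdge => rfl
  | randNbr x => simp only [answer, nbrs_congr hs (h x (by simp [Query.labels]))]
  | degree x => simp only [answer, nbrs_congr hs (h x (by simp [Query.labels]))]
  | fullNbr x => simp only [answer, nbrs_congr hs (h x (by simp [Query.labels]))]
  | additive S =>
    simp only [answer]
    congr 2
    refine Finset.filter_congr fun e he => ?_
    induction e using Sym2.ind with | _ x y => ?_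
    rw [Finset.mk_mem_sym2_iff] at he
    rw [mem_edgeSet_graph, mem_edgeSet_graph, h x he.1, h y he.2]

theorem answer_toGraph (hne : (c.1 ∪ c.2).Nonempty) {q : Query} (h1 : q ≠ .randVert)
    (h2 : q ≠ .randEdge) : (c.toGraph hs hne).answer q = c.answer s q := by
  cases q with
  | randVert => exact absurd rfl h1
  | randEdge => exact absurd rfl h2
  | _ => rfl

end Col

/-! ### Counting the extensions of a partial colouring -/

namespace Col

/-- The blocks that are not coloured yet. -/
def fresh (U : ℕ) (c : Col) : Finset ℕ := Finset.range U \ (c.1 ∪ c.2)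

/-- The colourings of the blocks below `U` with `l` edges and `k` large cliques that extend `c`. -/
def ext (U l k : ℕ) (c : Col) : Finset Col :=
  ((Finset.range U).powersetCard l ×ˢ (Finset.range U).powersetCard k).filter
    fun d => Disjoint d.1 d.2 ∧ c.1 ⊆ d.1 ∧ c.2 ⊆ d.2

variable {U l k s : ℕ}

theorem mem_ext {c d : Col} : d ∈ ext U l k c ↔
    ((d.1 ⊆ Finset.range U ∧ d.1.card = l) ∧ (d.2 ⊆ Finset.range U ∧ d.2.card = k)) ∧
      Disjoint d.1 d.2 ∧ c.1 ⊆ d.1 ∧ c.2 ⊆ d.2 := by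
  simp [ext, Finset.mem_powersetCard]

theorem mem_fresh {c : Col} {b : ℕ} : b ∈ fresh U c ↔ b < U ∧ b ∉ c.1 ∧ b ∉ c.2 := by
  simp [fresh, not_or]

/-- Apply a permutation of the blocks to a colouring. -/
def perm (σ : Equiv.Perm ℕ) (c : Col) : Col := (c.1.map σ.toEmbedding, c.2.map σ.toEmbedding)

theorem perm_injective (σ : Equiv.Perm ℕ) : Function.Injective (perm σ) := by
  intro c d h
  simp only [perm, Prod.mk.injEq, Finset.map_inj] at h
  exact Prod.ext h.1 h.2

theorem map_swap_eq {S : Finset ℕ} {b b' : ℕ} (hb : b ∉ S) (hb' : b' ∉ S) :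
    S.map (Equiv.swap b b').toEmbedding = S := by
  ext x
  simp only [Finset.mem_map_equiv, Equiv.symm_swap]
  by_cases h1 : x = b
  · subst h1; simp [hb, hb']
  by_cases h2 : x = b'
  · subst h2; simp [hb, hb']
  rw [Equiv.swap_apply_of_ne_of_ne h1 h2]

theorem card_ext_perm_le {σ : Equiv.Perm ℕ} (hσ : ∀ x, σ x < U ↔ x < U) (c : Col) :
    (ext U l k c).card ≤ (ext U l k (perm σ c)).card := by
  refine Finset.card_le_card_of_injOn (perm σ) ?_ (perm_injective σ).injOn
  intro d hd
  rw [Finset.mem_coe, mem_ext] at *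
  obtain ⟨⟨⟨h1, h2⟩, h3, h4⟩, h5, h6, h7⟩ := hd
  have aux : ∀ S : Finset ℕ, S ⊆ Finset.range U → S.map σ.toEmbedding ⊆ Finset.range U := by
    intro S hS x hx
    obtain ⟨y, hy, rfl⟩ := Finset.mem_map.1 hx
    exact Finset.mem_range.2 ((hσ y).2 (Finset.mem_range.1 (hS hy)))
  refine ⟨⟨⟨aux _ h1, by simp [perm, h2]⟩, aux _ h3, by simp [perm, h4]⟩, ?_, ?_, ?_⟩
  · simpa [perm] using h5
  · simpa [perm] using h6
  · simpa [perm] using h7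

theorem swap_lt_iff {b b' : ℕ} (hb : b < U) (hb' : b' < U) (x : ℕ) :
    Equiv.swap b b' x < U ↔ x < U := by
  by_cases h1 : x = b
  · subst h1; simp [hb, hb']
  by_cases h2 : x = b'
  · subst h2; simp [hb, hb']
  rw [Equiv.swap_apply_of_ne_of_ne h1 h2]

/-- Swapping two fresh blocks fixes `c` and maps extensions to extensions; used in both directions,
this shows that all fresh blocks are equally likely. -/
theorem card_ext_light_le {c : Col} {b b' : ℕ} (hb : b ∈ fresh U c) (hb' : b' ∈ fresh U c) :
    (ext U l k (insert b c.1, c.2)).card ≤ (ext U l k (insert b' c.1, c.2)).card := by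
  rw [mem_fresh] at hb hb'
  have := card_ext_perm_le (l := l) (k := k) (swap_lt_iff hb.1 hb'.1) (insert b c.1, c.2)
  simpa [perm, map_swap_eq hb.2.1 hb'.2.1, map_swap_eq hb.2.2 hb'.2.2] using this

theorem card_ext_heavy_le {c : Col} {b b' : ℕ} (hb : b ∈ fresh U c) (hb' : b' ∈ fresh U c) :
    (ext U l k (c.1, insert b c.2)).card ≤ (ext U l k (c.1, insert b' c.2)).card := by
  rw [mem_fresh] at hb hb'
  have := card_ext_perm_le (l := l) (k := k) (swap_lt_iff hb.1 hb'.1) (c.1, insert b c.2)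
  simpa [perm, map_swap_eq hb.2.1 hb'.2.1, map_swap_eq hb.2.2 hb'.2.2] using this

/-- Double counting of pairs of an extension and a new edge block in it. It turns "draw the graph,
then sample" into "sample a block, then draw the rest of the graph". -/
theorem sum_ext_light (c : Col) {M : Type*} [AddCommMonoid M] (g : Col → ℕ → M) :
    ∑ d ∈ ext U l k c, ∑ b ∈ d.1 \ c.1, g d b =
      ∑ b ∈ fresh U c, ∑ d ∈ ext U l k (insert b c.1, c.2), g d b := by
  refine Finset.sum_comm' fun d b => ?_
  simp only [mem_ext, mem_fresh, Finset.mem_sdiff, Finset.insert_subset_iff]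
  constructor
  · rintro ⟨⟨⟨⟨h1, h2⟩, h3, h4⟩, h5, h6, h7⟩, h8, h9⟩
    exact ⟨⟨⟨⟨h1, h2⟩, h3, h4⟩, h5, ⟨h8, h6⟩, h7⟩, Finset.mem_range.1 (h1 h8), h9,
      fun h => Finset.disjoint_left.1 h5 h8 (h7 h)⟩
  · rintro ⟨⟨⟨⟨h1, h2⟩, h3, h4⟩, h5, ⟨h8, h6⟩, h7⟩, h9, h10, h11⟩
    exact ⟨⟨⟨⟨h1, h2⟩, h3, h4⟩, h5, h6, h7⟩, h8, h10⟩

theorem sum_ext_heavy (c : Col) {M : Type*} [AddCommMonoid M] (g : Col → ℕ → M) :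
    ∑ d ∈ ext U l k c, ∑ b ∈ d.2 \ c.2, g d b =
      ∑ b ∈ fresh U c, ∑ d ∈ ext U l k (c.1, insert b c.2), g d b := by
  refine Finset.sum_comm' fun d b => ?_
  simp only [mem_ext, mem_fresh, Finset.mem_sdiff, Finset.insert_subset_iff]
  constructor
  · rintro ⟨⟨⟨⟨h1, h2⟩, h3, h4⟩, h5, h6, h7⟩, h8, h9⟩
    exact ⟨⟨⟨⟨h1, h2⟩, h3, h4⟩, h5, h6, h8, h7⟩, Finset.mem_range.1 (h3 h8),
      fun h => Finset.disjoint_left.1 h5 (h6 h) h8, h9⟩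
  · rintro ⟨⟨⟨⟨h1, h2⟩, h3, h4⟩, h5, h6, h8, h7⟩, h9, h10, h11⟩
    exact ⟨⟨⟨⟨h1, h2⟩, h3, h4⟩, h5, h6, h7⟩, h8, h11⟩

/-- By symmetry the left side is the sum over all fresh blocks, and each extension contains at most
`l` of them as edge blocks. -/
theorem card_ext_light {c : Col} {b : ℕ} (hb : b ∈ fresh U c) :
    (fresh U c).card * (ext U l k (insert b c.1, c.2)).card ≤ (ext U l k c).card * l := by
  calc _ ≤ ∑ b' ∈ fresh U c, (ext U l k (insert b' c.1, c.2)).card := by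
        rw [← smul_eq_mul, ← Finset.sum_const]
        exact Finset.sum_le_sum fun b' hb' => card_ext_light_le hb hb'
    _ = ∑ d ∈ ext U l k c, (d.1 \ c.1).card := by
        simp only [Finset.card_eq_sum_ones]
        exact (sum_ext_light c fun _ _ => 1).symm
    _ ≤ _ := by
        rw [← smul_eq_mul, ← Finset.sum_const]
        refine Finset.sum_le_sum fun d hd => ?_
        exact (Finset.card_le_card Finset.sdiff_subset).trans (mem_ext.1 hd).1.1.2.le

theorem card_ext_heavy {c : Col} {b : ℕ} (hb : b ∈ fresh U c) :
    (fresh U c).card * (ext U l k (c.1, insert b c.2)).card ≤ (ext U l k c).card * k := by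
  calc _ ≤ ∑ b' ∈ fresh U c, (ext U l k (c.1, insert b' c.2)).card := by
        rw [← smul_eq_mul, ← Finset.sum_const]
        exact Finset.sum_le_sum fun b' hb' => card_ext_heavy_le hb hb'
    _ = ∑ d ∈ ext U l k c, (d.2 \ c.2).card := by
        simp only [Finset.card_eq_sum_ones]
        exact (sum_ext_heavy c fun _ _ => 1).symm
    _ ≤ _ := by
        rw [← smul_eq_mul, ← Finset.sum_const]
        refine Finset.sum_le_sum fun d hd => ?_
        exact (Finset.card_le_card Finset.sdiff_subset).trans (mem_ext.1 hd).1.2.2.le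

theorem le_card_fresh (U : ℕ) (c : Col) : U ≤ (fresh U c).card + (c.1.card + c.2.card) := by
  have h1 := Finset.le_card_sdiff (c.1 ∪ c.2) (Finset.range U)
  have h2 := Finset.card_union_le c.1 c.2
  rw [Finset.card_range] at h1
  unfold fresh
  omega

/-- Few extensions of a colouring use a given new block. -/
theorem card_ext_used_le (c : Col) {b : ℕ} (hb : b ∉ c.1 ∪ c.2) :
    (fresh U c).card * ((ext U l k c).filter fun d => b ∈ d.1 ∪ d.2).card ≤
      (ext U l k c).card * (l + k) := by
  by_cases hbU : b < U
  · have hf : b ∈ fresh U c := by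
      rw [mem_fresh]; rw [Finset.mem_union, not_or] at hb; exact ⟨hbU, hb⟩
    have hsub : ((ext U l k c).filter fun d => b ∈ d.1 ∪ d.2) ⊆
        ext U l k (insert b c.1, c.2) ∪ ext U l k (c.1, insert b c.2) := by
      intro d hd
      simp only [Finset.mem_filter, Finset.mem_union, mem_ext, Finset.insert_subset_iff] at hd ⊢
      tauto
    calc _ ≤ (fresh U c).card * ((ext U l k (insert b c.1, c.2)).card +
          (ext U l k (c.1, insert b c.2)).card) :=
          Nat.mul_le_mul_left _ ((Finset.card_le_card hsub).trans (Finset.card_union_le _ _))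
      _ ≤ _ := by
          rw [Nat.mul_add, Nat.mul_add]
          exact Nat.add_le_add (card_ext_light hf) (card_ext_heavy hf)
  · have : ((ext U l k c).filter fun d => b ∈ d.1 ∪ d.2) = ∅ := by
      refine Finset.filter_eq_empty_iff.2 fun d hd hbd => hbU ?_
      rw [mem_ext] at hd
      rcases Finset.mem_union.1 hbd with h | h
      · exact Finset.mem_range.1 (hd.1.1.1 h)
      · exact Finset.mem_range.1 (hd.1.2.1 h)
    rw [this]; simp

theorem ext_nonempty (h : l + k ≤ U) : (ext U l k (∅, ∅)).Nonempty := by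
  refine ⟨(Finset.range l, Finset.Ico l (l + k)), ?_⟩
  rw [mem_ext]
  refine ⟨⟨⟨?_, by simp⟩, ?_, by simp⟩, ?_, by simp, by simp⟩
  · exact Finset.range_subset_range.2 (by omega)
  · intro x hx; simp at hx ⊢; omega
  · rw [Finset.disjoint_left]; intro x hx; simp at hx ⊢; omega

end Col

/-! ### The simulated oracle -/

/-- The expectation of `f` over the answer to a query and the new colouring, when the sampling
queries always reveal a fresh block of the expected type and all others are answered by `c`. -/
noncomputable def simE (U s : ℕ) (c : Col) : (q : Query) → (q.Answer → Col → ℝ≥0∞) → ℝ≥0∞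
  | .randVert, f => (2 * (c.fresh U).card : ℝ≥0∞)⁻¹ *
      ∑ b ∈ c.fresh U, ∑ x ∈ Col.blk s b 2, f x (insert b c.1, c.2)
  | .randEdge, f => (s.choose 2 * (c.fresh U).card : ℝ≥0∞)⁻¹ *
      ∑ b ∈ c.fresh U, ∑ e ∈ Col.pairs s b s, f e (c.1, insert b c.2)
  | .randNbr x, f => ∑' a, c.answer s (.randNbr x) a * f a c
  | .degree x, f => ∑' a, c.answer s (.degree x) a * f a c
  | .additive S, f => ∑' a, c.answer s (.additive S) a * f a c
  | .fullNbr x, f => ∑' a, c.answer s (.fullNbr x) a * f a c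

theorem simE_of_ne {U s : ℕ} {c : Col} {q : Query} (h1 : q ≠ .randVert) (h2 : q ≠ .randEdge)
    (f : q.Answer → Col → ℝ≥0∞) : simE U s c q f = ∑' a, c.answer s q a * f a c := by
  cases q with
  | randVert => exact absurd rfl h1
  | randEdge => exact absurd rfl h2
  | _ => rfl

theorem tsum_mul_add_le_one {α : Type*} (p : PMF α) {f g : α → ℝ≥0∞} (h : ∀ a, f a + g a ≤ 1) :
    ∑' a, p a * f a + ∑' a, p a * g a ≤ 1 := by
  rw [← ENNReal.tsum_add, ← p.tsum_coe]
  refine ENNReal.tsum_le_tsum fun a => ?_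
  rw [← mul_add]
  exact mul_le_of_le_one_right' (h a)

theorem inv_mul_double_sum_add_le_one {α : Type*} {B : Finset ℕ} {D : ℕ → Finset α} {w : ℕ}
    (hD : ∀ b, (D b).card = w) {f g : ℕ → α → ℝ≥0∞} (h : ∀ b a, f b a + g b a ≤ 1) :
    (w * B.card : ℝ≥0∞)⁻¹ * ∑ b ∈ B, ∑ a ∈ D b, f b a +
      (w * B.card : ℝ≥0∞)⁻¹ * ∑ b ∈ B, ∑ a ∈ D b, g b a ≤ 1 := by
  rw [← mul_add, ← Finset.sum_add_distrib]
  simp_rw [← Finset.sum_add_distrib]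
  calc _ ≤ (w * B.card : ℝ≥0∞)⁻¹ * ∑ b ∈ B, ∑ a ∈ D b, 1 := by
        gcongr; exact h _ _
    _ = (w * B.card : ℝ≥0∞)⁻¹ * (w * B.card) := by
        simp [hD, mul_comm]
    _ ≤ 1 := ENNReal.inv_mul_le_one _

theorem simE_add_le_one (U s : ℕ) (c : Col) (q : Query) {f g : q.Answer → Col → ℝ≥0∞}
    (h : ∀ a d, f a d + g a d ≤ 1) : simE U s c q f + simE U s c q g ≤ 1 := by
  cases q with
  | randVert =>
    have := inv_mul_double_sum_add_le_one (B := c.fresh U) (w := 2) (fun b => Col.card_blk (s := s) b 2)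
      (f := fun b x => f x (insert b c.1, c.2)) (g := fun b x => g x (insert b c.1, c.2))
      fun b a => h a _
    rw [Nat.cast_two] at this
    exact this
  | randEdge =>
    exact inv_mul_double_sum_add_le_one (B := c.fresh U) (fun b => Col.card_pairs (s := s) b s)
      (f := fun b x => f x (c.1, insert b c.2)) (g := fun b x => g x (c.1, insert b c.2))
      fun b a => h a _
  | randNbr x => exact tsum_mul_add_le_one (c.answer s (.randNbr x)) fun a => h a c
  | degree x => exact tsum_mul_add_le_one (c.answer s (.degree x)) fun a => h a c
  | additive S => exact tsum_mul_add_le_one (c.answer s (.additive S)) fun a => h a c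
  | fullNbr x => exact tsum_mul_add_le_one (c.answer s (.fullNbr x)) fun a => h a c

open Classical in
/-- The probability that `A` outputs an element of `T` at cost at most `b` when its queries are
answered by the simulated oracle. -/
noncomputable def simVal {M : Set Query} (U s : ℕ) (T : Set ℝ) : Alg M → ℕ → Col → ℝ≥0∞
  | .ret r, _, _ => if r ∈ T then 1 else 0
  | .toss p k, b, c => ∑' i, p i * simVal U s T (k i) b c
  | .query q _ k, b, c =>
      if q.cost ≤ b then simE U s c q fun a d => simVal U s T (k a) (b - q.cost) d else 0

/-- The simulation involves `U` and `s` but neither the number of edge blocks nor that of large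
cliques, so one run must serve both families of inputs, and its output cannot lie in two disjoint
sets. -/
theorem simVal_add_le_one {M : Set Query} (U s : ℕ) {T T' : Set ℝ} (hT : Disjoint T T')
    (A : Alg M) (b : ℕ) (c : Col) : simVal U s T A b c + simVal U s T' A b c ≤ 1 := by
  induction A generalizing b c with
  | ret r =>
    simp only [simVal]
    by_cases h : r ∈ T
    · simp [h, Set.disjoint_left.1 hT h]
    · simp only [h, if_false, zero_add]; split_ifs <;> simp
  | toss p k ih =>
    simp only [simVal]
    exact tsum_mul_add_le_one p fun i => ih i b c
  | query q hq k ih =>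
    simp only [simVal]
    split_ifs
    · exact simE_add_le_one U s c q fun a d => ih a _ d
    · simp

/-- The probability that `A` outputs an element of `T` at cost at most `q` on a clique graph. -/
noncomputable def colVal {M : Set Query} {s : ℕ} (hs : 2 < s) (T : Set ℝ) (c : Col) (A : Alg M)
    (q : ℕ) : ℝ≥0∞ :=
  -- An empty colouring is not an admissible input. The default `0` is harmless for upper bounds,
  -- and the colourings in `le_simVal_add` contain a large clique.
  if h : (c.1 ∪ c.2).Nonempty then val (c.toGraph hs h) T A q else 0

/-! ### Success probabilities on clique graphs -/

section colVal
variable {M : Set Query} {s : ℕ} (hs : 2 < s) (T : Set ℝ) {c : Col}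

theorem colVal_le_one (c : Col) (A : Alg M) (q : ℕ) : colVal hs T c A q ≤ 1 := by
  unfold colVal; split_ifs
  · exact val_le_one _ _ _ _
  · exact zero_le

open Classical in
theorem colVal_ret (c : Col) (r : ℝ) (q : ℕ) :
    colVal (M := M) hs T c (.ret r) q ≤ if r ∈ T then 1 else 0 := by
  rw [colVal]
  split_ifs <;> simp [val_ret, *]

theorem colVal_toss (c : Col) (p : PMF ℕ) (k : ℕ → Alg M) (q : ℕ) :
    colVal hs T c (.toss p k) q = ∑' i, p i * colVal hs T c (k i) q := by
  unfold colVal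
  split_ifs
  · exact val_toss _ _ _ _ _
  · simp

theorem colVal_query_of_lt (c : Col) (x : Query) (hx : x ∈ M) (k : x.Answer → Alg M) {q : ℕ}
    (h : q < x.cost) : colVal hs T c (.query x hx k) q = 0 := by
  unfold colVal
  split_ifs
  · exact val_query_of_lt _ _ _ _ _ h
  · rfl

theorem colVal_query_of_ne (c : Col) {x : Query} (hx : x ∈ M) (k : x.Answer → Alg M) (q : ℕ)
    (h1 : x ≠ .randVert) (h2 : x ≠ .randEdge) :
    colVal hs T c (.query x hx k) (q + x.cost) = ∑' a, c.answer s x a * colVal hs T c (k a) q := by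
  unfold colVal
  split_ifs with h
  · rw [val_query_add, Col.answer_toGraph hs c h h1 h2]
  · simp

theorem colVal_randVert (hc : Disjoint c.1 c.2) (hx : Query.randVert ∈ M)
    (k : ℕ → Alg M) (q : ℕ) :
    colVal hs T c (.query .randVert hx k) (q + 1) ≤
      ((2 * c.1.card + s * c.2.card : ℕ) : ℝ≥0∞)⁻¹ *
        (∑ b ∈ c.1, ∑ x ∈ Col.blk s b 2, colVal hs T c (k x) q +
          ∑ b ∈ c.2, ∑ x ∈ Col.blk s b s, colVal hs T c (k x) q) := by
  by_cases h : (c.1 ∪ c.2).Nonempty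
  · simp only [colVal, dif_pos h]
    rw [val_randVert]
    have hn := Col.n_toGraph hs c hc h
    rw [Graph.n] at hn
    rw [hn]
    refine mul_le_mul_right ?_ _
    exact (Col.sum_verts hs c hc fun x => val (c.toGraph hs h) T (k x) q).le
  · simp [colVal, h]

theorem colVal_randEdge (hc : Disjoint c.1 c.2) (hx : Query.randEdge ∈ M)
    (k : Sym2 ℕ → Alg M) (q : ℕ) :
    colVal hs T c (.query .randEdge hx k) (q + 1) ≤
      ((c.1.card + s.choose 2 * c.2.card : ℕ) : ℝ≥0∞)⁻¹ *
        (∑ b ∈ c.1, ∑ x ∈ Col.pairs s b 2, colVal hs T c (k x) q +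
          ∑ b ∈ c.2, ∑ x ∈ Col.pairs s b s, colVal hs T c (k x) q) := by
  by_cases h : (c.1 ∪ c.2).Nonempty
  · simp only [colVal, dif_pos h]
    rw [val_randEdge]
    rw [Col.card_edges_toGraph hs c hc h]
    refine mul_le_mul_right ?_ _
    exact (Col.sum_edges hs c hc h fun x => val (c.toGraph hs h) T (k x) q).le
  · simp [colVal, h]

end colVal

/-! ### Comparison of the true oracle with the simulated one -/

theorem sum_sum_le_card_mul {α : Type*} (S : Finset ℕ) {D : ℕ → Finset α} {w : ℕ}
    (hD : ∀ b, (D b).card = w) {f : α → ℝ≥0∞} (hf : ∀ a, f a ≤ 1) :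
    ∑ b ∈ S, ∑ a ∈ D b, f a ≤ (w * S.card : ℕ) := by
  calc _ ≤ ∑ b ∈ S, ∑ a ∈ D b, (1 : ℝ≥0∞) := by gcongr; exact hf _
    _ = _ := by simp [hD, mul_comm]

/-- The common computation for both kinds of samples. A given fresh block is used by at most a
fraction `l / B.card` of the `E` extensions, and a given element of it is then drawn with
probability `1/n`. As `w * l ≤ n`, the product is at most the uniform probability `1 / (w * B.card)`
of the simulation. -/
theorem inv_mul_reveal_le {α : Type*} {B : Finset ℕ} (hB : B.Nonempty) {D : ℕ → Finset α} {w : ℕ}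
    (hw : w ≠ 0) (hD : ∀ b, (D b).card = w) {E l n : ℕ} (hn : n ≠ 0) (hwl : w * l ≤ n) {N : ℕ → ℕ}
    (hN : ∀ b ∈ B, B.card * N b ≤ E * l) (F : ℕ → α → ℝ≥0∞) (δ : ℝ≥0∞) :
    (n : ℝ≥0∞)⁻¹ * ∑ b ∈ B, ∑ a ∈ D b, N b * (F b a + δ) ≤
      E * ((w * B.card : ℝ≥0∞)⁻¹ * ∑ b ∈ B, ∑ a ∈ D b, F b a + δ) := by
  have hB0 : (B.card : ℝ≥0∞) ≠ 0 := by simpa using hB.ne_empty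
  have hBt : (B.card : ℝ≥0∞) ≠ ⊤ := ENNReal.natCast_ne_top _
  have hw0 : (w : ℝ≥0∞) ≠ 0 := by simpa using hw
  have hwt : (w : ℝ≥0∞) ≠ ⊤ := ENNReal.natCast_ne_top _
  have hn0 : (n : ℝ≥0∞) ≠ 0 := by simpa using hn
  have hnt : (n : ℝ≥0∞) ≠ ⊤ := ENNReal.natCast_ne_top _
  have h1 : ∀ b ∈ B, (N b : ℝ≥0∞) ≤ (B.card : ℝ≥0∞)⁻¹ * (E * l) := by
    intro b hb
    rw [mul_comm, ← div_eq_mul_inv, ENNReal.le_div_iff_mul_le (Or.inl hB0) (Or.inl hBt), mul_comm]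
    exact_mod_cast hN b hb
  have h2 : (n : ℝ≥0∞)⁻¹ * l ≤ (w : ℝ≥0∞)⁻¹ := by
    rw [mul_comm, ← div_eq_mul_inv]
    refine ENNReal.div_le_of_le_mul ?_
    rw [mul_comm, ← div_eq_mul_inv, ENNReal.le_div_iff_mul_le (Or.inl hw0) (Or.inl hwt), mul_comm]
    exact_mod_cast hwl
  calc _ ≤ (n : ℝ≥0∞)⁻¹ * ∑ b ∈ B, ∑ a ∈ D b, (B.card : ℝ≥0∞)⁻¹ * (E * l) * (F b a + δ) := by
        refine mul_le_mul_right (Finset.sum_le_sum fun b hb => Finset.sum_le_sum fun a _ => ?_) _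
        exact mul_le_mul_left (h1 b hb) _
    _ = E * (((n : ℝ≥0∞)⁻¹ * l) * (B.card : ℝ≥0∞)⁻¹ * ∑ b ∈ B, ∑ a ∈ D b, (F b a + δ)) := by
        simp_rw [← Finset.mul_sum]; ring
    _ ≤ E * ((w : ℝ≥0∞)⁻¹ * (B.card : ℝ≥0∞)⁻¹ * ∑ b ∈ B, ∑ a ∈ D b, (F b a + δ)) := by
        gcongr
    _ = E * ((w * B.card : ℝ≥0∞)⁻¹ * ∑ b ∈ B, ∑ a ∈ D b, F b a + δ) := by
        have hsum : ∑ b ∈ B, ∑ a ∈ D b, (F b a + δ) =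
            ∑ b ∈ B, ∑ a ∈ D b, F b a + (w * B.card) * δ := by
          simp only [Finset.sum_add_distrib, Finset.sum_const, hD]
          simp; ring
        rw [hsum, ← ENNReal.mul_inv (Or.inl hw0) (Or.inl hwt), mul_add, ← mul_assoc (w * B.card : ℝ≥0∞)⁻¹,
          ENNReal.inv_mul_cancel (mul_ne_zero hw0 hB0) (ENNReal.mul_ne_top hwt hBt), one_mul]

section
variable {M : Set Query} {s : ℕ} (hs : 2 < s) (T : Set ℝ) {U l k Q : ℕ} {η : ℝ≥0∞}

theorem sum_tsum_mul_le {ι α : Type*} (S : Finset ι) (p : PMF α) {v : ι → α → ℝ≥0∞}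
    {I : α → ℝ≥0∞} {δ : ℝ≥0∞} (h : ∀ a, ∑ d ∈ S, v d a ≤ S.card * (I a + δ)) :
    ∑ d ∈ S, ∑' a, p a * v d a ≤ S.card * (∑' a, p a * I a + δ) := by
  rw [← Summable.tsum_finsetSum fun _ _ => ENNReal.summable]
  simp_rw [← Finset.mul_sum]
  calc ∑' a, p a * ∑ d ∈ S, v d a ≤ ∑' a, p a * (S.card * (I a + δ)) := by
        gcongr; exact h _
    _ = S.card * (∑' a, p a * I a + (∑' a, p a) * δ) := by
        rw [← ENNReal.tsum_mul_right, ← ENNReal.tsum_add, ← ENNReal.tsum_mul_left]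
        exact tsum_congr fun a => by ring
    _ = _ := by rw [p.tsum_coe, one_mul]

theorem Col.sz_eq_of_extends {c d : Col} (hd : Disjoint d.1 d.2) (h1 : c.1 ⊆ d.1) (h2 : c.2 ⊆ d.2)
    {b : ℕ} (hb : b ∈ c.1 ∪ c.2 ∨ b ∉ d.1 ∪ d.2) : d.sz s b = c.sz s b := by
  simp only [Finset.mem_union, not_or] at hb
  unfold Col.sz
  rcases hb with (hb | hb) | hb
  · have := Finset.disjoint_left.1 hd (h1 hb)
    rw [if_neg this, if_pos (h1 hb), if_neg (fun h => this (h2 h)), if_pos hb]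
  · rw [if_pos (h2 hb), if_pos hb]
  · rw [if_neg hb.2, if_neg hb.1, if_neg fun h => hb.2 (h2 h), if_neg fun h => hb.1 (h1 h)]

/-- Few extensions of `c` use an uncoloured block about which a query asks. -/
theorem card_ext_bad_le (hQ : Q < U) (hη : ((l + k : ℕ) : ℝ≥0∞) ≤ η * ((U - Q : ℕ) : ℝ≥0∞))
    {c : Col} (hc : c.1.card + c.2.card ≤ Q) (S : Finset ℕ) :
    (((c.ext U l k).filter fun d => ∃ x ∈ S, x / s ∉ c.1 ∪ c.2 ∧ x / s ∈ d.1 ∪ d.2).card : ℝ≥0∞) ≤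
      (c.ext U l k).card * (S.card * η) := by
  have hf := Col.le_card_fresh U c
  have hf0 : ((c.fresh U).card : ℝ≥0∞) ≠ 0 := by
    rw [Nat.cast_ne_zero]; omega
  have h1 : ((c.ext U l k).filter fun d => ∃ x ∈ S, x / s ∉ c.1 ∪ c.2 ∧ x / s ∈ d.1 ∪ d.2) ⊆
      (S.filter fun x => x / s ∉ c.1 ∪ c.2).biUnion fun x =>
        (c.ext U l k).filter fun d => x / s ∈ d.1 ∪ d.2 := by
    intro d hd
    rw [Finset.mem_filter] at hd
    obtain ⟨hd, x, hx, hx1, hx2⟩ := hd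
    exact Finset.mem_biUnion.2 ⟨x, Finset.mem_filter.2 ⟨hx, hx1⟩, Finset.mem_filter.2 ⟨hd, hx2⟩⟩
  have h2 : ∀ x ∈ S.filter (fun x => x / s ∉ c.1 ∪ c.2),
      (((c.ext U l k).filter fun d => x / s ∈ d.1 ∪ d.2).card : ℝ≥0∞) ≤ (c.ext U l k).card * η := by
    intro x hx
    have h3 := Col.card_ext_used_le (U := U) (l := l) (k := k) c (Finset.mem_filter.1 hx).2
    rw [← ENNReal.mul_le_mul_iff_right hf0 (ENNReal.natCast_ne_top _)]
    calc _ ≤ ((c.ext U l k).card : ℝ≥0∞) * ((l + k : ℕ) : ℝ≥0∞) := by exact_mod_cast h3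
      _ ≤ (c.ext U l k).card * (η * ((U - Q : ℕ) : ℝ≥0∞)) := by gcongr
      _ ≤ (c.ext U l k).card * (η * ((c.fresh U).card : ℝ≥0∞)) := by
          gcongr; omega
      _ = _ := by ring
  calc _ ≤ ((∑ x ∈ S.filter (fun x => x / s ∉ c.1 ∪ c.2),
        ((c.ext U l k).filter fun d => x / s ∈ d.1 ∪ d.2).card : ℕ) : ℝ≥0∞) := by
        exact_mod_cast (Finset.card_le_card h1).trans Finset.card_biUnion_le
    _ ≤ ∑ x ∈ S.filter (fun x => x / s ∉ c.1 ∪ c.2), (c.ext U l k).card * η := by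
        push_cast; exact Finset.sum_le_sum h2
    _ ≤ _ := by
        rw [Finset.sum_const, nsmul_eq_mul]
        calc _ ≤ (S.card : ℝ≥0∞) * ((c.ext U l k).card * η) := by
              gcongr; exact Finset.filter_subset _ _
          _ = _ := by ring

/-- The simulation misses only the draws from known edge blocks or from large cliques. These have
probability at most `(2 * Q + s * k) / (2 * l + s * k) ≤ η`; on all other draws the induction
hypothesis applies to the colouring with the revealed block added. -/
theorem sum_randVert_le (hk : 0 < k) (hQ : Q < U)
    (h1 : ((2 * Q + s * k : ℕ) : ℝ≥0∞) ≤ η * ((2 * l + s * k : ℕ) : ℝ≥0∞))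
    {c : Col} {b : ℕ} (hc : c.1.card + c.2.card + (b + 1) ≤ Q) (hx : Query.randVert ∈ M)
    (κ : ℕ → Alg M)
    (ih : ∀ (x : ℕ) (c : Col), c.1.card + c.2.card + b ≤ Q →
      ∑ d ∈ c.ext U l k, colVal hs T d (κ x) b ≤
        (c.ext U l k).card * (simVal U s T (κ x) b c + b * η)) :
    ∑ d ∈ c.ext U l k, colVal hs T d (.query .randVert hx κ) (b + 1) ≤
      (c.ext U l k).card *
        (simVal U s T (.query .randVert hx κ) (b + 1) c + ((b + 1 : ℕ) : ℝ≥0∞) * η) := by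
  have hf := Col.le_card_fresh U c
  have hn0 : 2 * l + s * k ≠ 0 := by positivity
  set n := 2 * l + s * k with hn
  have hne : (n : ℝ≥0∞) ≠ 0 := by exact_mod_cast hn0
  have hstep : ∀ d ∈ c.ext U l k, colVal hs T d (.query .randVert hx κ) (b + 1) ≤
      (n : ℝ≥0∞)⁻¹ * ∑ b' ∈ d.1 \ c.1, ∑ x ∈ Col.blk s b' 2, colVal hs T d (κ x) b + η := by
    intro d hd
    rw [Col.mem_ext] at hd
    obtain ⟨⟨⟨-, hl⟩, -, hk'⟩, hdis, hs1, hs2⟩ := hd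
    refine (colVal_randVert hs T hdis hx κ b).trans ?_
    rw [hl, hk', ← Finset.sum_sdiff hs1, ← hn, add_assoc, mul_add]
    gcongr
    have e1 := sum_sum_le_card_mul c.1 (fun b => Col.card_blk (s := s) b 2)
      (f := fun x => colVal hs T d (κ x) b) (fun a => colVal_le_one hs T d _ _)
    have e2 := sum_sum_le_card_mul d.2 (fun b => Col.card_blk (s := s) b s)
      (f := fun x => colVal hs T d (κ x) b) (fun a => colVal_le_one hs T d _ _)
    calc _ ≤ (n : ℝ≥0∞)⁻¹ * ((2 * Q + s * k : ℕ) : ℝ≥0∞) := by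
          gcongr
          refine (add_le_add e1 e2).trans ?_
          rw [hk']
          have : c.1.card ≤ Q := by omega
          exact_mod_cast Nat.add_le_add_right (Nat.mul_le_mul_left 2 this) _
      _ ≤ (n : ℝ≥0∞)⁻¹ * (η * n) := by gcongr
      _ = η := by
          rw [mul_comm η, ← mul_assoc, ENNReal.inv_mul_cancel hne (ENNReal.natCast_ne_top _), one_mul]
  calc _ ≤ ∑ d ∈ c.ext U l k, ((n : ℝ≥0∞)⁻¹ *
        ∑ b' ∈ d.1 \ c.1, ∑ x ∈ Col.blk s b' 2, colVal hs T d (κ x) b + η) :=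
        Finset.sum_le_sum hstep
    -- The new block is now chosen before the extension, so that `ih` applies to `insert b' c.1`.
    _ = (n : ℝ≥0∞)⁻¹ * ∑ b' ∈ c.fresh U, ∑ x ∈ Col.blk s b' 2,
          ∑ d ∈ Col.ext U l k (insert b' c.1, c.2), colVal hs T d (κ x) b +
        (c.ext U l k).card * η := by
        rw [Finset.sum_add_distrib, ← Finset.mul_sum, Col.sum_ext_light]
        simp only [Finset.sum_const, nsmul_eq_mul]
        congr 2
        exact Finset.sum_congr rfl fun b' _ => Finset.sum_comm
    _ ≤ (n : ℝ≥0∞)⁻¹ * ∑ b' ∈ c.fresh U, ∑ x ∈ Col.blk s b' 2,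
          (Col.ext U l k (insert b' c.1, c.2)).card *
            (simVal U s T (κ x) b (insert b' c.1, c.2) + b * η) +
        (c.ext U l k).card * η := by
        gcongr with b' hb' x
        refine ih x _ ?_
        have := Finset.card_insert_le b' c.1
        simp only; omega
    _ ≤ (c.ext U l k).card * (((2 : ℕ) * (c.fresh U).card : ℝ≥0∞)⁻¹ * ∑ b' ∈ c.fresh U,
          ∑ x ∈ Col.blk s b' 2, simVal U s T (κ x) b (insert b' c.1, c.2) + b * η) +
        (c.ext U l k).card * η := by
        refine add_le_add ?_ le_rfl
        exact inv_mul_reveal_le (B := c.fresh U) (l := l) (Finset.card_pos.1 (by omega)) two_ne_zero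
          (fun b => Col.card_blk (s := s) b 2) hn0 (by omega) (fun b' hb' => Col.card_ext_light hb')
          (fun b' x => simVal U s T (κ x) b (insert b' c.1, c.2)) _
    _ = _ := by
        simp only [simVal, Query.cost, Nat.le_add_left, if_true, simE, Nat.add_sub_cancel]
        push_cast
        ring

/-- Same argument with the roles exchanged: the missed draws are the single edges and the edges of
cliques already known. -/
theorem sum_randEdge_le (hk : 0 < k) (hQ : Q < U)
    (h2 : ((l + s.choose 2 * Q : ℕ) : ℝ≥0∞) ≤ η * ((l + s.choose 2 * k : ℕ) : ℝ≥0∞))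
    {c : Col} {b : ℕ} (hc : c.1.card + c.2.card + (b + 1) ≤ Q) (hx : Query.randEdge ∈ M)
    (κ : Sym2 ℕ → Alg M)
    (ih : ∀ (x : Sym2 ℕ) (c : Col), c.1.card + c.2.card + b ≤ Q →
      ∑ d ∈ c.ext U l k, colVal hs T d (κ x) b ≤
        (c.ext U l k).card * (simVal U s T (κ x) b c + b * η)) :
    ∑ d ∈ c.ext U l k, colVal hs T d (.query .randEdge hx κ) (b + 1) ≤
      (c.ext U l k).card *
        (simVal U s T (.query .randEdge hx κ) (b + 1) c + ((b + 1 : ℕ) : ℝ≥0∞) * η) := by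
  have hf := Col.le_card_fresh U c
  have hs2 : 0 < s.choose 2 := Nat.choose_pos (by omega)
  have hn0 : l + s.choose 2 * k ≠ 0 := by positivity
  set n := l + s.choose 2 * k with hn
  have hne : (n : ℝ≥0∞) ≠ 0 := by exact_mod_cast hn0
  have hstep : ∀ d ∈ c.ext U l k, colVal hs T d (.query .randEdge hx κ) (b + 1) ≤
      (n : ℝ≥0∞)⁻¹ * ∑ b' ∈ d.2 \ c.2, ∑ x ∈ Col.pairs s b' s, colVal hs T d (κ x) b + η := by
    intro d hd
    rw [Col.mem_ext] at hd
    obtain ⟨⟨⟨-, hl⟩, -, hk'⟩, hdis, hs1, hs2⟩ := hd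
    refine (colVal_randEdge hs T hdis hx κ b).trans ?_
    rw [hl, hk', ← Finset.sum_sdiff hs2, ← hn, add_left_comm, mul_add]
    gcongr
    have e1 := sum_sum_le_card_mul d.1 (fun b => Col.card_pairs (s := s) b 2)
      (f := fun x => colVal hs T d (κ x) b) (fun a => colVal_le_one hs T d _ _)
    have e2 := sum_sum_le_card_mul c.2 (fun b => Col.card_pairs (s := s) b s)
      (f := fun x => colVal hs T d (κ x) b) (fun a => colVal_le_one hs T d _ _)
    calc _ ≤ (n : ℝ≥0∞)⁻¹ * ((l + s.choose 2 * Q : ℕ) : ℝ≥0∞) := by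
          gcongr
          refine (add_le_add e1 e2).trans ?_
          rw [hl, Nat.choose_self, one_mul]
          have : c.2.card ≤ Q := by omega
          exact_mod_cast Nat.add_le_add_left (Nat.mul_le_mul_left _ this) _
      _ ≤ (n : ℝ≥0∞)⁻¹ * (η * n) := by gcongr
      _ = η := by
          rw [mul_comm η, ← mul_assoc, ENNReal.inv_mul_cancel hne (ENNReal.natCast_ne_top _), one_mul]
  calc _ ≤ ∑ d ∈ c.ext U l k, ((n : ℝ≥0∞)⁻¹ *
        ∑ b' ∈ d.2 \ c.2, ∑ x ∈ Col.pairs s b' s, colVal hs T d (κ x) b + η) :=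
        Finset.sum_le_sum hstep
    _ = (n : ℝ≥0∞)⁻¹ * ∑ b' ∈ c.fresh U, ∑ x ∈ Col.pairs s b' s,
          ∑ d ∈ Col.ext U l k (c.1, insert b' c.2), colVal hs T d (κ x) b +
        (c.ext U l k).card * η := by
        rw [Finset.sum_add_distrib, ← Finset.mul_sum, Col.sum_ext_heavy]
        simp only [Finset.sum_const, nsmul_eq_mul]
        congr 2
        exact Finset.sum_congr rfl fun b' _ => Finset.sum_comm
    _ ≤ (n : ℝ≥0∞)⁻¹ * ∑ b' ∈ c.fresh U, ∑ x ∈ Col.pairs s b' s,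
          (Col.ext U l k (c.1, insert b' c.2)).card *
            (simVal U s T (κ x) b (c.1, insert b' c.2) + b * η) +
        (c.ext U l k).card * η := by
        gcongr with b' hb' x
        refine ih x _ ?_
        have := Finset.card_insert_le b' c.2
        simp only; omega
    _ ≤ (c.ext U l k).card * ((s.choose 2 * (c.fresh U).card : ℝ≥0∞)⁻¹ * ∑ b' ∈ c.fresh U,
          ∑ x ∈ Col.pairs s b' s, simVal U s T (κ x) b (c.1, insert b' c.2) + b * η) +
        (c.ext U l k).card * η := by
        refine add_le_add ?_ le_rfl
        exact inv_mul_reveal_le (B := c.fresh U) (l := k) (Finset.card_pos.1 (by omega)) hs2.ne'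
          (fun b => Col.card_pairs (s := s) b s) hn0 (by omega) (fun b' hb' => Col.card_ext_heavy hb')
          (fun b' x => simVal U s T (κ x) b (c.1, insert b' c.2)) _
    _ = _ := by
        simp only [simVal, Query.cost, Nat.le_add_left, if_true, simE, Nat.add_sub_cancel]
        push_cast
        ring

/-- The partial colouring answers wrongly only if some label of the query lies in an uncoloured
block that the extension uses. Each label contributes `η`, and there are at most `x.cost` labels. -/
theorem sum_query_le (hQ : Q < U) (h3 : ((l + k : ℕ) : ℝ≥0∞) ≤ η * ((U - Q : ℕ) : ℝ≥0∞))
    {c : Col} {b : ℕ} {x : Query} (hx1 : x ≠ .randVert) (hx2 : x ≠ .randEdge)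
    (hc : c.1.card + c.2.card + (b + x.cost) ≤ Q) (hx : x ∈ M) (κ : x.Answer → Alg M)
    (ih : ∀ (a : x.Answer) (c : Col), c.1.card + c.2.card + b ≤ Q →
      ∑ d ∈ c.ext U l k, colVal hs T d (κ a) b ≤
        (c.ext U l k).card * (simVal U s T (κ a) b c + b * η)) :
    ∑ d ∈ c.ext U l k, colVal hs T d (.query x hx κ) (b + x.cost) ≤
      (c.ext U l k).card *
        (simVal U s T (.query x hx κ) (b + x.cost) c + ((b + x.cost : ℕ) : ℝ≥0∞) * η) := by
  classical
  set P : Col → Prop := fun d => ∃ y ∈ x.labels, y / s ∉ c.1 ∪ c.2 ∧ y / s ∈ d.1 ∪ d.2 with hP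
  have hstep : ∀ d ∈ c.ext U l k, colVal hs T d (.query x hx κ) (b + x.cost) ≤
      ∑' a, c.answer s x a * colVal hs T d (κ a) b + if P d then 1 else 0 := by
    intro d hd
    rw [Col.mem_ext] at hd
    by_cases hPd : P d
    · rw [if_pos hPd]
      exact (colVal_le_one hs T d _ _).trans le_add_self
    · rw [if_neg hPd, add_zero, colVal_query_of_ne hs T d hx κ b hx1 hx2]
      rw [Col.answer_congr hs (c' := c)]
      intro y hy
      refine Col.sz_eq_of_extends hd.2.1 hd.2.2.1 hd.2.2.2 ?_
      by_contra h
      push Not at h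
      exact hPd ⟨y, hy, h⟩
  have hbad := card_ext_bad_le (s := s) hQ h3 (c := c) (by omega) x.labels
  calc _ ≤ ∑ d ∈ c.ext U l k, (∑' a, c.answer s x a * colVal hs T d (κ a) b +
          if P d then 1 else 0) := Finset.sum_le_sum hstep
    _ = ∑ d ∈ c.ext U l k, ∑' a, c.answer s x a * colVal hs T d (κ a) b +
          (((c.ext U l k).filter P).card : ℝ≥0∞) := by
        rw [Finset.sum_add_distrib, Finset.sum_boole]
    _ ≤ (c.ext U l k).card * (∑' a, c.answer s x a * simVal U s T (κ a) b c + b * η) +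
          (c.ext U l k).card * (x.cost * η) := by
        refine add_le_add ?_ ?_
        · exact sum_tsum_mul_le _ _ fun a => ih a c (by omega)
        · refine (le_of_eq ?_).trans (hbad.trans ?_)
          · congr!
          · gcongr; exact x.card_labels_le
    _ = _ := by
        simp only [simVal, Nat.le_add_left, if_true, simE_of_ne hx1 hx2, Nat.add_sub_cancel]
        push_cast
        ring

/-- On average over the extensions of a colouring, an algorithm is not more successful than with
the simulated oracle, up to an error that is proportional to its cost. -/
theorem sum_colVal_le (hk : 0 < k) (hQ : Q < U)
    (h1 : ((2 * Q + s * k : ℕ) : ℝ≥0∞) ≤ η * ((2 * l + s * k : ℕ) : ℝ≥0∞))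
    (h2 : ((l + s.choose 2 * Q : ℕ) : ℝ≥0∞) ≤ η * ((l + s.choose 2 * k : ℕ) : ℝ≥0∞))
    (h3 : ((l + k : ℕ) : ℝ≥0∞) ≤ η * ((U - Q : ℕ) : ℝ≥0∞))
    (A : Alg M) (b : ℕ) (c : Col) (hc : c.1.card + c.2.card + b ≤ Q) :
    ∑ d ∈ c.ext U l k, colVal hs T d A b ≤
      (c.ext U l k).card * (simVal U s T A b c + b * η) := by
  induction A generalizing b c with
  | ret r =>
    calc _ ≤ ∑ d ∈ c.ext U l k, simVal (M := M) U s T (.ret r) b c :=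
          Finset.sum_le_sum fun d _ => colVal_ret hs T d r b
      _ ≤ _ := by
          rw [Finset.sum_const, nsmul_eq_mul]
          gcongr; exact le_self_add
  | toss p κ ih =>
    simp only [colVal_toss, simVal]
    exact sum_tsum_mul_le _ _ fun i => ih i b c hc
  | query x hx κ ih =>
    by_cases hb : x.cost ≤ b
    · obtain ⟨b, rfl⟩ := Nat.exists_eq_add_of_le' hb
      by_cases hx1 : x = .randVert
      · subst hx1
        exact sum_randVert_le hs T hk hQ h1 hc hx κ fun a c hc => ih a b c hc
      by_cases hx2 : x = .randEdge
      · subst hx2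
        exact sum_randEdge_le hs T hk hQ h2 hc hx κ fun a c hc => ih a b c hc
      exact sum_query_le hs T hQ h3 hx1 hx2 hc hx κ fun a c hc => ih a b c hc
    · rw [Finset.sum_eq_zero fun d _ => colVal_query_of_lt hs T d x hx κ (not_le.1 hb)]
      exact zero_le

end

/-- All extensions of the empty colouring have the same number of vertices and the same average
degree, so the guarantee `p` holds for each of them and hence on average, where `sum_colVal_le`
applies. -/
theorem le_simVal_add {M : Set Query} {s : ℕ} (hs : 2 < s) (T : Set ℝ) {U l k Q : ℕ} {η p : ℝ≥0∞}
    (hk : 0 < k) (hQ : Q < U) (hU : l + k ≤ U)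
    (h1 : ((2 * Q + s * k : ℕ) : ℝ≥0∞) ≤ η * ((2 * l + s * k : ℕ) : ℝ≥0∞))
    (h2 : ((l + s.choose 2 * Q : ℕ) : ℝ≥0∞) ≤ η * ((l + s.choose 2 * k : ℕ) : ℝ≥0∞))
    (h3 : ((l + k : ℕ) : ℝ≥0∞) ≤ η * ((U - Q : ℕ) : ℝ≥0∞)) (A : Alg M)
    (hp : ∀ G : Graph, G.n = 2 * l + s * k → G.avgDeg * (G.n : ℝ) = 2 * l + s * (s - 1) * k →
      p ≤ val G T A Q) :
    p ≤ simVal U s T A Q (∅, ∅) + Q * η := by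
  have hne := Col.ext_nonempty hU
  have hc0 : ((Col.ext U l k (∅, ∅)).card : ℝ≥0∞) ≠ 0 := by simpa using hne.ne_empty
  rw [← ENNReal.mul_le_mul_iff_right hc0 (ENNReal.natCast_ne_top _)]
  refine le_trans ?_ (sum_colVal_le hs T hk hQ h1 h2 h3 A Q (∅, ∅) (by simp))
  rw [← nsmul_eq_mul, ← Finset.sum_const]
  refine Finset.sum_le_sum fun d hd => ?_
  obtain ⟨⟨⟨-, hl⟩, -, hk'⟩, hdis, -⟩ := Col.mem_ext.1 hd
  have hd' : (d.1 ∪ d.2).Nonempty := by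
    obtain ⟨b, hb⟩ := Finset.card_pos.1 (hk'.symm ▸ hk)
    exact ⟨b, Finset.mem_union_right _ hb⟩
  rw [colVal, dif_pos hd']
  refine hp _ ?_ ?_
  · rw [Col.n_toGraph hs d hdis, hl, hk']
  · rw [Col.avgDeg_toGraph hs d hdis, hl, hk']

/-! ### Parameters of the lower bound -/

theorem natCast_le_ofReal_mul {a b : ℕ} {x : ℝ} (hx : 0 ≤ x) (h : (a : ℝ) ≤ x * b) :
    (a : ℝ≥0∞) ≤ ENNReal.ofReal x * b := by
  rw [← ENNReal.ofReal_natCast a, ← ENNReal.ofReal_natCast b, ← ENNReal.ofReal_mul hx]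
  exact ENNReal.ofReal_le_ofReal h

theorem choose_two_two_mul_sq_add_one (r : ℕ) : (2 * r ^ 2 + 1).choose 2 = r ^ 2 * (2 * r ^ 2 + 1) := by
  rw [Nat.choose_two_right, Nat.add_sub_cancel]
  refine Nat.div_eq_of_eq_mul_left two_pos ?_
  ring

/-- The clique graphs at the scale that is relevant for the lower bound: about `r ^ 2` cliques of
size about `r ^ 2` on about `r ^ 5` vertices. -/
theorem le_simVal_add_of_scale {M : Set Query} (T : Set ℝ) {r n a k Q : ℕ} {p : ℝ≥0∞} (ha : 1 ≤ a)
    (hr : 9 * a ≤ r) (hn : r ^ 5 ≤ n) (hn' : n ≤ 32 * r ^ 5) (hk : 2 * r ^ 2 ≤ k)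
    (hk' : k ≤ 3 * a * r ^ 2) (hpar : k % 2 = n % 2) (hQ : Q ≤ r) (A : Alg M)
    (hp : ∀ G : Graph, G.n = n → G.avgDeg * n = n + (2 * r ^ 2 + 1) * (2 * r ^ 2 - 1) * k →
      p ≤ val G T A Q) :
    p ≤ simVal (n * n + 2 * n) (2 * r ^ 2 + 1) T A Q (∅, ∅) +
      Q * ENNReal.ofReal (11 * a / r) := by
  have hr0 : 0 < r := by omega
  have hr1 : 9 ≤ r := by omega
  have hr2 : r ≤ r ^ 2 := by nlinarith
  set s := 2 * r ^ 2 + 1 with hs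
  have hsk : s * k ≤ n := by
    calc s * k ≤ (3 * r ^ 2) * (3 * a * r ^ 2) := Nat.mul_le_mul (by nlinarith) hk'
      _ = (9 * a) * r ^ 4 := by ring
      _ ≤ r * r ^ 4 := Nat.mul_le_mul_right _ hr
      _ = r ^ 5 := by ring
      _ ≤ n := hn
  -- The clique size is odd, so `s * k` has the parity of `n` and the remaining vertices can be
  -- paired into single edges.
  have hskpar : (s * k) % 2 = n % 2 := by
    rw [Nat.mul_mod, hpar, show s % 2 = 1 by omega, one_mul, Nat.mod_mod]
  obtain ⟨l, hl⟩ : ∃ l, n = 2 * l + s * k := ⟨(n - s * k) / 2, by omega⟩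
  have hrn : r ≤ n := le_trans (by calc r = r ^ 1 := (pow_one r).symm
                                    _ ≤ r ^ 5 := Nat.pow_le_pow_right hr0 (by norm_num)) hn
  have hks : k ≤ s * k := Nat.le_mul_of_pos_left _ (by omega)
  have hlk : l + k ≤ n := by omega
  have hrR : (0 : ℝ) < r := by exact_mod_cast hr0
  have hη : (0 : ℝ) ≤ 11 * a / r := by positivity
  have haR : (1 : ℝ) ≤ a := by exact_mod_cast ha
  have hQR : (Q : ℝ) ≤ r := by exact_mod_cast hQ
  have hnR : (r : ℝ) ^ 5 ≤ n := by exact_mod_cast hn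
  have hnR' : (n : ℝ) ≤ 32 * r ^ 5 := by exact_mod_cast hn'
  have hkR : 2 * (r : ℝ) ^ 2 ≤ k := by exact_mod_cast hk
  have hkR' : (k : ℝ) ≤ 3 * a * r ^ 2 := by exact_mod_cast hk'
  have hr1R : (9 : ℝ) ≤ r := by exact_mod_cast hr1
  have hsR : (s : ℝ) = 2 * r ^ 2 + 1 := by rw [hs]; push_cast; ring
  have hsR' : (s : ℝ) ≤ 3 * r ^ 2 := by rw [hsR]; nlinarith
  refine le_simVal_add (l := l) (k := k) (s := s) (by nlinarith) T (by nlinarith) (by nlinarith)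
    (by nlinarith) ?_ ?_ ?_ A ?_
  -- Random vertices: the cliques contain at most `9 * a * r^4` vertices and the known edges at most
  -- `2 * a * r^4`, out of at least `r^5`. This is where `11 = 9 + 2` comes from.
  · refine natCast_le_ofReal_mul hη ?_
    rw [← hl]
    push_cast
    rw [div_mul_eq_mul_div, le_div_iff₀ hrR]
    have e1 : (s : ℝ) * k ≤ 3 * r ^ 2 * (3 * a * r ^ 2) := by gcongr
    have e2 : (2 * (Q : ℝ)) ≤ 2 * a * r ^ 4 := by
      have : (r : ℝ) ≤ r ^ 4 := le_self_pow₀ (by linarith) (by norm_num)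
      nlinarith [pow_pos hrR 4]
    calc (2 * (Q : ℝ) + s * k) * r ≤ (2 * a * r ^ 4 + 3 * r ^ 2 * (3 * a * r ^ 2)) * r := by gcongr
      _ = 11 * a * r ^ 5 := by ring
      _ ≤ 11 * a * n := by gcongr
  -- Random edges: the cliques carry order `r^6` edges against `l ≤ 16 * r^5` single ones, and at
  -- most `Q ≤ r` of at least `2 * r^2` cliques are known.
  · refine natCast_le_ofReal_mul hη ?_
    rw [hs, choose_two_two_mul_sq_add_one]
    push_cast
    rw [div_mul_eq_mul_div, le_div_iff₀ hrR]
    have e0 : 2 * (l : ℝ) ≤ 32 * r ^ 5 := by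
      have : 2 * (l : ℝ) ≤ n := by exact_mod_cast (by omega : 2 * l ≤ n)
      linarith
    have e1 : (l : ℝ) * r ≤ 4 * ((r : ℝ) ^ 2 * (2 * r ^ 2 + 1) * k) := by
      calc (l : ℝ) * r ≤ 16 * r ^ 5 * r := by gcongr; linarith
        _ = 4 * ((r : ℝ) ^ 2 * (2 * r ^ 2) * (2 * r ^ 2)) - 0 := by ring
        _ ≤ 4 * ((r : ℝ) ^ 2 * (2 * r ^ 2 + 1) * k) := by
          rw [sub_zero]; gcongr; linarith
    have e2 : (r : ℝ) ^ 2 * (2 * r ^ 2 + 1) * Q * r ≤ (r : ℝ) ^ 2 * (2 * r ^ 2 + 1) * k := by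
      rw [mul_assoc _ (Q : ℝ)]; gcongr; nlinarith
    have e3 : 0 ≤ (r : ℝ) ^ 2 * (2 * r ^ 2 + 1) * k := by positivity
    have e4 : (0 : ℝ) ≤ l := by positivity
    nlinarith
  -- Guessed labels: at most `n` blocks are used out of more than `n^2`.
  · refine natCast_le_ofReal_mul hη ?_
    rw [div_mul_eq_mul_div, le_div_iff₀ hrR]
    have e1 : n * n ≤ n * n + 2 * n - Q := by omega
    have e1R : (n : ℝ) * n ≤ ((n * n + 2 * n - Q : ℕ) : ℝ) := by exact_mod_cast e1
    have e2 : ((l + k : ℕ) : ℝ) ≤ n := by exact_mod_cast hlk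
    have e3 : (r : ℝ) ≤ n := by exact_mod_cast hrn
    calc ((l + k : ℕ) : ℝ) * r ≤ n * n := by gcongr
      _ ≤ 1 * ((n * n + 2 * n - Q : ℕ) : ℝ) := by linarith
      _ ≤ _ := by gcongr; linarith
  · intro G hG hd
    refine hp G (hG.trans hl.symm) ?_
    rw [hG, ← hl] at hd
    rw [hd]
    have : (n : ℝ) = 2 * l + s * k := by exact_mod_cast hl
    rw [this, hsR]; ring

/-- The families with clique multiplicities `b = 1` and `b = a`, where `a > 2 * c^2`, have no common
`c`-approximation but the same simulation. Adding the two bounds gives `2 * p ≤ 1 + 2 * Q * (11 * a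
/ r)`, which fails if `Q` is a small multiple of `r`. -/
theorem query_lower_bound (c : ℝ) (p : ℝ≥0∞) (hc : 1 ≤ c) (hp : 1 / 2 < p) :
    ∃ (κ : ℝ) (N : ℕ), 0 < κ ∧ ∀ n : ℕ, N ≤ n → ∀ (A : Alg fullNbrModel) (q : ℝ),
      (∀ G : Graph, G.n = n → p ≤ successProb A G c q) → κ * (n : ℝ) ^ (1 / 5 : ℝ) ≤ q := by
  obtain ⟨g, hg0, hg⟩ : ∃ g : ℝ, 0 < g ∧ ENNReal.ofReal (1 / 2 + g) ≤ p := by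
    obtain ⟨x, hx1, hx2⟩ := exists_between hp
    have hxt : x ≠ ⊤ := (lt_of_lt_of_le hx2 le_top).ne
    have h2 : 1 / 2 < x.toReal := by
      have := (ENNReal.toReal_lt_toReal (by simp) hxt).2 hx1
      simpa using this
    refine ⟨x.toReal - 1 / 2, by linarith, ?_⟩
    rw [add_sub_cancel, ENNReal.ofReal_toReal hxt]
    exact hx2.le
  set a : ℕ := ⌈2 * c ^ 2⌉₊ + 1 with ha
  have ha1 : 1 ≤ a := by omega
  have hac : 2 * c ^ 2 < a := by
    rw [ha]; push_cast
    linarith [Nat.le_ceil (2 * c ^ 2)]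
  have haR : (0 : ℝ) < a := by exact_mod_cast ha1
  -- Since `Q ≤ 2 * κ * r`, the first bound gives `Q ≤ r` and the second makes the simulation error
  -- `Q * (11 * a / r)` at most `g / 2`.
  set κ : ℝ := min (1 / 2) (g / (44 * a)) with hκ
  have hκ0 : 0 < κ := by positivity
  -- `r ≥ 9 * a` makes the cliques fit into `n` vertices; `r ≥ 32` makes the clique edges dominate
  -- `n ≤ 32 * r^5`.
  refine ⟨κ, (max (9 * a) 32) ^ 5, hκ0, fun n hn A q hA => ?_⟩
  by_contra hq
  rw [not_le] at hq
  set x : ℝ := (n : ℝ) ^ (1 / 5 : ℝ) with hx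
  have hx0 : 0 ≤ x := by positivity
  have hx5 : x ^ 5 = n := by
    rw [hx, ← Real.rpow_natCast, ← Real.rpow_mul (by positivity)]; norm_num
  set r : ℕ := ⌊x⌋₊ with hr
  have hrx : (r : ℝ) ≤ x := Nat.floor_le hx0
  have hxr : x < r + 1 := Nat.lt_floor_add_one x
  have hR0 : max (9 * a) 32 ≤ r := by
    rw [hr, Nat.le_floor_iff hx0]
    refine le_of_pow_le_pow_left₀ (n := 5) (by norm_num) hx0 ?_
    rw [hx5]; exact_mod_cast hn
  have hr9 : 9 * a ≤ r := (le_max_left _ _).trans hR0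
  have hr32 : 32 ≤ r := (le_max_right _ _).trans hR0
  have hrR : (32 : ℝ) ≤ r := by exact_mod_cast hr32
  have hx2r : x ≤ 2 * r := by linarith
  have hn1 : r ^ 5 ≤ n := by
    have : (r : ℝ) ^ 5 ≤ n := by rw [← hx5]; gcongr
    exact_mod_cast this
  have hn2 : n ≤ 32 * r ^ 5 := by
    have : (n : ℝ) ≤ 32 * r ^ 5 := by
      calc (n : ℝ) = x ^ 5 := hx5.symm
        _ ≤ (2 * r) ^ 5 := by gcongr
        _ = 32 * r ^ 5 := by ring
    exact_mod_cast this
  have hr2 : 1 ≤ r ^ 2 := Nat.one_le_pow _ _ (by omega)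
  set Q : ℕ := ⌊q⌋₊ with hQ
  have hQr : (Q : ℝ) ≤ 2 * κ * r := by
    rcases le_or_gt 0 q with h0 | h0
    · calc (Q : ℝ) ≤ q := Nat.floor_le h0
        _ ≤ κ * x := hq.le
        _ ≤ κ * (2 * r) := by gcongr
        _ = 2 * κ * r := by ring
    · rw [hQ, Nat.floor_of_nonpos h0.le]; simp; positivity
  have hQr' : Q ≤ r := by
    have : κ ≤ 1 / 2 := min_le_left _ _
    have : (Q : ℝ) ≤ r := by nlinarith
    exact_mod_cast this
  have hval : ∀ G : Graph, G.n = n → p ≤ val G {y | IsApprox c G.avgDeg y} A Q := by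
    intro G hG
    refine (hA G hG).trans ?_
    rcases le_or_gt 0 q with h0 | h0
    · exact (successProb_eq_val G A c h0).le
    · have : {o : ℝ × ℕ | IsApprox c G.avgDeg o.1 ∧ (o.2 : ℝ) ≤ q} = ∅ := by
        ext o
        simp only [Set.mem_ofPred_eq, Set.mem_empty_iff_false, iff_false, not_and, not_le]
        intro _
        exact h0.trans_le (Nat.cast_nonneg _)
      rw [successProb, this]; simp
  have hn0 : (0 : ℝ) < n := by
    have : 0 < r ^ 5 := by positivity
    exact_mod_cast this.trans_le hn1
  have main : ∀ b k : ℕ, 1 ≤ b → b ≤ a → k = 2 * b * r ^ 2 + n % 2 →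
      p ≤ simVal (n * n + 2 * n) (2 * r ^ 2 + 1)
        {y | IsApprox c ((n + (2 * r ^ 2 + 1) * (2 * r ^ 2 - 1) * k) / n) y} A Q (∅, ∅) +
        Q * ENNReal.ofReal (11 * a / r) := by
    intro b k hb hba hk
    have hbr : r ^ 2 ≤ b * r ^ 2 := Nat.le_mul_of_pos_left _ hb
    have hba' : b * r ^ 2 ≤ a * r ^ 2 := Nat.mul_le_mul_right _ hba
    have hpar : n % 2 < 2 := Nat.mod_lt _ two_pos
    refine le_simVal_add_of_scale (k := k) _ ha1 hr9 hn1 hn2 (by rw [hk, mul_assoc]; omega) ?_ ?_ hQr' A ?_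
    · rw [hk, mul_assoc, mul_assoc]; omega
    · rw [hk, mul_assoc]; omega
    · intro G hG hd
      rw [← hd, mul_div_cancel_right₀ _ hn0.ne']
      exact hval G hG
  have m0 := main 1 _ le_rfl ha1 rfl
  have m1 := main a _ ha1 le_rfl rfl
  set k0 := 2 * 1 * r ^ 2 + n % 2 with hk0
  set k1 := 2 * a * r ^ 2 + n % 2 with hk1
  -- After multiplication by `n`, the smaller degree is at most `4 * r^2 * w` and the larger at
  -- least `2 * a * r^2 * w`; their ratio exceeds `c^2` because `a > 2 * c^2`.
  have hdisj : Disjoint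
      {y | IsApprox c ((n + (2 * r ^ 2 + 1) * (2 * r ^ 2 - 1) * k0) / n) y}
      {y | IsApprox c ((n + (2 * r ^ 2 + 1) * (2 * r ^ 2 - 1) * k1) / n) y} := by
    rw [Set.disjoint_left]
    rintro y ⟨-, h1⟩ ⟨h2, -⟩
    have hc0 : 0 < c := by linarith
    rw [div_le_iff₀ hc0, div_le_iff₀ hn0] at h2
    rw [← mul_div_assoc, le_div_iff₀ hn0] at h1
    have hnR : (n : ℝ) ≤ 32 * r ^ 5 := by exact_mod_cast hn2
    set w : ℝ := (2 * r ^ 2 + 1) * (2 * r ^ 2 - 1) with hw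
    have hw1 : 3 * (r : ℝ) ^ 4 ≤ w := by
      have : w = 4 * (r : ℝ) ^ 4 - 1 := by rw [hw]; ring
      have h1r : (1 : ℝ) ≤ r ^ 4 := one_le_pow₀ (by linarith)
      linarith
    have hk0R : (k0 : ℝ) ≤ 2 * r ^ 2 + 1 := by
      have : k0 ≤ 2 * r ^ 2 + 1 := by omega
      exact_mod_cast this
    have hk1R : 2 * a * (r : ℝ) ^ 2 ≤ k1 := by
      have : 2 * a * r ^ 2 ≤ k1 := by omega
      exact_mod_cast this
    have hr2R : (1 : ℝ) ≤ r ^ 2 := one_le_pow₀ (by linarith)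
    have hwpos : 0 < w := lt_of_lt_of_le (by positivity) hw1
    have hnw : (n : ℝ) ≤ r ^ 2 * w := by
      calc (n : ℝ) ≤ 32 * r ^ 5 := hnR
        _ ≤ r * r ^ 5 := by gcongr
        _ = r ^ 2 * r ^ 4 := by ring
        _ ≤ r ^ 2 * w := by gcongr; nlinarith [pow_pos (show (0 : ℝ) < r by linarith) 4]
    have f1 : (n : ℝ) + w * k0 ≤ 4 * r ^ 2 * w := by
      have : w * k0 ≤ w * (3 * r ^ 2) := by gcongr; linarith
      linarith
    have f2 : 2 * a * (r : ℝ) ^ 2 * w ≤ n + w * k1 := by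
      have : w * (2 * a * (r : ℝ) ^ 2) ≤ w * k1 := by gcongr
      linarith
    have f3 : y * c * n ≤ c ^ 2 * (4 * r ^ 2 * w) := by
      calc y * c * n = (y * n) * c := by ring
        _ ≤ (c * (n + w * k0)) * c := by gcongr
        _ = c ^ 2 * (n + w * k0) := by ring
        _ ≤ _ := by gcongr
    have f4 : 2 * c ^ 2 * (2 * r ^ 2 * w) < a * (2 * r ^ 2 * w) := by gcongr
    linarith
  have hsum := simVal_add_le_one (n * n + 2 * n) (2 * r ^ 2 + 1) hdisj A Q (∅, ∅)
  have hcon : ENNReal.ofReal (1 / 2 + g) + ENNReal.ofReal (1 / 2 + g) ≤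
      1 + ENNReal.ofReal (2 * (Q * (11 * a / r))) := by
    calc _ ≤ p + p := add_le_add hg hg
      _ ≤ _ := add_le_add m0 m1
      _ = _ := add_add_add_comm _ _ _ _
      _ ≤ 1 + (Q * ENNReal.ofReal (11 * a / r) + Q * ENNReal.ofReal (11 * a / r)) :=
          add_le_add hsum le_rfl
      _ = _ := by
          rw [← two_mul, ENNReal.ofReal_mul zero_le_two, ENNReal.ofReal_mul (Nat.cast_nonneg _),
            ENNReal.ofReal_natCast, ENNReal.ofReal_ofNat]
  rw [← ENNReal.ofReal_add (by positivity) (by positivity), ← ENNReal.ofReal_one,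
    ← ENNReal.ofReal_add (by positivity) (by positivity),
    ENNReal.ofReal_le_ofReal_iff (by positivity)] at hcon
  have hκ2 : κ * (44 * a) ≤ g := by
    rw [← le_div_iff₀ (by positivity)]; exact min_le_right _ _
  have : (Q : ℝ) * (11 * a / r) ≤ g / 2 := by
    rw [← mul_div_assoc, div_le_iff₀ (by linarith)]
    calc (Q : ℝ) * (11 * a) ≤ 2 * κ * r * (11 * a) := by gcongr
      _ = (κ * (44 * a)) / 2 * r := by ring
      _ ≤ g / 2 * r := by gcongr
  linarith

/-! ### Expectation functionals -/

/-- A normalized positive linear functional on the real functions on `α`. -/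
structure Expect (α : Type) where
  toFun : (α → ℝ) → ℝ
  map_add' : ∀ f g, toFun (fun a => f a + g a) = toFun f + toFun g
  map_mul' : ∀ (c : ℝ) f, toFun (fun a => c * f a) = c * toFun f
  mono' : ∀ f g, (∀ a, f a ≤ g a) → toFun f ≤ toFun g
  map_one' : toFun (fun _ => 1) = 1

namespace Expect

variable {α β : Type}

instance : CoeFun (Expect α) fun _ => (α → ℝ) → ℝ := ⟨toFun⟩

theorem map_add (E : Expect α) (f g : α → ℝ) : E (fun a => f a + g a) = E f + E g :=
  E.map_add' f g

theorem map_const_mul (E : Expect α) (c : ℝ) (f : α → ℝ) : E (fun a => c * f a) = c * E f :=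
  E.map_mul' c f

theorem mono (E : Expect α) {f g : α → ℝ} (h : ∀ a, f a ≤ g a) : E f ≤ E g := E.mono' f g h

theorem map_const (E : Expect α) (c : ℝ) : E (fun _ => c) = c := by
  have := E.map_mul' c fun _ => 1
  rw [E.map_one'] at this
  simpa using this

theorem map_neg (E : Expect α) (f : α → ℝ) : E (fun a => -f a) = -E f := by
  simpa using E.map_const_mul (-1) f

theorem map_sub (E : Expect α) (f g : α → ℝ) : E (fun a => f a - g a) = E f - E g := by
  simp only [sub_eq_add_neg]
  rw [E.map_add, E.map_neg]

theorem map_mul_const (E : Expect α) (c : ℝ) (f : α → ℝ) : E (fun a => f a * c) = E f * c := by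
  simp only [mul_comm _ c]
  exact E.map_const_mul c f

theorem map_div_const (E : Expect α) (c : ℝ) (f : α → ℝ) : E (fun a => f a / c) = E f / c := by
  simp only [div_eq_mul_inv]
  exact E.map_mul_const _ f

theorem map_sum {ι : Type*} (E : Expect α) (s : Finset ι) (f : ι → α → ℝ) :
    E (fun a => ∑ i ∈ s, f i a) = ∑ i ∈ s, E (f i) := by
  classical
  induction s using Finset.induction_on with
  | empty => simpa using E.map_const 0
  | insert i s hi ih => simp only [Finset.sum_insert hi]; rw [E.map_add, ih]

theorem nonneg (E : Expect α) {f : α → ℝ} (h : ∀ a, 0 ≤ f a) : 0 ≤ E f := by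
  have := E.mono h
  rwa [E.map_const] at this

/-- The point mass at `a`. -/
def pure (a : α) : Expect α where
  toFun f := f a
  map_add' _ _ := rfl
  map_mul' _ _ := rfl
  mono' _ _ h := h a
  map_one' := rfl

/-- Draw `a`, and then from `F a`. -/
def bind (E : Expect α) (F : α → Expect β) : Expect β where
  toFun f := E fun a => F a f
  map_add' f g := by simp only [map_add]
  map_mul' c f := by simp only [map_const_mul]
  mono' f g h := E.mono fun a => (F a).mono h
  map_one' := by simp only [map_const]

/-- The image under `φ`. -/
def map (φ : α → β) (E : Expect α) : Expect β where
  toFun f := E fun a => f (φ a)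
  map_add' _ _ := E.map_add _ _
  map_mul' _ _ := E.map_const_mul _ _
  mono' _ _ h := E.mono fun a => h (φ a)
  map_one' := E.map_const 1

/-- Independent draws. -/
def prod (E : Expect α) (F : Expect β) : Expect (α × β) where
  toFun f := E fun a => F fun b => f (a, b)
  map_add' f g := by simp only [map_add]
  map_mul' c f := by simp only [map_const_mul]
  mono' f g h := E.mono fun a => F.mono fun b => h (a, b)
  map_one' := by simp only [map_const]

/-- `N` independent draws. -/
def iid (E : Expect α) : (N : ℕ) → Expect (Fin N → α)
  | 0 => pure Fin.elim0
  | N + 1 => E.bind fun a => (E.iid N).map (Fin.cons a)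

/-- The uniform distribution on a nonempty finite set. -/
noncomputable def unif (s : Finset α) (hs : s.Nonempty) : Expect α where
  toFun f := (s.card : ℝ)⁻¹ * ∑ a ∈ s, f a
  map_add' f g := by rw [Finset.sum_add_distrib, mul_add]
  map_mul' c f := by rw [← Finset.mul_sum, mul_left_comm]
  mono' f g h := by gcongr; exact h _
  map_one' := by
    rw [Finset.sum_const, nsmul_eq_mul, mul_one, inv_mul_cancel₀]
    exact Nat.cast_ne_zero.2 hs.card_pos.ne'

theorem unif_apply (s : Finset α) (hs : s.Nonempty) (f : α → ℝ) :
    unif s hs f = (s.card : ℝ)⁻¹ * ∑ a ∈ s, f a := rfl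

theorem unif_comm (E : Expect β) (s : Finset α) (hs : s.Nonempty) (f : α → β → ℝ) :
    E (fun b => unif s hs fun a => f a b) = unif s hs fun a => E (f a) := by
  simp only [unif_apply]
  rw [E.map_const_mul, E.map_sum]

open Classical in
/-- The probability of an event. -/
noncomputable def prob (E : Expect α) (P : α → Prop) : ℝ := E fun a => if P a then 1 else 0

theorem prob_or_le (E : Expect α) (P Q : α → Prop) :
    E.prob (fun a => P a ∨ Q a) ≤ E.prob P + E.prob Q := by
  unfold prob
  rw [← E.map_add]
  refine E.mono fun a => ?_
  by_cases h1 : P a <;> by_cases h2 : Q a <;> simp [h1, h2]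

open Classical in
theorem prob_prod_fst (E : Expect α) (F : Expect β) (P : α → Prop) :
    (E.prod F).prob (fun a => P a.1) = E.prob P :=
  congrArg E.toFun (funext fun a => F.map_const (if P a then 1 else 0))

theorem prob_prod_snd (E : Expect α) (F : Expect β) (P : β → Prop) :
    (E.prod F).prob (fun a => P a.2) = F.prob P :=
  E.map_const (F.prob P)

/-- Chebyshev's inequality. -/
theorem prob_lt_abs_sub_le (E : Expect α) (X : α → ℝ) (μ : ℝ) {v δ : ℝ} (hδ : 0 < δ)
    (hv : E (fun a => (X a - μ) ^ 2) ≤ v) : E.prob (fun a => δ < |X a - μ|) ≤ v / δ ^ 2 := by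
  rw [le_div_iff₀ (by positivity), prob, ← E.map_mul_const]
  refine le_trans (E.mono fun a => ?_) hv
  split_ifs with h
  · rw [one_mul, ← sq_abs (X a - μ)]
    gcongr
  · rw [zero_mul]; positivity

/-- A function that is at least `y` outside an unlikely event has a large expectation. -/
theorem le_apply_of_prob_le (E : Expect α) {f : α → ℝ} {P : α → Prop} {δ y : ℝ} (hy1 : y ≤ 1)
    (hf : ∀ a, 0 ≤ f a) (h : ∀ a, ¬ P a → y ≤ f a) (hδ : E.prob P ≤ δ) :
    y - δ ≤ E f := by
  classical
  have h1 : E (fun a => y - if P a then 1 else 0) ≤ E f := by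
    refine E.mono fun a => ?_
    split_ifs with hP
    · linarith [hf a]
    · rw [sub_zero]; exact h a hP
  rw [E.map_sub, E.map_const] at h1
  unfold prob at hδ
  have h2 : E (fun a => if P a then (1 : ℝ) else 0) ≤ δ := by convert hδ
  linarith

/-- The shift `c` carries the induction: the deviation of the first draw is absorbed into it, and
the cross term vanishes in the mean. -/
theorem iid_sq (E : Expect α) (X : α → ℝ) {μ : ℝ} (hμ : E X = μ) (N : ℕ) (c : ℝ) :
    E.iid N (fun v => (c + ∑ i, (X (v i) - μ)) ^ 2) = c ^ 2 + N * E fun a => (X a - μ) ^ 2 := by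
  induction N generalizing c with
  | zero => simp [iid, pure]
  | succ N ih =>
    have h1 : ∀ a, E.iid N (fun v => (c + ∑ i : Fin (N + 1),
        (X ((Fin.cons a v : Fin (N + 1) → α) i) - μ)) ^ 2) =
        c ^ 2 + N * E (fun a => (X a - μ) ^ 2) + 2 * c * (X a - μ) + (X a - μ) ^ 2 := by
      intro a
      simp only [Fin.sum_univ_succ, Fin.cons_zero, Fin.cons_succ]
      have := ih (c + (X a - μ))
      simp only [add_assoc] at this ⊢
      rw [this]
      ring
    change E (fun a => E.iid N fun v => _) = _
    simp only [h1]
    rw [E.map_add, E.map_add, E.map_const, E.map_const_mul, E.map_sub, hμ, E.map_const]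
    push_cast
    ring

theorem sq_sub_le (E : Expect α) (X : α → ℝ) {μ : ℝ} (hμ : E X = μ) :
    E (fun a => (X a - μ) ^ 2) ≤ E fun a => X a ^ 2 := by
  have : E (fun a => (X a - μ) ^ 2) = E (fun a => X a ^ 2) - μ ^ 2 := by
    have h : ∀ a, (X a - μ) ^ 2 = X a ^ 2 - 2 * μ * X a + μ ^ 2 := fun a => by ring
    simp only [h]
    rw [E.map_add, E.map_sub, E.map_const_mul, E.map_const, hμ]
    ring
  rw [this]
  linarith [sq_nonneg μ]

/-- The mean squared error of an empirical mean. -/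
theorem iid_mean_sq (E : Expect α) (X : α → ℝ) {μ v : ℝ} (hμ : E X = μ)
    (hv : E (fun a => (X a - μ) ^ 2) ≤ v) {N : ℕ} (hN : 0 < N) :
    E.iid N (fun w => ((∑ i, X (w i)) / N - μ) ^ 2) ≤ v / N := by
  have hN' : (0 : ℝ) < N := by exact_mod_cast hN
  have h : ∀ w : Fin N → α, ((∑ i, X (w i)) / N - μ) ^ 2 =
      (N : ℝ)⁻¹ ^ 2 * (0 + ∑ i, (X (w i) - μ)) ^ 2 := by
    intro w
    rw [Finset.sum_sub_distrib, Finset.sum_const, Finset.card_univ, Fintype.card_fin, nsmul_eq_mul]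
    field_simp
    ring
  simp only [h]
  rw [map_const_mul, E.iid_sq X hμ]
  calc (N : ℝ)⁻¹ ^ 2 * (0 ^ 2 + N * E fun a => (X a - μ) ^ 2)
      ≤ (N : ℝ)⁻¹ ^ 2 * (0 ^ 2 + N * v) := by gcongr
    _ = v / N := by field_simp; ring

/-- The mean squared error of the empirical mean of a nonnegative kernel over all pairs from two
independent samples. -/
theorem iid_kernel_sq (s : Finset α) (hs : s.Nonempty) (g : α → α → ℝ) {A V θ : ℝ}
    (hg : ∀ a b, 0 ≤ g a b) (h1 : ∀ a, unif s hs (g a) ≤ A)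
    (h2 : ∀ b, unif s hs (fun a => g a b) ≤ A)
    (hV : unif s hs (fun b => unif s hs fun a => g a b ^ 2) ≤ V)
    (hθ : unif s hs (fun a => unif s hs (g a)) = θ) {N : ℕ} (hN : 0 < N) :
    (((unif s hs).iid N).prod ((unif s hs).iid N))
      (fun w => ((∑ i, ∑ j, g (w.1 i) (w.2 j)) / N ^ 2 - θ) ^ 2) ≤
        V / N ^ 2 + 2 * A ^ 2 / N := by
  set E := unif s hs with hE
  have hN' : (0 : ℝ) < N := by exact_mod_cast hN
  have hm0 : ∀ a, 0 ≤ E (g a) := fun a => E.nonneg (hg a)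
  have hm0' : ∀ b, 0 ≤ E (fun a => g a b) := fun b => E.nonneg fun a => hg a b
  -- For a fixed first sample `ξ`, the second is an independent sample of `b ↦ ∑ i, g (ξ i) b`. Its
  -- mean squared error splits into the squared bias due to `ξ` and a variance.
  have inner : ∀ ξ : Fin N → α,
      E.iid N (fun ζ => ((∑ i, ∑ j, g (ξ i) (ζ j)) / N ^ 2 - θ) ^ 2) ≤
        (N : ℝ)⁻¹ ^ 4 * (N ^ 2 * (0 + ∑ i, (E (g (ξ i)) - θ)) ^ 2 +
          N * E fun b => (∑ i, g (ξ i) b) ^ 2) := by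
    intro ξ
    have hμ : E (fun b => ∑ i, g (ξ i) b) = ∑ i, E (g (ξ i)) := E.map_sum _ _
    have hrw : ∀ ζ : Fin N → α, ((∑ i, ∑ j, g (ξ i) (ζ j)) / N ^ 2 - θ) ^ 2 =
        (N : ℝ)⁻¹ ^ 4 * (N * (∑ i, (E (g (ξ i)) - θ)) +
          ∑ j, ((∑ i, g (ξ i) (ζ j)) - ∑ i, E (g (ξ i)))) ^ 2 := by
      intro ζ
      rw [Finset.sum_comm]
      simp only [Finset.sum_sub_distrib, Finset.sum_const, Finset.card_univ, Fintype.card_fin,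
        nsmul_eq_mul]
      field_simp
      ring
    simp only [hrw]
    rw [map_const_mul, E.iid_sq (fun b => ∑ i, g (ξ i) b) hμ]
    have := E.sq_sub_le (fun b => ∑ i, g (ξ i) b) hμ
    rw [zero_add, mul_pow]
    gcongr
  have hmean : E.iid N (fun ξ => (0 + ∑ i, (E (g (ξ i)) - θ)) ^ 2) ≤ N * A ^ 2 := by
    rw [E.iid_sq (fun a => E (g a)) hθ]
    have e1 := E.sq_sub_le (fun a => E (g a)) hθ
    have e2 : E (fun a => E (g a) ^ 2) ≤ A ^ 2 := by
      rw [← E.map_const (A ^ 2)]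
      exact E.mono fun a => pow_le_pow_left₀ (hm0 a) (h1 a) 2
    have := mul_le_mul_of_nonneg_left (e1.trans e2) hN'.le
    linarith
  -- With `b` fixed and `ξ` random this is again a sum of independent draws: squared mean at most
  -- `(N * A)^2`, variance at most `N` times the second moment.
  have hvar : E.iid N (fun ξ => E fun b => (∑ i, g (ξ i) b) ^ 2) ≤ N ^ 2 * A ^ 2 + N * V := by
    rw [hE, unif_comm, ← hE]
    have e1 : ∀ b, E.iid N (fun ξ => (∑ i, g (ξ i) b) ^ 2) ≤
        N ^ 2 * A ^ 2 + N * E fun a => g a b ^ 2 := by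
      intro b
      have hrw : ∀ ξ : Fin N → α, (∑ i, g (ξ i) b) ^ 2 =
          (N * E (fun a => g a b) + ∑ i, (g (ξ i) b - E fun a => g a b)) ^ 2 := by
        intro ξ
        simp only [Finset.sum_sub_distrib, Finset.sum_const, Finset.card_univ, Fintype.card_fin,
          nsmul_eq_mul]
        ring
      simp only [hrw]
      rw [E.iid_sq (fun a => g a b) rfl, mul_pow]
      have := E.sq_sub_le (fun a => g a b) rfl
      have h3 := pow_le_pow_left₀ (hm0' b) (h2 b) 2
      gcongr
    refine (E.mono e1).trans ?_
    rw [E.map_add, E.map_const, E.map_const_mul]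
    gcongr
  change E.iid N (fun ξ => E.iid N fun ζ => _) ≤ _
  refine (Expect.mono _ inner).trans ?_
  rw [map_const_mul, map_add, map_const_mul, map_const_mul]
  calc _ ≤ (N : ℝ)⁻¹ ^ 4 * (N ^ 2 * (N * A ^ 2) + N * (N ^ 2 * A ^ 2 + N * V)) := by gcongr
    _ = V / N ^ 2 + 2 * A ^ 2 / N := by field_simp; ring

end Expect

/-! ### Programs -/

/-- On input `G`, the program `P`, which passes its result to a continuation, draws its result
from `E` at cost at most `c`. -/
def Realizes {M : Set Query} (G : Graph) (T : Set ℝ) {α : Type} (P : (α → Alg M) → Alg M)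
    (E : Expect α) (c : ℕ) : Prop :=
  -- Quantifying over the continuation and its remaining budget makes the notion compose; an
  -- inequality suffices because only lower bounds on success are needed.
  ∀ (k : α → Alg M) (q : ℕ),
    E (fun a => (val G T (k a) q).toReal) ≤ (val G T (P k) (q + c)).toReal

namespace Realizes
variable {M : Set Query} {G : Graph} {T : Set ℝ} {α β : Type}

theorem mono {P : (α → Alg M) → Alg M} {E : Expect α} {c c' : ℕ} (h : Realizes G T P E c)
    (hc : c ≤ c') : Realizes G T P E c' := fun k q =>
  (h k q).trans (ENNReal.toReal_mono (val_ne_top _ _ _ _) (val_mono _ _ _ (by omega)))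

theorem bind {P : (α → Alg M) → Alg M} {E : Expect α} {c c' : ℕ} (h : Realizes G T P E c)
    {P' : α → (β → Alg M) → Alg M} {E' : α → Expect β} (h' : ∀ a, Realizes G T (P' a) (E' a) c') :
    Realizes G T (fun k => P fun a => P' a k) (E.bind E') (c + c') := fun k q => by
  have := h (fun a => P' a k) (q + c')
  rw [add_assoc, add_comm c'] at this
  exact (E.mono fun a => h' a k q).trans this

theorem map {P : (α → Alg M) → Alg M} {E : Expect α} {c : ℕ} (h : Realizes G T P E c)
    (φ : α → β) : Realizes G T (fun k => P fun a => k (φ a)) (E.map φ) c := fun k q =>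
  h (fun a => k (φ a)) q

theorem prod {P : (α → Alg M) → Alg M} {E : Expect α} {P' : (β → Alg M) → Alg M} {E' : Expect β}
    {c c' : ℕ} (h : Realizes G T P E c) (h' : Realizes G T P' E' c') :
    Realizes G T (fun k => P fun a => P' fun b => k (a, b)) (E.prod E') (c + c') := fun k q => by
  have := h (fun a => P' fun b => k (a, b)) (q + c')
  rw [add_assoc, add_comm c'] at this
  exact (E.mono fun a => h' (fun b => k (a, b)) q).trans this

end Realizes

/-- Run a program `N` times. -/
def rep {M : Set Query} {α : Type} (P : (α → Alg M) → Alg M) :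
    (N : ℕ) → ((Fin N → α) → Alg M) → Alg M
  | 0, k => k Fin.elim0
  | N + 1, k => P fun a => rep P N fun v => k (Fin.cons a v)

/-- Add the results of the programs `P b` for `b < B`. -/
def sumP {M : Set Query} (P : ℕ → (ℝ → Alg M) → Alg M) : ℕ → (ℝ → Alg M) → Alg M
  | 0, k => k 0
  | B + 1, k => sumP P B fun x => P B fun y => k (x + y)

section programs
variable {M : Set Query} {G : Graph} {T : Set ℝ} {α : Type}

theorem Realizes.rep {P : (α → Alg M) → Alg M} {E : Expect α} {c : ℕ} (h : Realizes G T P E c)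
    (N : ℕ) : Realizes G T (rep P N) (E.iid N) (N * c) := by
  induction N with
  | zero => intro k q; simp [AvgDeg.rep, Expect.iid, Expect.pure]
  | succ N ih =>
    have := h.bind fun a => ih.map (Fin.cons (α := fun _ => α) a)
    exact this.mono (by rw [Nat.add_mul]; omega)

theorem Realizes.sumP {P : ℕ → (ℝ → Alg M) → Alg M} {x : ℕ → ℝ} {c : ℕ}
    (h : ∀ b, Realizes G T (P b) (.pure (x b)) c) (B : ℕ) :
    Realizes G T (sumP P B) (.pure (∑ b ∈ Finset.range B, x b)) (B * c) := by
  induction B with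
  | zero => intro k q; simp [AvgDeg.sumP, Expect.pure]
  | succ B ih =>
    intro k q
    have h1 := ih (fun x => P B fun y => k (x + y)) (q + c)
    have h2 := h B (fun y => k ((∑ b ∈ Finset.range B, x b) + y)) q
    rw [Finset.sum_range_succ, show q + (B + 1) * c = q + c + B * c by ring]
    exact h2.trans h1

theorem realizes_randVert (hx : Query.randVert ∈ M) :
    Realizes G T (fun k => .query .randVert hx k) (.unif G.verts G.nonempty) 1 := by
  intro k q
  rw [val_randVert, ENNReal.toReal_mul, ENNReal.toReal_sum fun _ _ => val_ne_top _ _ _ _,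
    ENNReal.toReal_inv, ENNReal.toReal_natCast]
  rfl

theorem realizes_randEdge (hx : Query.randEdge ∈ M) :
    Realizes G T (fun k => .query .randEdge hx k) (.unif G.edges G.edges_nonempty) 1 := by
  intro k q
  rw [val_randEdge, ENNReal.toReal_mul, ENNReal.toReal_sum fun _ _ => val_ne_top _ _ _ _,
    ENNReal.toReal_inv, ENNReal.toReal_natCast]
  rfl

theorem realizes_degree (x : ℕ) (hx : Query.degree x ∈ M) :
    Realizes G T (fun k => .query (.degree x) hx k) (.pure (G.nbrs x).card) 1 := by
  intro k q
  refine ENNReal.toReal_mono (val_ne_top _ _ _ _) ?_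
  exact ((val_query_add G T (.degree x) hx k q).trans (tsum_pure_mul _ _)).ge

theorem realizes_additive (S : Finset ℕ) (hx : Query.additive S ∈ M) :
    Realizes G T (fun k => .query (.additive S) hx k) (.pure (G.edgesIn S).card) S.card := by
  intro k q
  refine ENNReal.toReal_mono (val_ne_top _ _ _ _) ?_
  exact ((val_query_add G T (.additive S) hx k q).trans (tsum_pure_mul _ _)).ge

end programs

/-! ### Degrees, edges and their averages -/

namespace Graph

variable (G : Graph)

/-- The degree of `x`. -/
noncomputable def deg (x : ℕ) : ℕ := (G.nbrs x).card

open Classical in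
/-- The adjacency matrix. -/
noncomputable def adj (x y : ℕ) : ℝ := if G.toSimple.Adj x y then 1 else 0

open Classical in
theorem adj_comm (x y : ℕ) : G.adj x y = G.adj y x :=
  if_congr (G.toSimple.adj_comm x y) rfl rfl

theorem adj_nonneg (x y : ℕ) : 0 ≤ G.adj x y := by unfold adj; split_ifs <;> norm_num

theorem adj_le_one (x y : ℕ) : G.adj x y ≤ 1 := by unfold adj; split_ifs <;> norm_num

theorem sum_adj (x : ℕ) : ∑ y ∈ G.verts, G.adj x y = G.deg x := by
  simp only [adj, deg, nbrs, Finset.sum_boole]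

theorem n_pos : 0 < G.n := Finset.card_pos.2 G.nonempty

open Classical in
theorem deg_le (x : ℕ) : G.deg x ≤ G.n := Finset.card_filter_le _ _

open Classical in
theorem deg_pos {x : ℕ} (hx : x ∈ G.verts) : 0 < G.deg x := by
  obtain ⟨y, hy⟩ := G.exists_adj x hx
  exact Finset.card_pos.2 ⟨y, Finset.mem_filter.2 ⟨G.mem_of_adj y x hy.symm, hy⟩⟩

/-- Summing over ordered adjacent pairs is summing over edges in both orientations. -/
theorem sum_adj_mul (S : Finset ℕ) (g : ℕ → ℕ → ℝ) :
    ∑ x ∈ S, ∑ y ∈ S, G.adj x y * g x y =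
      ∑ e ∈ G.edgesIn S, (g e.inf e.sup + g e.sup e.inf) := by
  classical
  have h1 : ∑ x ∈ S, ∑ y ∈ S, G.adj x y * g x y =
      ∑ p ∈ (S ×ˢ S).filter (fun p => G.toSimple.Adj p.1 p.2), g p.1 p.2 := by
    rw [Finset.sum_filter, Finset.sum_product]
    refine Finset.sum_congr rfl fun x _ => Finset.sum_congr rfl fun y _ => ?_
    simp only [adj]; split_ifs <;> simp
  rw [h1, ← Finset.sum_fiberwise_of_maps_to (t := G.edgesIn S) (g := fun p => s(p.1, p.2))]
  · refine Finset.sum_congr rfl fun e he => ?_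
    have hfib : ((S ×ˢ S).filter (fun p => G.toSimple.Adj p.1 p.2)).filter
        (fun p => s(p.1, p.2) = e) = {(e.inf, e.sup), (e.sup, e.inf)} := by
      induction e using Sym2.ind with | _ a b => ?_
      simp only [edgesIn, Finset.mem_filter, Finset.mk_mem_sym2_iff, SimpleGraph.mem_edgeSet] at he
      ext ⟨x, y⟩
      simp only [Finset.mem_filter, Finset.mem_product, Finset.mem_insert, Finset.mem_singleton,
        Prod.mk.injEq, Sym2.eq_iff, Sym2.inf_mk, Sym2.sup_mk]
      have hab := he.2
      have hba := he.2.symm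
      rcases le_total a b with h | h
      · simp only [inf_of_le_left h, sup_of_le_right h]
        constructor
        · rintro ⟨-, h'⟩; exact h'
        · rintro (⟨rfl, rfl⟩ | ⟨rfl, rfl⟩) <;> simp [he.1, hab, hba]
      · simp only [inf_of_le_right h, sup_of_le_left h]
        constructor
        · rintro ⟨-, h'⟩; exact h'.symm
        · rintro (⟨rfl, rfl⟩ | ⟨rfl, rfl⟩) <;> simp [he.1, hab, hba]
    rw [hfib, Finset.sum_pair]
    intro h
    rw [Prod.mk.injEq] at h
    induction e using Sym2.ind with | _ a b => ?_
    simp only [edgesIn, Finset.mem_filter, SimpleGraph.mem_edgeSet] at he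
    simp only [Sym2.inf_mk, Sym2.sup_mk] at h
    have := he.2.ne
    rcases le_total a b with h' | h'
    · simp only [inf_of_le_left h', sup_of_le_right h'] at h; exact this h.1
    · simp only [inf_of_le_right h', sup_of_le_left h'] at h; exact this h.1.symm
  · rintro ⟨x, y⟩ hp
    simp only [Finset.mem_filter, Finset.mem_product] at hp
    simp only [edgesIn, Finset.mem_filter, Finset.mk_mem_sym2_iff, SimpleGraph.mem_edgeSet]
    exact hp

theorem two_mul_card_edgesIn (S : Finset ℕ) :
    2 * ((G.edgesIn S).card : ℝ) = ∑ x ∈ S, ∑ y ∈ S, G.adj x y := by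
  have := G.sum_adj_mul S fun _ _ => 1
  simp only [mul_one] at this
  rw [this, Finset.sum_const, nsmul_eq_mul]
  ring

/-- A random end of a random edge is a vertex chosen with probability proportional to its degree. -/
theorem sum_edges_eq (f : ℕ → ℝ) :
    ∑ e ∈ G.edges, (f e.inf + f e.sup) = ∑ x ∈ G.verts, G.deg x * f x := by
  have := G.sum_adj_mul G.verts fun x _ => f x
  rw [edges, ← this]
  refine Finset.sum_congr rfl fun x _ => ?_
  rw [← Finset.sum_mul, G.sum_adj]

/-- The uniform distribution on the edges. -/
noncomputable abbrev edgeE : Expect (Sym2 ℕ) := .unif G.edges G.edges_nonempty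

/-- The uniform distribution on the vertices. -/
noncomputable abbrev vertE : Expect ℕ := .unif G.verts G.nonempty

theorem n_mul_avgDeg : (G.n : ℝ) * G.avgDeg = ∑ x ∈ G.verts, (G.deg x : ℝ) := by
  have : (G.n : ℝ) ≠ 0 := Nat.cast_ne_zero.2 G.n_pos.ne'
  rw [avgDeg]
  exact mul_div_cancel₀ _ this

theorem two_mul_card_edges : 2 * (G.edges.card : ℝ) = G.n * G.avgDeg := by
  have := G.sum_edges_eq fun _ => 1
  rw [Finset.sum_const, nsmul_eq_mul] at this
  rw [n_mul_avgDeg]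
  simp only [mul_one] at this
  linarith

theorem edges_card_pos : (0 : ℝ) < G.edges.card := by
  exact_mod_cast G.edges_nonempty.card_pos

theorem one_le_avgDeg : 1 ≤ G.avgDeg := by
  have hn : (0 : ℝ) < G.n := by exact_mod_cast G.n_pos
  rw [avgDeg, le_div_iff₀ hn, one_mul, n, Finset.card_eq_sum_ones]
  push_cast
  exact Finset.sum_le_sum fun x hx => by exact_mod_cast G.deg_pos hx

theorem avgDeg_le : G.avgDeg ≤ G.n := by
  have hn : (0 : ℝ) < G.n := by exact_mod_cast G.n_pos
  rw [avgDeg, div_le_iff₀ hn]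
  calc _ ≤ ∑ x ∈ G.verts, (G.n : ℝ) := Finset.sum_le_sum fun x _ => by exact_mod_cast G.deg_le x
    _ = _ := by rw [Finset.sum_const, nsmul_eq_mul]; rfl

theorem edgeE_add (f : ℕ → ℝ) : G.edgeE (fun e => f e.inf + f e.sup) =
    (G.edges.card : ℝ)⁻¹ * ∑ x ∈ G.verts, G.deg x * f x := by
  rw [Expect.unif_apply, sum_edges_eq]

end Graph

/-! ### The statistics of a random edge and of a random vertex -/

/-- Approximately the inverse of the degree if `d * t ^ 3 > n`, and zero otherwise. -/
noncomputable def wt (n t d : ℕ) : ℝ := if n < d * t ^ 3 then (2 ^ d.size : ℝ)⁻¹ else 0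

/-- The indicator of `d * t ^ 3 ≤ n`. -/
noncomputable def lightInd (n t d : ℕ) : ℝ := if n < d * t ^ 3 then 0 else 1

section wt
variable (n t d : ℕ)

theorem wt_nonneg : 0 ≤ wt n t d := by unfold wt; split_ifs <;> positivity

theorem mul_wt_le_one : d * wt n t d ≤ 1 := by
  unfold wt
  split_ifs
  · rw [← div_eq_mul_inv, div_le_one (by positivity)]
    exact_mod_cast (Nat.lt_size_self d).le
  · simp

/-- `d.size` is the number of binary digits, so `2 ^ d.size` lies between `d` and `2 * d`. -/
theorem half_le_mul_wt (h : n < d * t ^ 3) : 1 / 2 ≤ d * wt n t d := by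
  have hd : d ≠ 0 := by rintro rfl; simp at h
  have h1 : 1 ≤ d.size := Nat.size_pos.2 (Nat.pos_of_ne_zero hd)
  have h2 : 2 ^ (d.size - 1) ≤ d := Nat.lt_size.1 (by omega)
  have h3 : 2 ^ d.size ≤ 2 * d := by
    calc 2 ^ d.size = 2 * 2 ^ (d.size - 1) := by rw [← pow_succ']; congr 1; omega
      _ ≤ _ := by omega
  have h4 : (2 : ℝ) ^ d.size ≤ 2 * d := by exact_mod_cast h3
  rw [wt, if_pos h, ← div_eq_mul_inv, div_le_div_iff₀ two_pos (by positivity)]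
  linarith

/-- Only degrees above `n / t^3` get a weight, which caps the inverse degree. This is the bound
behind the variance of the heavy edge estimator. -/
theorem wt_le (hn : 0 < n) : wt n t d ≤ t ^ 3 / n := by
  have hn' : (0 : ℝ) < n := by exact_mod_cast hn
  by_cases h : n < d * t ^ 3
  · have hd : (0 : ℝ) < d := by
      rcases Nat.eq_zero_or_pos d with rfl | h'
      · simp at h
      · exact_mod_cast h'
    have h1 := mul_wt_le_one n t d
    have h2 : (n : ℝ) ≤ d * t ^ 3 := by exact_mod_cast h.le
    rw [le_div_iff₀ hn']
    calc wt n t d * n ≤ wt n t d * (d * t ^ 3) := mul_le_mul_of_nonneg_left h2 (wt_nonneg n t d)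
      _ = (d * wt n t d) * t ^ 3 := by ring
      _ ≤ 1 * t ^ 3 := by gcongr
      _ = t ^ 3 := one_mul _
  · rw [wt, if_neg h]; positivity

theorem lightInd_nonneg : 0 ≤ lightInd n t d := by unfold lightInd; split_ifs <;> norm_num

theorem lightInd_le_one : lightInd n t d ≤ 1 := by unfold lightInd; split_ifs <;> norm_num

end wt

/-- The three statistics of an edge with end degrees `a` and `b`. -/
noncomputable def statX (a b : ℕ) : ℝ := ((a : ℝ)⁻¹ + (b : ℝ)⁻¹) / 2
noncomputable def statF (n t a b : ℕ) : ℝ := (lightInd n t a + lightInd n t b) / 2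
noncomputable def statH (n t a b : ℕ) : ℝ := (a * wt n t a) * (b * wt n t b)

/-- The statistic of a vertex of degree `d`. -/
noncomputable def statY (n t d : ℕ) : ℝ := d * lightInd n t d

theorem statX_nonneg (a b : ℕ) : 0 ≤ statX a b := by unfold statX; positivity

theorem statX_le_one (a b : ℕ) : statX a b ≤ 1 := by
  have h : ∀ a : ℕ, (a : ℝ)⁻¹ ≤ 1 := fun a => Nat.cast_inv_le_one a
  unfold statX
  linarith [h a, h b]

theorem statF_nonneg (n t a b : ℕ) : 0 ≤ statF n t a b := by
  unfold statF; linarith [lightInd_nonneg n t a, lightInd_nonneg n t b]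

theorem statF_le_one (n t a b : ℕ) : statF n t a b ≤ 1 := by
  unfold statF; linarith [lightInd_le_one n t a, lightInd_le_one n t b]

theorem mul_wt_nonneg (n t a : ℕ) : 0 ≤ a * wt n t a :=
  mul_nonneg (Nat.cast_nonneg _) (wt_nonneg _ _ _)

theorem statH_nonneg (n t a b : ℕ) : 0 ≤ statH n t a b :=
  mul_nonneg (mul_wt_nonneg _ _ _) (mul_wt_nonneg _ _ _)

theorem statH_le_one (n t a b : ℕ) : statH n t a b ≤ 1 :=
  mul_le_one₀ (mul_wt_le_one _ _ _) (mul_wt_nonneg _ _ _) (mul_wt_le_one _ _ _)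

/-- Either both ends are heavy and `statH ≥ 1/4`, or one is light and `statF ≥ 1/2`. On average, one
of the two estimators for large `d` therefore has a mean bounded below. -/
theorem one_le_statH_statF (n t a b : ℕ) : 1 ≤ 4 * statH n t a b + 2 * statF n t a b := by
  have h0 := statH_nonneg n t a b
  by_cases ha : n < a * t ^ 3
  · by_cases hb : n < b * t ^ 3
    · have h1 := half_le_mul_wt n t a ha
      have h2 := half_le_mul_wt n t b hb
      have h3 := statF_nonneg n t a b
      have : 1 / 2 * (1 / 2) ≤ statH n t a b := mul_le_mul h1 h2 (by norm_num) (by linarith)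
      linarith
    · have h3 : statF n t a b = 1 / 2 := by simp [statF, lightInd, ha, hb]
      linarith
  · have h3 : 1 / 2 ≤ statF n t a b := by
      have := lightInd_nonneg n t b
      simp only [statF]
      rw [lightInd, if_neg ha]; linarith
    linarith

theorem sq_le_self_of_mem {x : ℝ} (h0 : 0 ≤ x) (h1 : x ≤ 1) : x ^ 2 ≤ x := by nlinarith

/-! ### Means of the statistics and the kernel of the heavy edge estimator -/

namespace Graph
variable (G : Graph)

/-- Degree-biased sampling cancels the inverse degree: every vertex contributes exactly `1`, as none
is isolated, and `n / (2m) = 1 / d`, where `m` is the number of edges. -/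
theorem edgeE_statX : G.edgeE (fun e => statX (G.deg e.inf) (G.deg e.sup)) = G.avgDeg⁻¹ := by
  have h := G.edgeE_add fun x => (G.deg x : ℝ)⁻¹
  have h2 : ∑ x ∈ G.verts, (G.deg x : ℝ) * (G.deg x : ℝ)⁻¹ = G.n := by
    rw [n, Finset.card_eq_sum_ones, Nat.cast_sum]
    refine Finset.sum_congr rfl fun x hx => ?_
    rw [mul_inv_cancel₀ (Nat.cast_ne_zero.2 (G.deg_pos hx).ne')]; simp
  simp only [statX]
  rw [Expect.map_div_const, h, h2]
  have h3 := G.two_mul_card_edges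
  have h4 := G.edges_card_pos
  have h5 := G.one_le_avgDeg
  have h6 : (0 : ℝ) < G.n := by exact_mod_cast G.n_pos
  field_simp
  linarith

/-- Both sides are the total degree of the light vertices divided by `n`. Hence `d` is the ratio of
the two means. -/
theorem edgeE_statF (t : ℕ) :
    G.avgDeg * G.edgeE (fun e => statF G.n t (G.deg e.inf) (G.deg e.sup)) =
      G.vertE fun x => statY G.n t (G.deg x) := by
  have h := G.edgeE_add fun x => lightInd G.n t (G.deg x)
  simp only [statF]
  rw [Expect.map_div_const, h, Expect.unif_apply]
  have h3 := G.two_mul_card_edges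
  have h4 := G.edges_card_pos
  have h5 := G.one_le_avgDeg
  have h6 : (0 : ℝ) < G.n := by exact_mod_cast G.n_pos
  change _ = (G.n : ℝ)⁻¹ * ∑ x ∈ G.verts, (G.deg x : ℝ) * lightInd G.n t (G.deg x)
  field_simp
  linear_combination -(∑ x ∈ G.verts, (G.deg x : ℝ) * lightInd G.n t (G.deg x)) * h3

/-- The kernel of the heavy edge estimator. -/
noncomputable def ker (t x y : ℕ) : ℝ :=
  G.adj x y * (wt G.n t (G.deg x) * wt G.n t (G.deg y))

/-- The kernel of the heavy edge estimator on pairs of edges. -/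
noncomputable def edgeKer (t : ℕ) (e f : Sym2 ℕ) : ℝ :=
  ((G.ker t e.inf f.inf + G.ker t e.inf f.sup) + (G.ker t e.sup f.inf + G.ker t e.sup f.sup)) / 4

theorem ker_comm (t x y : ℕ) : G.ker t x y = G.ker t y x := by
  unfold ker; rw [G.adj_comm]; ring

theorem ker_nonneg (t x y : ℕ) : 0 ≤ G.ker t x y :=
  mul_nonneg (G.adj_nonneg x y) (mul_nonneg (wt_nonneg _ _ _) (wt_nonneg _ _ _))

theorem ker_le (t x y : ℕ) : G.ker t x y ≤ ((t : ℝ) ^ 3 / G.n) ^ 2 := by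
  have h1 := wt_le G.n t (G.deg x) G.n_pos
  have h2 := wt_le G.n t (G.deg y) G.n_pos
  have h3 := wt_nonneg G.n t (G.deg x)
  have h4 := wt_nonneg G.n t (G.deg y)
  calc G.ker t x y ≤ 1 * (wt G.n t (G.deg x) * wt G.n t (G.deg y)) := by
        unfold ker; gcongr; exact G.adj_le_one x y
    _ ≤ 1 * ((t : ℝ) ^ 3 / G.n * (t ^ 3 / G.n)) := by gcongr
    _ = _ := by ring

theorem edgeKer_nonneg (t : ℕ) (e f : Sym2 ℕ) : 0 ≤ G.edgeKer t e f := by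
  unfold edgeKer
  have := G.ker_nonneg t
  linarith [this e.inf f.inf, this e.inf f.sup, this e.sup f.inf, this e.sup f.sup]

theorem edgeKer_le (t : ℕ) (e f : Sym2 ℕ) : G.edgeKer t e f ≤ ((t : ℝ) ^ 3 / G.n) ^ 2 := by
  unfold edgeKer
  have := G.ker_le t
  linarith [this e.inf f.inf, this e.inf f.sup, this e.sup f.inf, this e.sup f.sup]

theorem edgeKer_comm (t : ℕ) (e f : Sym2 ℕ) : G.edgeKer t e f = G.edgeKer t f e := by
  unfold edgeKer
  rw [G.ker_comm t e.inf f.inf, G.ker_comm t e.inf f.sup, G.ker_comm t e.sup f.inf,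
    G.ker_comm t e.sup f.sup]
  ring

/-- The weighted degree of `x` into the heavy vertices. -/
theorem sum_deg_ker_le (t x : ℕ) : ∑ y ∈ G.verts, G.deg y * G.ker t x y ≤ 1 := by
  calc _ = ∑ y ∈ G.verts, wt G.n t (G.deg x) * (G.adj x y * (G.deg y * wt G.n t (G.deg y))) := by
        refine Finset.sum_congr rfl fun y _ => ?_
        unfold ker; ring
    _ ≤ ∑ y ∈ G.verts, wt G.n t (G.deg x) * (G.adj x y * 1) := by
        refine Finset.sum_le_sum fun y _ => ?_
        refine mul_le_mul_of_nonneg_left ?_ (wt_nonneg _ _ _)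
        exact mul_le_mul_of_nonneg_left (mul_wt_le_one _ _ _) (G.adj_nonneg _ _)
    _ = G.deg x * wt G.n t (G.deg x) := by
        simp only [mul_one]
        rw [← Finset.mul_sum, G.sum_adj, mul_comm]
    _ ≤ 1 := mul_wt_le_one _ _ _

theorem edgeE_edgeKer (t : ℕ) (e : Sym2 ℕ) : G.edgeE (G.edgeKer t e) =
    (G.edges.card : ℝ)⁻¹ * ((∑ y ∈ G.verts, G.deg y * G.ker t e.inf y) +
      ∑ y ∈ G.verts, G.deg y * G.ker t e.sup y) / 4 := by
  change G.edgeE (fun f => _ / 4) = _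
  rw [Expect.map_div_const, Expect.map_add, G.edgeE_add, G.edgeE_add]
  ring

theorem edgeE_edgeKer_le (t : ℕ) (e : Sym2 ℕ) :
    G.edgeE (G.edgeKer t e) ≤ (2 * (G.edges.card : ℝ))⁻¹ := by
  rw [edgeE_edgeKer, mul_inv]
  have h := G.edges_card_pos
  have h1 := G.sum_deg_ker_le t e.inf
  have h2 := G.sum_deg_ker_le t e.sup
  have h3 : (0 : ℝ) < (G.edges.card : ℝ)⁻¹ := by positivity
  calc _ ≤ (G.edges.card : ℝ)⁻¹ * (1 + 1) / 4 := by gcongr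
    _ = _ := by ring

/-- The degree bias of the two independent ends turns each `wt` into `deg * wt`, so the sum over
adjacent pairs becomes the sum of `statH` over the edges. After multiplication by `n` the mean is
`meanH / d`. -/
theorem edgeE_edgeE_edgeKer (t : ℕ) : G.edgeE (fun e => G.edgeE (G.edgeKer t e)) =
    (2 * (G.edges.card : ℝ))⁻¹ *
      G.edgeE fun e => statH G.n t (G.deg e.inf) (G.deg e.sup) := by
  simp only [edgeE_edgeKer]
  rw [Expect.map_div_const, Expect.map_const_mul,
    G.edgeE_add fun x => ∑ y ∈ G.verts, G.deg y * G.ker t x y]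
  have h := G.sum_adj_mul G.verts fun x y => statH G.n t (G.deg x) (G.deg y)
  have h2 : ∑ x ∈ G.verts, (G.deg x : ℝ) * ∑ y ∈ G.verts, G.deg y * G.ker t x y =
      ∑ x ∈ G.verts, ∑ y ∈ G.verts, G.adj x y * statH G.n t (G.deg x) (G.deg y) := by
    refine Finset.sum_congr rfl fun x _ => ?_
    rw [Finset.mul_sum]
    refine Finset.sum_congr rfl fun y _ => ?_
    unfold ker statH; ring
  have h3 : ∑ e ∈ G.edgesIn G.verts, (statH G.n t (G.deg e.inf) (G.deg e.sup) +
      statH G.n t (G.deg e.sup) (G.deg e.inf)) =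
      2 * ∑ e ∈ G.edges, statH G.n t (G.deg e.inf) (G.deg e.sup) := by
    rw [Finset.mul_sum]
    refine Finset.sum_congr rfl fun e _ => ?_
    unfold statH; ring
  rw [h2, h, h3, Expect.unif_apply]
  ring

end Graph

/-! ### Images of samples, binary digits and cuts -/

theorem Expect.iid_map {α β : Type} (E : Expect α) (φ : α → β) (N : ℕ) (f : (Fin N → β) → ℝ) :
    (E.map φ).iid N f = E.iid N fun v => f fun i => φ (v i) := by
  induction N with
  | zero => simp only [iid, pure]; congr 1; funext i; exact i.elim0
  | succ N ih =>
    change E (fun a => (E.map φ).iid N fun v => f (Fin.cons (φ a) v)) =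
      E fun a => E.iid N fun v => f fun i => φ ((Fin.cons a v : Fin (N + 1) → α) i)
    congr 1
    funext a
    rw [ih]
    congr 1
    funext v
    congr 1
    funext i
    refine Fin.cases ?_ (fun i => ?_) i <;> simp

theorem Realizes.congr {M : Set Query} {G : Graph} {T : Set ℝ} {α : Type}
    {P : (α → Alg M) → Alg M} {E E' : Expect α} {c : ℕ} (h : Realizes G T P E c)
    (hE : ∀ f, E' f = E f) : Realizes G T P E' c := fun k q => (hE _).le.trans (h k q)

/-- `Additive` counts without weights; binary digits write an integer weight function as a
combination of indicators of sets. -/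
theorem cast_eq_sum_testBit {m B : ℕ} (h : m < 2 ^ B) :
    (m : ℝ) = ∑ b ∈ Finset.range B, if m.testBit b then (2 : ℝ) ^ b else 0 := by
  induction B generalizing m with
  | zero => simp at h; simp [h]
  | succ B ih =>
    rw [Finset.sum_range_succ']
    have h1 : m / 2 < 2 ^ B := by rw [pow_succ] at h; omega
    have h2 := ih h1
    have h3 : ∑ b ∈ Finset.range B, (if m.testBit (b + 1) then (2 : ℝ) ^ (b + 1) else 0) =
        2 * ((m / 2 : ℕ) : ℝ) := by
      rw [h2, Finset.mul_sum]
      refine Finset.sum_congr rfl fun b _ => ?_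
      rw [Nat.testBit_add_one]
      split_ifs <;> ring
    have h4 : (if m.testBit 0 then (2 : ℝ) ^ 0 else 0) = ((m % 2 : ℕ) : ℝ) := by
      rw [Nat.testBit_zero]
      rcases Nat.mod_two_eq_zero_or_one m with h | h <;> simp [h]
    rw [h3, h4]
    exact_mod_cast (Nat.div_add_mod m 2).symm

/-- The number of ordered adjacent pairs between two sets from four counts of edges inside sets. -/
theorem Graph.sum_adj_eq_card_edgesIn (G : Graph) (S T : Finset ℕ) :
    ((G.edgesIn (S ∪ T)).card : ℝ) + (G.edgesIn (S ∩ T)).card - (G.edgesIn (S \ T)).card -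
      (G.edgesIn (T \ S)).card = ∑ x ∈ S, ∑ y ∈ T, G.adj x y := by
  have hS : ∀ F : ℕ → ℝ, ∑ x ∈ S, F x = ∑ x ∈ S \ T, F x + ∑ x ∈ S ∩ T, F x := fun F =>
    by
    rw [add_comm]; exact (Finset.sum_inter_add_sum_sdiff S T F).symm
  have hT : ∀ F : ℕ → ℝ, ∑ x ∈ T, F x = ∑ x ∈ T \ S, F x + ∑ x ∈ S ∩ T, F x := fun F => by
    rw [Finset.inter_comm, add_comm]; exact (Finset.sum_inter_add_sum_sdiff T S F).symm
  have hU : ∀ F : ℕ → ℝ, ∑ x ∈ S ∪ T, F x =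
      ∑ x ∈ S \ T, F x + ∑ x ∈ T \ S, F x + ∑ x ∈ S ∩ T, F x := fun F => by
    rw [← Finset.sdiff_union_self_eq_union, Finset.sum_union Finset.sdiff_disjoint, hT F, add_assoc]
  have hc : ∀ A B : Finset ℕ, ∑ x ∈ A, ∑ y ∈ B, G.adj x y = ∑ x ∈ B, ∑ y ∈ A, G.adj x y := by
    intro A B
    rw [Finset.sum_comm]
    exact Finset.sum_congr rfl fun x _ => Finset.sum_congr rfl fun y _ => G.adj_comm _ _
  have h1 := G.two_mul_card_edgesIn (S ∪ T)
  have h2 := G.two_mul_card_edgesIn (S ∩ T)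
  have h3 := G.two_mul_card_edgesIn (S \ T)
  have h4 := G.two_mul_card_edgesIn (T \ S)
  rw [hS]
  simp only [hT, hU, Finset.sum_add_distrib] at h1 ⊢
  have c1 := hc (S \ T) (T \ S)
  have c2 := hc (S \ T) (S ∩ T)
  have c3 := hc (T \ S) (S ∩ T)
  linarith

/-! ### Counting edges between weighted sets -/

theorem additive_mem (S : Finset ℕ) : Query.additive S ∈ advancedModel := trivial

/-- The number of ordered adjacent pairs between `S` and `T`. -/
def cutP (S T : Finset ℕ) (k : ℝ → Alg advancedModel) : Alg advancedModel :=
  .query (.additive (S ∪ T)) (additive_mem _) fun a : ℕ =>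
    .query (.additive (S ∩ T)) (additive_mem _) fun b : ℕ =>
      .query (.additive (S \ T)) (additive_mem _) fun c : ℕ =>
        .query (.additive (T \ S)) (additive_mem _) fun d : ℕ => k ((a : ℝ) + b - c - d)

/-- The bilinear form of the adjacency matrix at two weight functions on `A` and `A'`. -/
def formP (B : ℕ) (A A' : Finset ℕ) (α β : ℕ → ℕ) (k : ℝ → Alg advancedModel) :
    Alg advancedModel :=
  sumP (fun b => sumP (fun b' k => cutP (A.filter fun x => (α x).testBit b)
    (A'.filter fun x => (β x).testBit b') fun x => k (2 ^ b * 2 ^ b' * x)) B) B k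

section estimators
variable {G : Graph} {T : Set ℝ}

theorem realizes_cutP (S S' : Finset ℕ) :
    Realizes G T (cutP S S') (.pure (∑ x ∈ S, ∑ y ∈ S', G.adj x y)) (4 * (S.card + S'.card)) := by
  have h1 := Finset.card_union_le S S'
  have h2 := Finset.card_le_card (Finset.inter_subset_left (s₁ := S) (s₂ := S'))
  have h3 := Finset.card_le_card (Finset.sdiff_subset (s := S) (t := S'))
  have h4 := Finset.card_le_card (Finset.sdiff_subset (s := S') (t := S))
  have := ((realizes_additive (G := G) (T := T) _ (additive_mem (S ∪ S'))).bind fun a : ℕ =>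
    (realizes_additive _ (additive_mem (S ∩ S'))).bind fun b : ℕ =>
      (realizes_additive _ (additive_mem (S \ S'))).bind fun c : ℕ =>
        (realizes_additive _ (additive_mem (S' \ S))).map
          fun d : ℕ => ((a : ℝ) + b - c - d))
  refine (this.mono (c' := 4 * (S.card + S'.card)) (by omega)).congr fun f => ?_
  exact congrArg f (G.sum_adj_eq_card_edgesIn S S').symm

theorem realizes_formP {B : ℕ} (A A' : Finset ℕ) {α β : ℕ → ℕ} (hα : ∀ x, α x < 2 ^ B)
    (hβ : ∀ x, β x < 2 ^ B) :
    Realizes G T (formP B A A' α β)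
      (.pure (∑ x ∈ A, α x * ∑ y ∈ A', β y * G.adj x y))
      (B * (B * (4 * (A.card + A'.card)))) := by
  have h : ∀ b b', Realizes G T (fun k => cutP (A.filter fun x => (α x).testBit b)
      (A'.filter fun x => (β x).testBit b') fun x => k (2 ^ b * 2 ^ b' * x))
      (.pure (2 ^ b * 2 ^ b' * ∑ x ∈ A.filter fun x => (α x).testBit b,
        ∑ y ∈ A'.filter fun x => (β x).testBit b', G.adj x y)) (4 * (A.card + A'.card)) := by
    intro b b'
    refine ((realizes_cutP _ _).map fun x => 2 ^ b * 2 ^ b' * x).mono ?_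
    have h1 := Finset.card_filter_le A fun x => (α x).testBit b
    have h2 := Finset.card_filter_le A' fun x => (β x).testBit b'
    omega
  refine (Realizes.sumP (fun b => Realizes.sumP (h b) B) B).congr fun f => ?_
  change f _ = f _
  congr 1
  calc _ = ∑ x ∈ A, ∑ y ∈ A', (∑ b ∈ Finset.range B, if (α x).testBit b then (2 : ℝ) ^ b else 0) *
        (∑ b ∈ Finset.range B, if (β y).testBit b then (2 : ℝ) ^ b else 0) * G.adj x y := by
        refine Finset.sum_congr rfl fun x _ => ?_
        rw [Finset.mul_sum]
        refine Finset.sum_congr rfl fun y _ => ?_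
        rw [← cast_eq_sum_testBit (hα x), ← cast_eq_sum_testBit (hβ y)]
        ring
    _ = ∑ x ∈ A, ∑ y ∈ A', ∑ b ∈ Finset.range B, ∑ b' ∈ Finset.range B,
        (if (α x).testBit b then (2 : ℝ) ^ b else 0) *
        (if (β y).testBit b' then (2 : ℝ) ^ b' else 0) * G.adj x y := by
        refine Finset.sum_congr rfl fun x _ => Finset.sum_congr rfl fun y _ => ?_
        rw [Finset.sum_mul_sum, Finset.sum_mul]
        exact Finset.sum_congr rfl fun b _ => Finset.sum_mul _ _ _
    _ = ∑ b ∈ Finset.range B, ∑ b' ∈ Finset.range B, ∑ x ∈ A, ∑ y ∈ A',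
        (if (α x).testBit b then (2 : ℝ) ^ b else 0) *
        (if (β y).testBit b' then (2 : ℝ) ^ b' else 0) * G.adj x y := by
        rw [Finset.sum_congr rfl fun x _ => Finset.sum_comm, Finset.sum_comm]
        refine Finset.sum_congr rfl fun b _ => ?_
        rw [Finset.sum_congr rfl fun x _ => Finset.sum_comm, Finset.sum_comm]
    _ = _ := by
        refine Finset.sum_congr rfl fun b _ => Finset.sum_congr rfl fun b' _ => ?_
        rw [Finset.mul_sum, Finset.sum_filter]
        refine Finset.sum_congr rfl fun x _ => ?_
        split_ifs
        · rw [Finset.mul_sum, Finset.sum_filter]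
          refine Finset.sum_congr rfl fun y _ => ?_
          split_ifs <;> ring
        · simp

/-! ### Sampling edges with their degrees -/

/-- A random edge and the degrees of its ends. -/
def edgeP (k : Sym2 ℕ × ℕ × ℕ → Alg advancedModel) : Alg advancedModel :=
  .query .randEdge trivial fun e : Sym2 ℕ => .query (.degree e.inf) trivial fun a : ℕ =>
    .query (.degree e.sup) trivial fun b : ℕ => k (e, a, b)

/-- The degree of a random vertex. -/
def vertP (k : ℕ → Alg advancedModel) : Alg advancedModel :=
  .query .randVert trivial fun x : ℕ => .query (.degree x) trivial fun a : ℕ => k a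

/-- An edge together with the degrees of its ends. -/
noncomputable def Graph.withDeg (G : Graph) (e : Sym2 ℕ) : Sym2 ℕ × ℕ × ℕ :=
  (e, G.deg e.inf, G.deg e.sup)

theorem realizes_edgeP : Realizes G T edgeP (G.edgeE.map G.withDeg) 3 := by
  have h : ∀ e : Sym2 ℕ, Realizes G T (M := advancedModel) (fun k =>
      .query (.degree e.inf) trivial fun a : ℕ => .query (.degree e.sup) trivial fun b : ℕ =>
        k (e, a, b)) (.pure (G.withDeg e)) 2 := fun e k q =>
    (realizes_degree (M := advancedModel) e.sup trivial (fun b => k (e, G.deg e.inf, b)) q).trans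
      (realizes_degree (M := advancedModel) e.inf trivial
        (fun a => .query (.degree e.sup) trivial fun b : ℕ => k (e, a, b)) (q + 1))
  exact fun k q => (realizes_randEdge (M := advancedModel) trivial).bind h k q

theorem realizes_vertP : Realizes G T vertP (G.vertE.map G.deg) 2 :=
  ((realizes_randVert (M := advancedModel) trivial).bind fun x =>
    realizes_degree (M := advancedModel) x trivial).congr fun _ => rfl

/-! ### The heavy edge estimator -/

/-- An integer multiple of `wt`. -/
def wtN (L n t d : ℕ) : ℕ := if n < d * t ^ 3 then 2 ^ (L - d.size) else 0

theorem wtN_le (L n t d : ℕ) : wtN L n t d ≤ 2 ^ L := by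
  unfold wtN
  split_ifs
  · exact Nat.pow_le_pow_right two_pos (by omega)
  · positivity

theorem cast_wtN {L n t d : ℕ} (h : d.size ≤ L) : (wtN L n t d : ℝ) = 2 ^ L * wt n t d := by
  unfold wtN wt
  split_ifs
  · push_cast
    rw [pow_sub₀ _ two_ne_zero h]
  · simp

/-- The total weight that a sample of edges puts on the label `x`. -/
def mult (L n t : ℕ) {N : ℕ} (ξ : Fin N → Sym2 ℕ × ℕ × ℕ) (x : ℕ) : ℕ :=
  ∑ i, ((if (ξ i).1.inf = x then wtN L n t (ξ i).2.1 else 0) +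
    if (ξ i).1.sup = x then wtN L n t (ξ i).2.2 else 0)

/-- The ends of the edges of a sample. -/
def ends {N : ℕ} (ξ : Fin N → Sym2 ℕ × ℕ × ℕ) : Finset ℕ :=
  (Finset.univ.image fun i => (ξ i).1.inf) ∪ Finset.univ.image fun i => (ξ i).1.sup

theorem card_ends_le {N : ℕ} (ξ : Fin N → Sym2 ℕ × ℕ × ℕ) : (ends ξ).card ≤ 2 * N := by
  refine (Finset.card_union_le _ _).trans ?_
  have h1 := Finset.card_image_le (s := Finset.univ) (f := fun i => (ξ i).1.inf)
  have h2 := Finset.card_image_le (s := Finset.univ) (f := fun i => (ξ i).1.sup)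
  rw [Finset.card_univ, Fintype.card_fin] at h1 h2
  omega

theorem mult_le (L n t : ℕ) {N : ℕ} (ξ : Fin N → Sym2 ℕ × ℕ × ℕ) (x : ℕ) :
    mult L n t ξ x ≤ 2 * N * 2 ^ L := by
  calc mult L n t ξ x ≤ ∑ _i : Fin N, (2 ^ L + 2 ^ L) := by
        refine Finset.sum_le_sum fun i _ => Nat.add_le_add ?_ ?_ <;> split_ifs <;>
          first | exact wtN_le _ _ _ _ | exact Nat.zero_le _
    _ = _ := by simp; ring

/-- `Additive` takes sets, so repeated ends of a sample are merged into one label with multiplicity;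
this undoes the merging. -/
theorem sum_mult_mul {L t : ℕ} (hL : G.n.size ≤ L) {N : ℕ} (ξ : Fin N → Sym2 ℕ) (F : ℕ → ℝ) :
    ∑ x ∈ ends (fun i => G.withDeg (ξ i)), (mult L G.n t (fun i => G.withDeg (ξ i)) x : ℝ) * F x =
      2 ^ L * ∑ i, (wt G.n t (G.deg (ξ i).inf) * F (ξ i).inf +
        wt G.n t (G.deg (ξ i).sup) * F (ξ i).sup) := by
  have hw : ∀ x, (wtN L G.n t (G.deg x) : ℝ) = 2 ^ L * wt G.n t (G.deg x) := fun x =>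
    cast_wtN ((Nat.size_le_size (G.deg_le x)).trans hL)
  simp only [mult, Nat.cast_sum, Finset.sum_mul]
  rw [Finset.sum_comm, Finset.mul_sum]
  refine Finset.sum_congr rfl fun i _ => ?_
  have h1 : (ξ i).inf ∈ ends (fun i => G.withDeg (ξ i)) :=
    Finset.mem_union_left _ (Finset.mem_image.2 ⟨i, Finset.mem_univ _, rfl⟩)
  have h2 : (ξ i).sup ∈ ends (fun i => G.withDeg (ξ i)) :=
    Finset.mem_union_right _ (Finset.mem_image.2 ⟨i, Finset.mem_univ _, rfl⟩)
  have key : ∀ a w : ℕ, a ∈ ends (fun i => G.withDeg (ξ i)) →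
      ∑ x ∈ ends (fun i => G.withDeg (ξ i)), ((if a = x then w else 0 : ℕ) : ℝ) * F x =
        w * F a := by
    intro a w ha
    rw [Finset.sum_eq_single a]
    · simp
    · intro x _ hx; simp [hx.symm]
    · exact fun h => absurd ha h
  simp only [Nat.cast_add, add_mul, Finset.sum_add_distrib]
  rw [key (G.withDeg (ξ i)).1.inf _ h1, key (G.withDeg (ξ i)).1.sup _ h2]
  change (wtN L G.n t (G.deg (ξ i).inf) : ℝ) * F (ξ i).inf +
    (wtN L G.n t (G.deg (ξ i).sup) : ℝ) * F (ξ i).sup = _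
  rw [hw, hw]
  ring

/-- The heavy edge estimator from two samples of `N` edges. -/
noncomputable def batchP (B L n t N : ℕ) (k : ℝ → Alg advancedModel) : Alg advancedModel :=
  rep edgeP N fun ξ => rep edgeP N fun ζ =>
    formP B (ends ξ) (ends ζ) (mult L n t ξ) (mult L n t ζ) fun x =>
      -- `(2 ^ L) ^ 2` removes the integer scaling of both weights, `4` averages over the ends of
      -- both edges, and `N ^ 2` over the pairs.
      k (n * (x / (4 * (2 ^ L) ^ 2) / N ^ 2))

theorem realizes_batchP {B L t N : ℕ} (hL : G.n.size ≤ L) (hB : 2 * N * 2 ^ L < 2 ^ B) :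
    Realizes G T (batchP B L G.n t N)
      (((G.edgeE.iid N).prod (G.edgeE.iid N)).map fun w =>
        G.n * ((∑ i, ∑ j, G.edgeKer t (w.1 i) (w.2 j)) / N ^ 2)) (6 * N + B * (B * (16 * N))) := by
  have h : ∀ ξ ζ : Fin N → Sym2 ℕ × ℕ × ℕ, Realizes G T
      (formP B (ends ξ) (ends ζ) (mult L G.n t ξ) (mult L G.n t ζ))
      (.pure (∑ x ∈ ends ξ, mult L G.n t ξ x * ∑ y ∈ ends ζ, mult L G.n t ζ y * G.adj x y))
      (B * (B * (16 * N))) := by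
    intro ξ ζ
    refine (realizes_formP (ends ξ) (ends ζ) (fun x => (mult_le L G.n t ξ x).trans_lt hB)
      (fun x => (mult_le L G.n t ζ x).trans_lt hB)).mono ?_
    have h1 := card_ends_le ξ
    have h2 := card_ends_le ζ
    exact Nat.mul_le_mul_left _ (Nat.mul_le_mul_left _ (by omega))
  have hP := (realizes_edgeP (G := G) (T := T)).rep N
  refine ((hP.bind fun ξ => hP.bind fun ζ => (h ξ ζ).map fun x =>
    G.n * (x / (4 * (2 ^ L) ^ 2) / N ^ 2)).mono (by omega)).congr fun f => ?_
  change G.edgeE.iid N (fun ξ => G.edgeE.iid N fun ζ => f _) =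
    (G.edgeE.map G.withDeg).iid N fun ξ => (G.edgeE.map G.withDeg).iid N fun ζ => f _
  rw [Expect.iid_map]
  congr 1
  funext ξ
  rw [Expect.iid_map]
  congr 1
  funext ζ
  congr 2
  rw [sum_mult_mul hL]
  simp only [sum_mult_mul hL]
  congr 1
  congr 1
  rw [eq_div_iff (by positivity), Finset.sum_mul, Finset.mul_sum]
  refine Finset.sum_congr rfl fun i _ => ?_
  simp only [Finset.mul_sum, ← Finset.sum_add_distrib, Finset.sum_mul]
  refine Finset.sum_congr rfl fun j _ => ?_
  simp only [Graph.edgeKer, Graph.ker]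
  ring

end estimators

/-! ### The decision at one scale -/

/-- The output at scale `t` for given values of the statistics, if there is one. -/
noncomputable def decideAt (n t X H F Y Z : ℝ) : Option ℝ :=
  if 2 / t ≤ X then some (1 / X)
  else if 1 / 16 ≤ H then
    if 2 / (65536 * (n / t ^ 4)) ≤ Z then some (H / Z) else none
  else if 2 * (n / t ^ 4) ≤ Y then some (Y / F) else none

/-- For `ε < 1` the constant `8` leaves room: `1 + ε/8 ≤ (1 - ε/8) * (1 + ε)`. -/
theorem isApprox_div {ε d u v a b : ℝ} (hε0 : 0 < ε) (hε1 : ε < 1) (ha : 0 < a) (hb : 0 < b)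
    (hd : a / b = d) (hu : |u - a| ≤ ε / 8 * a) (hv : |v - b| ≤ ε / 8 * b) :
    IsApprox (1 + ε) d (u / v) := by
  rw [abs_le] at hu hv
  have hv0 : 0 < v := by nlinarith
  have hu0 : 0 < u := by nlinarith
  subst hd
  constructor
  · rw [div_div, div_le_div_iff₀ (by positivity) hv0]
    calc a * v ≤ a * (b * (1 + ε / 8)) := by gcongr; linarith
      _ ≤ (a * (1 - ε / 8)) * (b * (1 + ε)) := by
          have : (1 + ε / 8) ≤ (1 - ε / 8) * (1 + ε) := by nlinarith
          calc a * (b * (1 + ε / 8)) = a * b * (1 + ε / 8) := by ring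
            _ ≤ a * b * ((1 - ε / 8) * (1 + ε)) := by gcongr
            _ = _ := by ring
      _ ≤ u * (b * (1 + ε)) := by gcongr; linarith
  · rw [← mul_div_assoc, div_le_div_iff₀ hv0 hb]
    calc u * b ≤ (a * (1 + ε / 8)) * b := by gcongr; linarith
      _ ≤ (1 + ε) * a * (b * (1 - ε / 8)) := by
          have : (1 + ε / 8) ≤ (1 - ε / 8) * (1 + ε) := by nlinarith
          calc a * (1 + ε / 8) * b = a * b * (1 + ε / 8) := by ring
            _ ≤ a * b * ((1 - ε / 8) * (1 + ε)) := by gcongr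
            _ = _ := by ring
      _ ≤ (1 + ε) * a * v := by gcongr; linarith

theorem isApprox_inv {ε d x : ℝ} (hε0 : 0 < ε) (hε1 : ε < 1) (hd : 0 < d)
    (hx : |x - d⁻¹| ≤ ε / 8 * d⁻¹) : IsApprox (1 + ε) d (1 / x) :=
  isApprox_div hε0 hε1 one_pos (inv_pos.2 hd) (by simp) (by simp; positivity) hx

-- Each error is relative to the maximum of the mean and a threshold. An estimate of at least twice
-- the threshold forces the mean above the threshold, so the error is truly relative and the answer
-- is sound at every scale. Conversely, `4 * d ≤ t` makes the test on `X` succeed, and `16 * D ≤ d ≤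
-- 256 * D` with `D = n / t^4` makes the relevant later test succeed: the lower bound serves `Y`,
-- the upper one `Z`.
set_option maxHeartbeats 1000000 in
theorem decideAt_spec {ε n t d φ h X H F Y Z : ℝ} (hε0 : 0 < ε) (hε1 : ε < 1) (hn : 0 < n)
    (ht : 0 < t) (hd : 0 < d) (hh0 : 0 ≤ h) (hh1 : h ≤ 1) (hφ0 : 0 ≤ φ)
    (hhφ : 1 ≤ 4 * h + 2 * φ)
    (hX : |X - d⁻¹| ≤ ε / 8 * max d⁻¹ t⁻¹) (hH : |H - h| ≤ ε / 256) (hF : |F - φ| ≤ ε / 256)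
    (hY : |Y - d * φ| ≤ ε / 8 * max (d * φ) (n / t ^ 4))
    (hZ : |Z - h / d| ≤ ε / 256 * max d⁻¹ (65536 * (n / t ^ 4))⁻¹) :
    (∀ r, decideAt n t X H F Y Z = some r → IsApprox (1 + ε) d r) ∧
      ((4 * d ≤ t ∨ 16 * (n / t ^ 4) ≤ d ∧ d ≤ 256 * (n / t ^ 4)) →
        decideAt n t X H F Y Z ≠ none) := by
  set D := n / t ^ 4 with hD
  have hD0 : 0 < D := by positivity
  have hdi : 0 < d⁻¹ := inv_pos.2 hd
  have hti : 0 < t⁻¹ := inv_pos.2 ht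
  have hDi : 0 < (65536 * D)⁻¹ := by positivity
  by_cases c1 : 2 / t ≤ X
  · rw [decideAt, if_pos c1]
    refine ⟨?_, fun _ => by simp⟩
    rintro r ⟨⟩
    refine isApprox_inv hε0 hε1 hd ?_
    have : t⁻¹ ≤ d⁻¹ := by
      by_contra hlt
      rw [not_le] at hlt
      rw [max_eq_right hlt.le, abs_le] at hX
      rw [div_eq_mul_inv] at c1
      nlinarith
    rwa [max_eq_left this] at hX
  have c1' : ¬ 4 * d ≤ t := by
    intro h4
    have h5 : t⁻¹ * 4 ≤ d⁻¹ := by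
      rw [← div_eq_inv_mul, div_le_iff₀ ht, ← div_eq_inv_mul, le_div_iff₀ hd]; linarith
    rw [max_eq_left (by linarith), abs_le] at hX
    rw [div_eq_mul_inv] at c1
    nlinarith
  rw [abs_le] at hH hF
  by_cases c2 : 1 / 16 ≤ H
  · have hh : 1 / 32 ≤ h := by linarith
    have hhd : d⁻¹ / 32 ≤ h / d := by
      rw [div_eq_mul_inv h]; nlinarith
    have hhd1 : h / d ≤ d⁻¹ := by rw [div_eq_mul_inv h]; nlinarith
    by_cases c3 : 2 / (65536 * D) ≤ Z
    · rw [decideAt, if_neg c1, if_pos c2, if_pos c3]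
      refine ⟨?_, fun _ => by simp⟩
      rintro r ⟨⟩
      have hmax : (65536 * D)⁻¹ ≤ d⁻¹ := by
        by_contra hlt
        rw [not_le] at hlt
        rw [max_eq_right hlt.le, abs_le] at hZ
        rw [div_eq_mul_inv] at c3
        nlinarith
      rw [max_eq_left hmax] at hZ
      refine isApprox_div hε0 hε1 (a := h) (b := h / d) (by linarith) (by positivity) ?_ ?_ ?_
      · have : h ≠ 0 := by linarith
        field_simp
      · rw [abs_le]; constructor <;> nlinarith
      · refine hZ.trans ?_
        nlinarith
    · rw [decideAt, if_neg c1, if_pos c2, if_neg c3]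
      refine ⟨by simp, ?_⟩
      rintro (h4 | ⟨h5, h6⟩)
      · exact absurd h4 c1'
      · exfalso
        -- From `d ≤ 256 * D`, since `65536 = 256^2`. The mean `h / d` is at least `d⁻¹ / 32`, well
        -- above twice this threshold.
        have hmax : (65536 * D)⁻¹ ≤ d⁻¹ / 256 := by
          rw [div_eq_mul_inv, ← mul_inv]
          exact inv_anti₀ (by positivity) (by linarith)
        rw [max_eq_left (by linarith), abs_le] at hZ
        rw [div_eq_mul_inv] at c3
        nlinarith
  -- A small `H` makes `h` small, and then `hhφ` forces many light ends.
  · have hφ : 1 / 4 ≤ φ := by linarith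
    by_cases c3 : 2 * D ≤ Y
    · rw [decideAt, if_neg c1, if_neg c2, if_pos c3]
      refine ⟨?_, fun _ => by simp⟩
      rintro r ⟨⟩
      have hmax : D ≤ d * φ := by
        by_contra hlt
        rw [not_le] at hlt
        rw [max_eq_right hlt.le, abs_le] at hY
        nlinarith
      rw [max_eq_left hmax] at hY
      refine isApprox_div hε0 hε1 (a := d * φ) (b := φ) (by positivity) (by linarith) ?_ hY ?_
      · exact mul_div_cancel_right₀ d (by linarith : 0 < φ).ne'
      · rw [abs_le]; constructor <;> nlinarith
    · rw [decideAt, if_neg c1, if_neg c2, if_neg c3]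
      refine ⟨by simp, ?_⟩
      rintro (h4 | ⟨h5, h6⟩)
      · exact absurd h4 c1'
      · exfalso
        have h7 : 4 * D ≤ d * φ := by nlinarith
        rw [max_eq_left (by linarith), abs_le] at hY
        nlinarith

/-! ### Deviation bounds for the statistics -/

namespace Expect
variable {α : Type}

theorem prob_mono (E : Expect α) {P Q : α → Prop} (h : ∀ a, P a → Q a) : E.prob P ≤ E.prob Q := by
  refine E.mono fun a => ?_
  by_cases h1 : P a
  · simp [h1, h a h1]
  · simp only [h1, if_false]; split_ifs <;> norm_num

theorem iid_sum (E : Expect α) (X : α → ℝ) (N : ℕ) :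
    E.iid N (fun v => ∑ i, X (v i)) = N * E X := by
  induction N with
  | zero => simp [iid, pure]
  | succ N ih =>
    change E (fun a => E.iid N fun v => ∑ i : Fin (N + 1),
      X ((Fin.cons a v : Fin (N + 1) → α) i)) = _
    simp only [Fin.sum_univ_succ, Fin.cons_zero, Fin.cons_succ, map_add, map_const, ih]
    push_cast
    ring

/-- Chebyshev's inequality for an empirical mean. -/
theorem prob_mean_le (E : Expect α) (X : α → ℝ) {μ v δ c : ℝ} (hμ : E X = μ)
    (hv : E (fun a => (X a - μ) ^ 2) ≤ v) {N : ℕ} (hN : 0 < N) (hδ : 0 < δ)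
    (hc : v / N ≤ c * δ ^ 2) :
    (E.iid N).prob (fun w => δ < |(∑ i, X (w i)) / N - μ|) ≤ c := by
  refine (prob_lt_abs_sub_le _ _ μ hδ (E.iid_mean_sq X hμ hv hN)).trans ?_
  rw [div_le_iff₀ (by positivity)]
  exact hc

end Expect

namespace Graph
variable (G : Graph)

/-- The statistic lies in `[0, 1]`, so its second moment is at most its mean. -/
theorem edgeE_sq_statX_le :
    (G.edgeE.map G.withDeg) (fun w => (statX w.2.1 w.2.2 - G.avgDeg⁻¹) ^ 2) ≤ G.avgDeg⁻¹ := by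
  refine (Expect.sq_sub_le (G.edgeE.map G.withDeg) (fun w => statX w.2.1 w.2.2)
    G.edgeE_statX).trans ?_
  refine le_trans (Expect.mono _ fun w => sq_le_self_of_mem (statX_nonneg _ _) (statX_le_one _ _)) ?_
  exact G.edgeE_statX.le

/-- The mean of the statistic `statF`. -/
noncomputable def meanF (t : ℕ) : ℝ :=
  G.edgeE (fun e => statF G.n t (G.deg e.inf) (G.deg e.sup))

/-- The mean of the statistic `statH`. -/
noncomputable def meanH (t : ℕ) : ℝ :=
  G.edgeE (fun e => statH G.n t (G.deg e.inf) (G.deg e.sup))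

theorem meanF_nonneg (t : ℕ) : 0 ≤ G.meanF t := Expect.nonneg _ fun _ => statF_nonneg _ _ _ _

theorem meanH_nonneg (t : ℕ) : 0 ≤ G.meanH t := Expect.nonneg _ fun _ => statH_nonneg _ _ _ _

theorem meanH_le_one (t : ℕ) : G.meanH t ≤ 1 := by
  rw [← G.edgeE.map_const 1]
  exact Expect.mono _ fun _ => statH_le_one _ _ _ _

theorem one_le_meanH_meanF (t : ℕ) : 1 ≤ 4 * G.meanH t + 2 * G.meanF t := by
  unfold meanH meanF
  rw [← Expect.map_const_mul, ← Expect.map_const_mul, ← Expect.map_add, ← G.edgeE.map_const 1]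
  exact Expect.mono _ fun _ => one_le_statH_statF _ _ _ _

theorem edgeE_sq_statF_le (t : ℕ) :
    (G.edgeE.map G.withDeg) (fun w => (statF G.n t w.2.1 w.2.2 - G.meanF t) ^ 2) ≤ 1 := by
  refine (Expect.sq_sub_le (G.edgeE.map G.withDeg) (fun w => statF G.n t w.2.1 w.2.2)
    (μ := G.meanF t) rfl).trans ?_
  rw [← (G.edgeE.map G.withDeg).map_const 1]
  exact Expect.mono _ fun w => pow_le_one₀ (statF_nonneg _ _ _ _) (statF_le_one _ _ _ _)

theorem edgeE_sq_statH_le (t : ℕ) :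
    (G.edgeE.map G.withDeg) (fun w => (statH G.n t w.2.1 w.2.2 - G.meanH t) ^ 2) ≤ 1 := by
  refine (Expect.sq_sub_le (G.edgeE.map G.withDeg) (fun w => statH G.n t w.2.1 w.2.2)
    (μ := G.meanH t) rfl).trans ?_
  rw [← (G.edgeE.map G.withDeg).map_const 1]
  exact Expect.mono _ fun w => pow_le_one₀ (statH_nonneg _ _ _ _) (statH_le_one _ _ _ _)

theorem vertE_statY (t : ℕ) :
    (G.vertE.map G.deg) (fun w => statY G.n t w) = G.avgDeg * G.meanF t := (G.edgeE_statF t).symm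

/-- Light degrees are at most `n / t^3`, so the second moment is at most this cap times the mean. -/
theorem vertE_sq_statY_le {t : ℕ} (ht : 0 < t) :
    (G.vertE.map G.deg) (fun w => (statY G.n t w - G.avgDeg * G.meanF t) ^ 2) ≤
      G.n / t ^ 3 * (G.avgDeg * G.meanF t) := by
  refine (Expect.sq_sub_le (G.vertE.map G.deg) (fun w => statY G.n t w) (G.vertE_statY t)).trans ?_
  rw [← G.vertE_statY t, ← Expect.map_const_mul]
  refine Expect.mono _ fun w => ?_
  have ht' : (0 : ℝ) < t := by exact_mod_cast ht
  unfold statY lightInd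
  split_ifs with h
  · simp
  · have h' : (w : ℝ) * t ^ 3 ≤ G.n := by exact_mod_cast not_lt.1 h
    have : (w : ℝ) ≤ G.n / t ^ 3 := by rw [le_div_iff₀ (by positivity)]; exact h'
    rw [mul_one, sq]
    gcongr

/-- The distribution of the heavy edge estimator from two samples of `N` edges. -/
noncomputable def batchE (t N : ℕ) : Expect ℝ :=
  ((G.edgeE.iid N).prod (G.edgeE.iid N)).map fun w =>
    G.n * ((∑ i, ∑ j, G.edgeKer t (w.1 i) (w.2 j)) / N ^ 2)

theorem n_mul_inv_two_mul_card : (G.n : ℝ) * (2 * (G.edges.card : ℝ))⁻¹ = G.avgDeg⁻¹ := by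
  have h1 := G.one_le_avgDeg
  have h6 : (0 : ℝ) < G.n := by exact_mod_cast G.n_pos
  rw [two_mul_card_edges, mul_inv, ← mul_assoc, mul_inv_cancel₀ h6.ne', one_mul]

theorem batchE_mean (t : ℕ) {N : ℕ} (hN : 0 < N) :
    G.batchE t N (fun z => z) = G.meanH t / G.avgDeg := by
  have hN' : (N : ℝ) ≠ 0 := Nat.cast_ne_zero.2 hN.ne'
  change G.edgeE.iid N (fun ξ => G.edgeE.iid N fun ζ =>
    G.n * ((∑ i, ∑ j, G.edgeKer t (ξ i) (ζ j)) / N ^ 2)) = _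
  have h1 : ∀ ξ : Fin N → Sym2 ℕ, G.edgeE.iid N (fun ζ =>
      G.n * ((∑ i, ∑ j, G.edgeKer t (ξ i) (ζ j)) / N ^ 2)) =
      G.n * (N * (∑ i, G.edgeE (G.edgeKer t (ξ i))) / N ^ 2) := by
    intro ξ
    rw [Expect.map_const_mul, Expect.map_div_const]
    congr 2
    rw [show (fun ζ : Fin N → Sym2 ℕ => ∑ i, ∑ j, G.edgeKer t (ξ i) (ζ j)) =
        fun ζ => ∑ j, ∑ i, G.edgeKer t (ξ i) (ζ j) from funext fun ζ => Finset.sum_comm,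
      Expect.iid_sum G.edgeE (fun f => ∑ i, G.edgeKer t (ξ i) f), Expect.map_sum]
  simp only [h1]
  rw [Expect.map_const_mul, Expect.map_div_const, Expect.map_const_mul,
    Expect.iid_sum G.edgeE (fun e => G.edgeE (G.edgeKer t e)), edgeE_edgeE_edgeKer]
  rw [div_eq_mul_inv (G.meanH t), ← G.n_mul_inv_two_mul_card]
  unfold meanH
  field_simp

theorem batchE_sq_le {t : ℕ} {N : ℕ} (hN : 0 < N) :
    G.batchE t N (fun z => (z - G.meanH t / G.avgDeg) ^ 2) ≤
      G.avgDeg⁻¹ * (t ^ 6 / (G.n * N ^ 2)) + 2 * G.avgDeg⁻¹ ^ 2 / N := by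
  have h6 : (0 : ℝ) < G.n := by exact_mod_cast G.n_pos
  -- The second moment of the kernel is at most its maximum times its mean.
  have hV : G.edgeE (fun f => G.edgeE fun e => G.edgeKer t e f ^ 2) ≤
      ((t : ℝ) ^ 3 / G.n) ^ 2 * (2 * (G.edges.card : ℝ))⁻¹ := by
    have h1 : ∀ f, G.edgeE (fun e => G.edgeKer t e f ^ 2) ≤
        ((t : ℝ) ^ 3 / G.n) ^ 2 * (2 * (G.edges.card : ℝ))⁻¹ := by
      intro f
      calc _ ≤ G.edgeE (fun e => ((t : ℝ) ^ 3 / G.n) ^ 2 * G.edgeKer t f e) := by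
            refine Expect.mono _ fun e => ?_
            rw [sq, G.edgeKer_comm t e f]
            exact mul_le_mul_of_nonneg_right (G.edgeKer_le t f e) (G.edgeKer_nonneg t f e)
        _ ≤ _ := by
            rw [Expect.map_const_mul]
            exact mul_le_mul_of_nonneg_left (G.edgeE_edgeKer_le t f) (by positivity)
    exact (Expect.mono _ h1).trans (Expect.map_const _ _).le
  have key := Expect.iid_kernel_sq G.edges G.edges_nonempty (G.edgeKer t) (G.edgeKer_nonneg t)
    (G.edgeE_edgeKer_le t)
    (fun f => by simp only [G.edgeKer_comm t _ f]; exact G.edgeE_edgeKer_le t f)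
    hV (G.edgeE_edgeE_edgeKer t) hN
  have hrw : ∀ w : (Fin N → Sym2 ℕ) × (Fin N → Sym2 ℕ),
      (G.n * ((∑ i, ∑ j, G.edgeKer t (w.1 i) (w.2 j)) / N ^ 2) - G.meanH t / G.avgDeg) ^ 2 =
      (G.n : ℝ) ^ 2 * ((∑ i, ∑ j, G.edgeKer t (w.1 i) (w.2 j)) / N ^ 2 -
        (2 * (G.edges.card : ℝ))⁻¹ * G.meanH t) ^ 2 := by
    intro w
    rw [div_eq_mul_inv (G.meanH t), ← G.n_mul_inv_two_mul_card]
    ring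
  change ((G.edgeE.iid N).prod (G.edgeE.iid N)) (fun w =>
    (G.n * ((∑ i, ∑ j, G.edgeKer t (w.1 i) (w.2 j)) / N ^ 2) - G.meanH t / G.avgDeg) ^ 2) ≤ _
  simp only [hrw]
  rw [Expect.map_const_mul]
  refine (mul_le_mul_of_nonneg_left key (by positivity)).trans (le_of_eq ?_)
  rw [← G.n_mul_inv_two_mul_card]
  have hN' : (N : ℝ) ≠ 0 := Nat.cast_ne_zero.2 hN.ne'
  field_simp

end Graph

/-! ### The algorithm at one scale -/

/-- The decision from samples of edges with degrees, of degrees of vertices, and of values of the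
heavy edge estimator. -/
noncomputable def decideSample (n t : ℕ) {M R : ℕ}
    (w : (Fin M → Sym2 ℕ × ℕ × ℕ) × (Fin M → ℕ) × (Fin R → ℝ)) : Option ℝ :=
  decideAt n t ((∑ i, statX (w.1 i).2.1 (w.1 i).2.2) / M)
    ((∑ i, statH n t (w.1 i).2.1 (w.1 i).2.2) / M) ((∑ i, statF n t (w.1 i).2.1 (w.1 i).2.2) / M)
    ((∑ i, statY n t (w.2.1 i)) / M) ((∑ i, w.2.2 i) / R)

/-- The program at scale `2 ^ j`. -/
noncomputable def scaleP (K S L n j : ℕ) (k : Option ℝ → Alg advancedModel) : Alg advancedModel :=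
  rep edgeP (K * 2 ^ j * S) fun a => rep vertP (K * 2 ^ j * S) fun b =>
    rep (batchP (L + j + 10) L n (2 ^ j) (256 * 2 ^ j)) (K * S) fun c =>
      k (decideSample n (2 ^ j) (a, b, c))

/-- The cost of the program at scale `2 ^ j`. -/
def scaleCost (K S L j : ℕ) : ℕ :=
  K * 2 ^ j * S * 3 + (K * 2 ^ j * S * 2 + K * S * (6 * (256 * 2 ^ j) +
    (L + j + 10) * ((L + j + 10) * (16 * (256 * 2 ^ j)))))

/-- The distribution of the result at scale `2 ^ j`. -/
noncomputable def scaleE (G : Graph) (K S j : ℕ) : Expect (Option ℝ) :=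
  (((G.edgeE.map G.withDeg).iid (K * 2 ^ j * S)).prod
    (((G.vertE.map G.deg).iid (K * 2 ^ j * S)).prod
      ((G.batchE (2 ^ j) (256 * 2 ^ j)).iid (K * S)))).map (decideSample G.n (2 ^ j))

theorem realizes_scaleP {G : Graph} {T : Set ℝ} (K S j : ℕ) :
    Realizes G T (scaleP K S G.n.size G.n j) (scaleE G K S j) (scaleCost K S G.n.size j) := by
  -- The bound of `mult_le` for `N = 256 * 2^j` equals `2 ^ (L + j + 9)`, so `L + j + 10` binary
  -- digits suffice.
  have hB : 2 * (256 * 2 ^ j) * 2 ^ G.n.size < 2 ^ (G.n.size + j + 10) := by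
    have : 0 < 2 ^ G.n.size * 2 ^ j := by positivity
    calc 2 * (256 * 2 ^ j) * 2 ^ G.n.size = 512 * (2 ^ G.n.size * 2 ^ j) := by ring
      _ < 1024 * (2 ^ G.n.size * 2 ^ j) := by omega
      _ = 2 ^ (G.n.size + j + 10) := by rw [pow_add, pow_add]; ring
  exact ((realizes_edgeP.rep _).prod ((realizes_vertP.rep _).prod
    ((realizes_batchP le_rfl hB).rep _))).map _

/-- A result is sound, and there is one if the scale fits the average degree. -/
def GoodResult (G : Graph) (ε : ℝ) (j : ℕ) (o : Option ℝ) : Prop :=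
  (∀ r, o = some r → IsApprox (1 + ε) G.avgDeg r) ∧
    ((4 * G.avgDeg ≤ 2 ^ j ∨ 16 * (G.n / (2 ^ j) ^ 4) ≤ G.avgDeg ∧
      G.avgDeg ≤ 256 * (G.n / (2 ^ j) ^ 4)) → o ≠ none)

theorem div_mul_le_of_one_le {K S ε w : ℝ} (hK : 0 < K) (hS0 : 0 < S) (hS : 1 ≤ S * ε ^ 2)
    (hw : 0 ≤ w) : w / (K * S) ≤ w * ε ^ 2 / K := by
  rw [div_le_div_iff₀ (by positivity) hK]
  calc w * K = w * K * 1 := by ring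
    _ ≤ w * K * (S * ε ^ 2) := by gcongr
    _ = _ := by ring

/-- The variances of the empirical means have the form mean times threshold. This bound turns
Chebyshev's inequality into an error relative to the maximum of the two, as `decideAt_spec`
requires. -/
theorem mul_le_max_sq {a b : ℝ} (ha : 0 ≤ a) (hb : 0 ≤ b) : a * b ≤ max a b ^ 2 := by
  rw [sq]
  exact mul_le_mul (le_max_left _ _) (le_max_right _ _) hb (ha.trans (le_max_left _ _))

section deviation
variable (G : Graph) {K S : ℕ} {ε : ℝ}

theorem prob_statX_le (hK : 0 < K) (hS0 : 0 < S) (hε : 0 < ε) (hS : 1 ≤ S * ε ^ 2) (j : ℕ) :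
    ((G.edgeE.map G.withDeg).iid (K * 2 ^ j * S)).prob (fun w =>
      ε / 8 * max G.avgDeg⁻¹ ((2 ^ j : ℕ) : ℝ)⁻¹ <
        |(∑ i, statX (w i).2.1 (w i).2.2) / (K * 2 ^ j * S : ℕ) - G.avgDeg⁻¹|) ≤ 64 / K := by
  have hK' : (0 : ℝ) < K := by exact_mod_cast hK
  have hS' : (0 : ℝ) < S := by exact_mod_cast hS0
  have hd := G.one_le_avgDeg
  have hx : (0 : ℝ) < G.avgDeg⁻¹ := by positivity
  refine Expect.prob_mean_le (G.edgeE.map G.withDeg) (fun w => statX w.2.1 w.2.2) G.edgeE_statX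
    G.edgeE_sq_statX_le (by positivity) (by positivity) ?_
  set m := max G.avgDeg⁻¹ ((2 ^ j : ℕ) : ℝ)⁻¹ with hm
  calc G.avgDeg⁻¹ / (K * 2 ^ j * S : ℕ) = G.avgDeg⁻¹ * ((2 ^ j : ℕ) : ℝ)⁻¹ / (K * S) := by
        push_cast; field_simp
    _ ≤ m ^ 2 / (K * S) := by
        gcongr; exact mul_le_max_sq hx.le (by positivity)
    _ ≤ m ^ 2 * ε ^ 2 / K := div_mul_le_of_one_le hK' hS' hS (by positivity)
    _ = 64 / K * (ε / 8 * m) ^ 2 := by ring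

theorem one_div_sample_le (hK : 0 < K) (hS0 : 0 < S) (hS : 1 ≤ S * ε ^ 2) (j : ℕ) :
    1 / ((K * 2 ^ j * S : ℕ) : ℝ) ≤ 65536 / K * (ε / 256) ^ 2 := by
  have hK' : (0 : ℝ) < K := by exact_mod_cast hK
  have hS' : (0 : ℝ) < S := by exact_mod_cast hS0
  calc 1 / ((K * 2 ^ j * S : ℕ) : ℝ) ≤ 1 / (K * S) := by
        push_cast
        refine one_div_le_one_div_of_le (by positivity) ?_
        have : (1 : ℝ) ≤ 2 ^ j := one_le_pow₀ (by norm_num)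
        calc (K : ℝ) * S = K * 1 * S := by ring
          _ ≤ K * 2 ^ j * S := by gcongr
    _ ≤ 1 * ε ^ 2 / K := div_mul_le_of_one_le hK' hS' hS zero_le_one
    _ = _ := by ring

theorem prob_statF_le (hK : 0 < K) (hS0 : 0 < S) (hε : 0 < ε) (hS : 1 ≤ S * ε ^ 2) (j : ℕ) :
    ((G.edgeE.map G.withDeg).iid (K * 2 ^ j * S)).prob (fun w => ε / 256 <
      |(∑ i, statF G.n (2 ^ j) (w i).2.1 (w i).2.2) / (K * 2 ^ j * S : ℕ) - G.meanF (2 ^ j)|) ≤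
        65536 / K :=
  Expect.prob_mean_le (G.edgeE.map G.withDeg) (fun w => statF G.n (2 ^ j) w.2.1 w.2.2) rfl
    (G.edgeE_sq_statF_le _) (by positivity) (by positivity) (one_div_sample_le hK hS0 hS j)

theorem prob_statH_le (hK : 0 < K) (hS0 : 0 < S) (hε : 0 < ε) (hS : 1 ≤ S * ε ^ 2) (j : ℕ) :
    ((G.edgeE.map G.withDeg).iid (K * 2 ^ j * S)).prob (fun w => ε / 256 <
      |(∑ i, statH G.n (2 ^ j) (w i).2.1 (w i).2.2) / (K * 2 ^ j * S : ℕ) - G.meanH (2 ^ j)|) ≤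
        65536 / K :=
  Expect.prob_mean_le (G.edgeE.map G.withDeg) (fun w => statH G.n (2 ^ j) w.2.1 w.2.2) rfl
    (G.edgeE_sq_statH_le _) (by positivity) (by positivity) (one_div_sample_le hK hS0 hS j)

theorem prob_statY_le (hK : 0 < K) (hS0 : 0 < S) (hε : 0 < ε) (hS : 1 ≤ S * ε ^ 2) (j : ℕ) :
    ((G.vertE.map G.deg).iid (K * 2 ^ j * S)).prob (fun w =>
      ε / 8 * max (G.avgDeg * G.meanF (2 ^ j)) (G.n / ((2 ^ j : ℕ) : ℝ) ^ 4) <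
        |(∑ i, statY G.n (2 ^ j) (w i)) / (K * 2 ^ j * S : ℕ) - G.avgDeg * G.meanF (2 ^ j)|) ≤
          64 / K := by
  have hK' : (0 : ℝ) < K := by exact_mod_cast hK
  have hS' : (0 : ℝ) < S := by exact_mod_cast hS0
  have hd := G.one_le_avgDeg
  have hn : (0 : ℝ) < G.n := by exact_mod_cast G.n_pos
  have ht : (0 : ℝ) < ((2 ^ j : ℕ) : ℝ) := by positivity
  have hφ := G.meanF_nonneg (2 ^ j)
  have hx : 0 ≤ G.avgDeg * G.meanF (2 ^ j) := mul_nonneg (by linarith) hφ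
  have hy : 0 < G.n / ((2 ^ j : ℕ) : ℝ) ^ 4 := by positivity
  set m := max (G.avgDeg * G.meanF (2 ^ j)) (G.n / ((2 ^ j : ℕ) : ℝ) ^ 4) with hm
  have hm0 : 0 < m := lt_of_lt_of_le hy (le_max_right _ _)
  refine Expect.prob_mean_le (G.vertE.map G.deg) (fun w => statY G.n (2 ^ j) w) (G.vertE_statY _)
    (G.vertE_sq_statY_le (by positivity)) (by positivity) (by positivity) ?_
  calc G.n / ((2 ^ j : ℕ) : ℝ) ^ 3 * (G.avgDeg * G.meanF (2 ^ j)) / (K * 2 ^ j * S : ℕ) =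
        (G.avgDeg * G.meanF (2 ^ j)) * (G.n / ((2 ^ j : ℕ) : ℝ) ^ 4) / (K * S) := by
        push_cast; field_simp
    _ ≤ m ^ 2 / (K * S) := by
        gcongr; exact mul_le_max_sq hx hy.le
    _ ≤ m ^ 2 * ε ^ 2 / K := div_mul_le_of_one_le hK' hS' hS (by positivity)
    _ = 64 / K * (ε / 8 * m) ^ 2 := by ring

theorem prob_batch_le (hK : 0 < K) (hS0 : 0 < S) (hε : 0 < ε) (hS : 1 ≤ S * ε ^ 2) (j : ℕ) :
    ((G.batchE (2 ^ j) (256 * 2 ^ j)).iid (K * S)).prob (fun w =>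
      ε / 256 * max G.avgDeg⁻¹ (65536 * (G.n / ((2 ^ j : ℕ) : ℝ) ^ 4))⁻¹ <
        |(∑ i, w i) / (K * S : ℕ) - G.meanH (2 ^ j) / G.avgDeg|) ≤ 131072 / K := by
  have hK' : (0 : ℝ) < K := by exact_mod_cast hK
  have hS' : (0 : ℝ) < S := by exact_mod_cast hS0
  have hd := G.one_le_avgDeg
  have hx : (0 : ℝ) < G.avgDeg⁻¹ := by positivity
  have hn : (0 : ℝ) < G.n := by exact_mod_cast G.n_pos
  have ht : (1 : ℝ) ≤ ((2 ^ j : ℕ) : ℝ) := by exact_mod_cast Nat.one_le_two_pow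
  have hy : 0 < (65536 * (G.n / ((2 ^ j : ℕ) : ℝ) ^ 4))⁻¹ := by positivity
  set m := max G.avgDeg⁻¹ (65536 * (G.n / ((2 ^ j : ℕ) : ℝ) ^ 4))⁻¹ with hm
  have hm0 : 0 < m := lt_of_lt_of_le hy (le_max_right _ _)
  have hN : 0 < 256 * 2 ^ j := by positivity
  refine Expect.prob_mean_le (G.batchE (2 ^ j) (256 * 2 ^ j)) (fun z => z) (G.batchE_mean _ hN)
    (v := 2 * m ^ 2) ((G.batchE_sq_le hN).trans ?_) (by positivity) (by positivity) ?_
  -- With `N = 256 * t`, the variance term from single pairs is `d⁻¹` times the threshold `(65536 *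
  -- n / t^4)⁻¹`.
  · have e1 : (((2 ^ j : ℕ) : ℝ) ^ 6 / (G.n * ((256 * 2 ^ j : ℕ) : ℝ) ^ 2)) =
        (65536 * (G.n / ((2 ^ j : ℕ) : ℝ) ^ 4))⁻¹ := by
      push_cast
      field_simp
      norm_num
    have e2 : 2 * G.avgDeg⁻¹ ^ 2 / ((256 * 2 ^ j : ℕ) : ℝ) ≤ m ^ 2 := by
      have h2 : (2 : ℝ) ≤ ((256 * 2 ^ j : ℕ) : ℝ) := by
        rw [Nat.cast_mul]; push_cast at ht ⊢; linarith
      rw [div_le_iff₀ (by linarith)]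
      have h3 : G.avgDeg⁻¹ ^ 2 ≤ m ^ 2 := pow_le_pow_left₀ hx.le (le_max_left _ _) 2
      nlinarith [sq_nonneg m]
    rw [e1]
    have e3 := mul_le_max_sq hx.le hy.le
    rw [← hm] at e3
    linarith
  · calc 2 * m ^ 2 / (K * S : ℕ) = (2 * m ^ 2) / (K * S) := by push_cast; ring
      _ ≤ 2 * m ^ 2 * ε ^ 2 / K := div_mul_le_of_one_le hK' hS' hS (by positivity)
      _ = 131072 / K * (ε / 256 * m) ^ 2 := by ring

/-- Union bound over the five statistics; outside the exceptional events `decideAt_spec` applies.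
The failure bounds add up to `262272 / K`. -/
theorem prob_not_goodResult_le (hK : 0 < K) (hS0 : 0 < S) (hε : 0 < ε) (hε1 : ε < 1)
    (hS : 1 ≤ S * ε ^ 2) (j : ℕ) :
    (scaleE G K S j).prob (fun o => ¬ GoodResult G ε j o) ≤ 400000 / K := by
  have hK' : (0 : ℝ) < K := by exact_mod_cast hK
  have hd := G.one_le_avgDeg
  have hn : (0 : ℝ) < G.n := by exact_mod_cast G.n_pos
  set EA := (G.edgeE.map G.withDeg).iid (K * 2 ^ j * S) with hEA
  set EB := (G.vertE.map G.deg).iid (K * 2 ^ j * S) with hEB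
  set EC := (G.batchE (2 ^ j) (256 * 2 ^ j)).iid (K * S) with hEC
  set PX : (Fin (K * 2 ^ j * S) → Sym2 ℕ × ℕ × ℕ) → Prop := fun w =>
      ε / 8 * max G.avgDeg⁻¹ ((2 ^ j : ℕ) : ℝ)⁻¹ <
        |(∑ i, statX (w i).2.1 (w i).2.2) / (K * 2 ^ j * S : ℕ) - G.avgDeg⁻¹| with hPX
  set PF : (Fin (K * 2 ^ j * S) → Sym2 ℕ × ℕ × ℕ) → Prop := fun w => ε / 256 <
      |(∑ i, statF G.n (2 ^ j) (w i).2.1 (w i).2.2) / (K * 2 ^ j * S : ℕ) - G.meanF (2 ^ j)|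
    with hPF
  set PH : (Fin (K * 2 ^ j * S) → Sym2 ℕ × ℕ × ℕ) → Prop := fun w => ε / 256 <
      |(∑ i, statH G.n (2 ^ j) (w i).2.1 (w i).2.2) / (K * 2 ^ j * S : ℕ) - G.meanH (2 ^ j)|
    with hPH
  set PY : (Fin (K * 2 ^ j * S) → ℕ) → Prop := fun w =>
      ε / 8 * max (G.avgDeg * G.meanF (2 ^ j)) (G.n / ((2 ^ j : ℕ) : ℝ) ^ 4) <
        |(∑ i, statY G.n (2 ^ j) (w i)) / (K * 2 ^ j * S : ℕ) - G.avgDeg * G.meanF (2 ^ j)|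
    with hPY
  set PZ : (Fin (K * S) → ℝ) → Prop := fun w =>
      ε / 256 * max G.avgDeg⁻¹ (65536 * (G.n / ((2 ^ j : ℕ) : ℝ) ^ 4))⁻¹ <
        |(∑ i, w i) / (K * S : ℕ) - G.meanH (2 ^ j) / G.avgDeg| with hPZ
  have hX : EA.prob PX ≤ 64 / K := prob_statX_le G hK hS0 hε hS j
  have hF : EA.prob PF ≤ 65536 / K := prob_statF_le G hK hS0 hε hS j
  have hH : EA.prob PH ≤ 65536 / K := prob_statH_le G hK hS0 hε hS j
  have hY : EB.prob PY ≤ 64 / K := prob_statY_le G hK hS0 hε hS j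
  have hZ : EC.prob PZ ≤ 131072 / K := prob_batch_le G hK hS0 hε hS j
  have hmono : (scaleE G K S j).prob (fun o => ¬ GoodResult G ε j o) ≤
      (EA.prod (EB.prod EC)).prob
        (fun w => (PX w.1 ∨ PF w.1 ∨ PH w.1) ∨ (PY w.2.1 ∨ PZ w.2.2)) := by
    change (EA.prod (EB.prod EC)).prob
      (fun w => ¬ GoodResult G ε j (decideSample G.n (2 ^ j) w)) ≤ _
    refine Expect.prob_mono _ fun w hw => ?_
    by_contra hcon
    rw [not_or, not_or, not_or, not_or] at hcon
    obtain ⟨⟨h1, h2, h3⟩, h4, h5⟩ := hcon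
    refine hw ?_
    have := decideAt_spec (n := G.n) (t := ((2 ^ j : ℕ) : ℝ)) hε hε1 hn (by positivity)
      (by linarith) (G.meanH_nonneg (2 ^ j)) (G.meanH_le_one _) (G.meanF_nonneg _)
      (G.one_le_meanH_meanF _) (not_lt.1 h1) (not_lt.1 h3) (not_lt.1 h2) (not_lt.1 h4)
      (not_lt.1 h5)
    refine ⟨this.1, fun hc => this.2 ?_⟩
    push_cast
    exact hc
  have hA : (EA.prod (EB.prod EC)).prob (fun w => PX w.1 ∨ PF w.1 ∨ PH w.1) ≤
      64 / K + (65536 / K + 65536 / K) := by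
    rw [Expect.prob_prod_fst EA (EB.prod EC) fun a => PX a ∨ PF a ∨ PH a]
    exact (Expect.prob_or_le _ _ _).trans (add_le_add hX
      ((Expect.prob_or_le _ _ _).trans (add_le_add hF hH)))
  have hB : (EA.prod (EB.prod EC)).prob (fun w => PY w.2.1 ∨ PZ w.2.2) ≤
      64 / K + 131072 / K := by
    rw [Expect.prob_prod_snd EA (EB.prod EC) fun b => PY b.1 ∨ PZ b.2]
    refine (Expect.prob_or_le _ _ _).trans (add_le_add ?_ ?_)
    · rw [Expect.prob_prod_fst EB EC PY]; exact hY
    · rw [Expect.prob_prod_snd EB EC PZ]; exact hZ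
  refine hmono.trans ((Expect.prob_or_le _ _ _).trans ((add_le_add hA hB).trans ?_))
  rw [← add_div, ← add_div, ← add_div, ← add_div]
  gcongr
  norm_num

end deviation

/-! ### The search over the scales -/

/-- Try the scales `2 ^ j, 2 ^ (j + 1), …` until there is a result. -/
noncomputable def searchAlg (K S L n : ℕ) : ℕ → ℕ → Alg advancedModel
  -- The value is irrelevant: `searchAlg_success` assumes enough fuel to reach a fitting scale.
  | 0, _ => .ret 0
  | fuel + 1, j => scaleP K S L n j fun o =>
      match o with
      | some r => .ret r
      | none => searchAlg K S L n fuel (j + 1)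

theorem scaleCost_mono (K S L : ℕ) : Monotone (scaleCost K S L) := by
  intro i j h
  have h2 : 2 ^ i ≤ 2 ^ j := Nat.pow_le_pow_right two_pos h
  unfold scaleCost
  gcongr

/-- Induction on the distance `i` to a fitting scale. Before it, a good result is either a correct
answer or none, and then the search goes on; at the fitting scale a good result is an answer. Each
scale loses probability `δ` and costs at most `c`, because costs grow with the scale. -/
theorem searchAlg_success {G : Graph} {ε : ℝ} {K S c : ℕ} {δ : ℝ} (hδ0 : 0 ≤ δ)
    (hδ : ∀ j, (scaleE G K S j).prob (fun o => ¬ GoodResult G ε j o) ≤ δ) (i : ℕ) :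
    ∀ fuel j, i < fuel → scaleCost K S G.n.size (j + i) ≤ c →
      (4 * G.avgDeg ≤ 2 ^ (j + i) ∨ 16 * (G.n / (2 ^ (j + i)) ^ 4) ≤ G.avgDeg ∧
        G.avgDeg ≤ 256 * (G.n / (2 ^ (j + i)) ^ 4)) →
      1 - (i + 1) * δ ≤ (val G {a | IsApprox (1 + ε) G.avgDeg a}
        (searchAlg K S G.n.size G.n fuel j) ((i + 1) * c)).toReal := by
  induction i with
  | zero =>
    intro fuel j hf hc hj
    obtain ⟨fuel, rfl⟩ := Nat.exists_eq_succ_of_ne_zero hf.ne'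
    have hR := (realizes_scaleP (G := G) (T := {a | IsApprox (1 + ε) G.avgDeg a}) K S j).mono
      (c' := c) hc
    have := hR (fun o => match o with
      | some r => .ret r
      | none => searchAlg K S G.n.size G.n fuel (j + 1)) 0
    rw [zero_add] at this
    rw [zero_add, one_mul]
    refine le_trans ?_ this
    rw [Nat.cast_zero, zero_add, one_mul]
    refine Expect.le_apply_of_prob_le _ le_rfl (fun _ => ENNReal.toReal_nonneg) ?_ (hδ j)
    intro o ho
    rw [not_not] at ho
    rcases o with _ | r
    · exact absurd rfl (ho.2 hj)
    · rw [val_ret, if_pos (show r ∈ {a | IsApprox (1 + ε) G.avgDeg a} from ho.1 r rfl)]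
      simp
  | succ i ih =>
    intro fuel j hf hc hj
    obtain ⟨fuel, rfl⟩ := Nat.exists_eq_succ_of_ne_zero (Nat.ne_zero_of_lt hf)
    have hR := (realizes_scaleP (G := G) (T := {a | IsApprox (1 + ε) G.avgDeg a}) K S j).mono
      (c' := c) ((scaleCost_mono K S G.n.size (by omega)).trans hc)
    have := hR (fun o => match o with
      | some r => .ret r
      | none => searchAlg K S G.n.size G.n fuel (j + 1)) ((i + 1) * c)
    rw [show (i + 1) * c + c = (i + 1 + 1) * c by ring] at this
    refine le_trans ?_ this
    have hi := ih fuel (j + 1) (by omega) (by rwa [show j + 1 + i = j + (i + 1) by ring])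
      (by rwa [show j + 1 + i = j + (i + 1) by ring])
    rw [show 1 - (((i + 1 : ℕ) : ℝ) + 1) * δ = 1 - (i + 1) * δ - δ by push_cast; ring]
    have hpos : 0 ≤ ((i : ℝ) + 1) * δ := by positivity
    refine Expect.le_apply_of_prob_le _ (by linarith) (fun _ => ENNReal.toReal_nonneg) ?_ (hδ j)
    intro o ho
    rw [not_not] at ho
    rcases o with _ | r
    · exact hi
    · rw [val_ret, if_pos (show r ∈ {a | IsApprox (1 + ε) G.avgDeg a} from ho.1 r rfl)]
      simpa using hpos

/-- Some scale fits the average degree and is not much larger than the query bound. -/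
theorem exists_scale {n : ℕ} {d : ℝ} (hd1 : 1 ≤ d) (hdn : d ≤ n) :
    ∃ j : ℕ, (4 * d ≤ 2 ^ j ∨ 16 * (n / (2 ^ j) ^ 4) ≤ d ∧ d ≤ 256 * (n / (2 ^ j) ^ 4)) ∧
      (2 : ℝ) ^ j < 8 * min d ((n / d) ^ (1 / 4 : ℝ)) := by
  have hd0 : 0 < d := by linarith
  have hn0 : (0 : ℝ) < n := by linarith
  rcases le_total d (((n : ℝ) / d) ^ (1 / 4 : ℝ)) with h | h
  · rw [min_eq_left h]
    -- Small `d`: the least such `j` overshoots `4 * d` by less than a factor `2`.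
    have hex : ∃ j : ℕ, 4 * d ≤ 2 ^ j := by
      obtain ⟨j, hj⟩ := pow_unbounded_of_one_lt (4 * d) one_lt_two
      exact ⟨j, hj.le⟩
    classical
    refine ⟨Nat.find hex, Or.inl (Nat.find_spec hex), ?_⟩
    rcases Nat.eq_zero_or_pos (Nat.find hex) with h0 | h0
    · rw [h0]; norm_num; linarith
    · have := Nat.find_min hex (Nat.sub_lt h0 one_pos)
      rw [not_le] at this
      calc (2 : ℝ) ^ Nat.find hex = 2 * 2 ^ (Nat.find hex - 1) := by
            rw [← pow_succ']; congr 1; omega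
        _ < 2 * (4 * d) := by gcongr
        _ = 8 * d := by ring
  · rw [min_eq_right h]
    -- Large `d`: one step of `j` changes `(2^j)^4` by a factor `16`, exactly the width of the
    -- window from `16` to `256`, so the least `j` lands in it.
    have hex : ∃ j : ℕ, 16 * n ≤ d * (16 : ℝ) ^ j := by
      obtain ⟨j, hj⟩ := pow_unbounded_of_one_lt (16 * n : ℝ) (show (1 : ℝ) < 16 by norm_num)
      exact ⟨j, hj.le.trans (le_mul_of_one_le_left (by positivity) hd1)⟩
    classical
    have h16 : ∀ j : ℕ, ((2 : ℝ) ^ j) ^ 4 = 16 ^ j := fun j => by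
      rw [← pow_mul, mul_comm, pow_mul]; norm_num
    set j := Nat.find hex with hj
    have hspec : 16 * n ≤ d * (16 : ℝ) ^ j := Nat.find_spec hex
    have h0 : 0 < j := by
      rcases Nat.eq_zero_or_pos j with h0 | h0
      · rw [h0] at hspec; norm_num at hspec; linarith
      · exact h0
    have hmin : d * (16 : ℝ) ^ (j - 1) < 16 * n := not_le.1 (Nat.find_min hex (Nat.sub_lt h0 one_pos))
    have hmin' : d * (16 : ℝ) ^ j < 256 * n := by
      calc d * (16 : ℝ) ^ j = 16 * (d * (16 : ℝ) ^ (j - 1)) := by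
            rw [mul_left_comm, ← pow_succ']; congr 2; omega
        _ < 16 * (16 * n) := by gcongr
        _ = 256 * n := by ring
    refine ⟨j, Or.inr ⟨?_, ?_⟩, ?_⟩
    · rw [h16, ← mul_div_assoc, div_le_iff₀ (by positivity)]; exact hspec
    · rw [h16, ← mul_div_assoc, le_div_iff₀ (by positivity)]; exact hmin'.le
    · set x := ((n : ℝ) / d) ^ (1 / 4 : ℝ) with hx
      have hx0 : 0 < x := by positivity
      have hx4 : x ^ 4 = n / d := by
        rw [hx, ← Real.rpow_natCast, ← Real.rpow_mul (by positivity)]; norm_num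
      refine lt_of_pow_lt_pow_left₀ 4 (by positivity) ?_
      rw [h16, mul_pow, hx4]
      have e1 : (16 : ℝ) ^ j < 256 * (n / d) := by
        rw [← mul_div_assoc, lt_div_iff₀ hd0]; linarith
      have e2 : 0 < (n : ℝ) / d := by positivity
      linarith

/-! ### Constants and the final bounds -/

theorem Graph.two_le_n (G : Graph) : 2 ≤ G.n := by
  obtain ⟨x, hx⟩ := G.nonempty
  obtain ⟨y, hy⟩ := G.exists_adj x hx
  have : ({x, y} : Finset ℕ) ⊆ G.verts := by
    intro z hz
    rw [Finset.mem_insert, Finset.mem_singleton] at hz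
    rcases hz with rfl | rfl
    · exact hx
    · exact G.mem_of_adj _ _ hy.symm
  have h2 := Finset.card_le_card this
  rwa [Finset.card_pair hy.ne] at h2

theorem cast_size_le_log {n : ℕ} (hn : 2 ≤ n) : (n.size : ℝ) ≤ 4 * Real.log n := by
  have h2 : 2 ≤ n.size := Nat.lt_size.2 (by simpa using hn)
  have h3 : 2 ^ (n.size - 1) ≤ n := Nat.lt_size.1 (by omega)
  have h4 : ((2 : ℝ)) ^ (n.size - 1) ≤ n := by exact_mod_cast h3
  have h5 : ((n.size - 1 : ℕ) : ℝ) * Real.log 2 ≤ Real.log n := by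
    rw [← Real.log_pow]
    exact Real.log_le_log (by positivity) h4
  have h6 := Real.log_two_gt_d9
  have h7 : (n.size : ℝ) ≤ 2 * ((n.size - 1 : ℕ) : ℝ) := by
    exact_mod_cast (by omega : n.size ≤ 2 * (n.size - 1))
  have h8 : (0 : ℝ) ≤ ((n.size - 1 : ℕ) : ℝ) := Nat.cast_nonneg _
  nlinarith

theorem search_cost_le {L j S : ℕ} (hL : 2 ≤ L) (hj : j ≤ L + 2) :
    (j + 1) * scaleCost (200000000 * L) S L j ≤ 200000000000000 * L ^ 4 * S * 2 ^ j := by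
  have h1 : j + 1 ≤ 3 * L := by omega
  have h2 : L + j + 10 ≤ 8 * L := by omega
  have hc : scaleCost (200000000 * L) S L j =
      200000000 * L * S * 2 ^ j * (1541 + 4096 * (L + j + 10) ^ 2) := by
    unfold scaleCost; ring
  have h3 : 1541 + 4096 * (L + j + 10) ^ 2 ≤ 300000 * L ^ 2 := by
    have e1 : (L + j + 10) ^ 2 ≤ (8 * L) ^ 2 := Nat.pow_le_pow_left h2 2
    have e2 : (8 * L) ^ 2 = 64 * L ^ 2 := by ring
    have e3 : 2 ^ 2 ≤ L ^ 2 := Nat.pow_le_pow_left hL 2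
    omega
  rw [hc]
  calc _ ≤ 3 * L * (200000000 * L * S * 2 ^ j * (300000 * L ^ 2)) := by gcongr
    _ = 180000000000000 * (L ^ 4 * S * 2 ^ j) := by ring
    _ ≤ 200000000000000 * (L ^ 4 * S * 2 ^ j) := Nat.mul_le_mul_right _ (by norm_num)
    _ = _ := by ring

theorem query_upper_bound : ∃ (C : ℝ) (k : ℕ), 0 ≤ C ∧ ∀ (n : ℕ) (ε : ℝ), 0 < ε → ε < 1 →
    ∃ A : Alg advancedModel, ∀ G : Graph, G.n = n →
      99 / 100 < successProb A G (1 + ε)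
        (C * Real.log n ^ k * (ε⁻¹ ^ 2 * min G.avgDeg (((n : ℝ) / G.avgDeg) ^ (1 / 4 : ℝ)))) := by
  -- The four logarithms: one for the number of scales, one for `K`, which is proportional to `L`,
  -- and two for the pairs of binary digits.
  refine ⟨10 ^ 18, 4, by positivity, fun n ε hε0 hε1 => ?_⟩
  set S : ℕ := ⌈ε⁻¹ ^ 2⌉₊ with hS
  have hε2 : 1 ≤ ε⁻¹ ^ 2 := one_le_pow₀ ((one_le_inv₀ hε0).2 hε1.le)
  have hS1 : ε⁻¹ ^ 2 ≤ S := Nat.le_ceil _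
  have hS2 : (S : ℝ) ≤ 2 * ε⁻¹ ^ 2 := by
    have := Nat.ceil_lt_add_one (show 0 ≤ ε⁻¹ ^ 2 by positivity)
    linarith
  have hS0 : 0 < S := Nat.ceil_pos.2 (by positivity)
  have hSε : 1 ≤ S * ε ^ 2 := by
    calc (1 : ℝ) = ε⁻¹ ^ 2 * ε ^ 2 := by rw [← mul_pow, inv_mul_cancel₀ hε0.ne', one_pow]
      _ ≤ S * ε ^ 2 := by gcongr
  -- A fitting `j` satisfies `2^j < 8 * n`, so `j ≤ L + 2` and the fuel suffices. Each scale fails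
  -- with probability at most `1 / (500 * L)`, and at most `3 * L` scales are tried, for a total of
  -- `3/500 < 1/100`.
  refine ⟨searchAlg (200000000 * n.size) S n.size n (n.size + 3) 0, ?_⟩
  rintro G rfl
  set L := G.n.size with hL
  have hn2 := G.two_le_n
  have hL2 : 2 ≤ L := Nat.lt_size.2 (by simpa using hn2)
  have hLlog : (L : ℝ) ≤ 4 * Real.log G.n := cast_size_le_log hn2
  have hd1 := G.one_le_avgDeg
  have hdn := G.avgDeg_le
  obtain ⟨j, hj, hj2⟩ := exists_scale hd1 hdn
  set μ := min G.avgDeg ((G.n / G.avgDeg) ^ (1 / 4 : ℝ)) with hμ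
  have hjL : j ≤ L + 2 := by
    have h1 : (2 : ℝ) ^ j < 8 * G.n := by
      have : μ ≤ G.avgDeg := min_le_left _ _
      linarith
    have h2 : 2 ^ j < 8 * G.n := by exact_mod_cast h1
    have h3 : G.n < 2 ^ L := Nat.lt_size_self _
    have h4 : 2 ^ j < 2 ^ (L + 3) := by rw [pow_add]; omega
    have := (Nat.pow_lt_pow_iff_right (by norm_num : 1 < 2)).1 h4
    omega
  have hμ0 : 0 < μ := by
    have : (0 : ℝ) < 2 ^ j := by positivity
    linarith
  have hLR : (2 : ℝ) ≤ L := by exact_mod_cast hL2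
  set δ : ℝ := 400000 / ((200000000 * L : ℕ) : ℝ) with hδ
  have hδL : δ * L = 1 / 500 := by
    rw [hδ]; push_cast; field_simp; norm_num
  have hδ0 : 0 ≤ δ := by positivity
  have hmain := searchAlg_success (G := G) (ε := ε) (K := 200000000 * L) (S := S) hδ0
    (fun j => prob_not_goodResult_le G (by omega) hS0 hε0 hε1 hSε j) j (L + 3) 0 (by omega)
    le_rfl (by rwa [zero_add])
  rw [zero_add] at hmain
  have hlog0 : 0 ≤ Real.log G.n := by linarith
  rw [successProb_eq_val _ _ _ (by positivity)]
  have hbudget : (j + 1) * scaleCost (200000000 * L) S L j ≤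
      ⌊(10 : ℝ) ^ 18 * Real.log G.n ^ 4 * (ε⁻¹ ^ 2 * μ)⌋₊ := by
    refine Nat.le_floor ?_
    calc (((j + 1) * scaleCost (200000000 * L) S L j : ℕ) : ℝ) ≤
          ((200000000000000 * L ^ 4 * S * 2 ^ j : ℕ) : ℝ) := by
          exact_mod_cast search_cost_le hL2 hjL
      _ = 200000000000000 * (L : ℝ) ^ 4 * S * 2 ^ j := by push_cast; ring
      _ ≤ 200000000000000 * (4 * Real.log G.n) ^ 4 * (2 * ε⁻¹ ^ 2) * (8 * μ) := by gcongr
      _ = 819200000000000000 * (Real.log G.n ^ 4 * (ε⁻¹ ^ 2 * μ)) := by ring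
      _ ≤ 10 ^ 18 * (Real.log G.n ^ 4 * (ε⁻¹ ^ 2 * μ)) := by gcongr; norm_num
      _ = _ := by ring
  refine lt_of_lt_of_le ?_ (val_mono G _ _ hbudget)
  rw [← ENNReal.toReal_lt_toReal (by simp [ENNReal.div_eq_top]) (val_ne_top _ _ _ _)]
  refine lt_of_lt_of_le ?_ hmain
  have hjR : (j : ℝ) + 1 ≤ 3 * L := by exact_mod_cast (by omega : j + 1 ≤ 3 * L)
  have : ((j : ℝ) + 1) * δ ≤ 3 * L * δ := by gcongr
  rw [ENNReal.toReal_div]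
  norm_num
  linarith

/-- The increasing function `d` and the decreasing function `(n/d)^(1/4)` cross at `d = n^(1/5)`. -/
theorem min_le_rpow {n d : ℝ} (hn : 0 < n) (hd : 0 < d) :
    min d ((n / d) ^ (1 / 4 : ℝ)) ≤ n ^ (1 / 5 : ℝ) := by
  rcases le_total d (n ^ (1 / 5 : ℝ)) with h | h
  · exact (min_le_left _ _).trans h
  · refine (min_le_right _ _).trans ?_
    calc (n / d) ^ (1 / 4 : ℝ) ≤ (n / n ^ (1 / 5 : ℝ)) ^ (1 / 4 : ℝ) := by gcongr
      _ = n ^ (1 / 5 : ℝ) := by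
          nth_rewrite 1 [← Real.rpow_one n]
          rw [← Real.rpow_sub hn, ← Real.rpow_mul hn.le]
          norm_num

theorem successProb_mono {M : Set Query} (A : Alg M) (G : Graph) (c : ℝ) {q q' : ℝ} (h : q ≤ q') :
    successProb A G c q ≤ successProb A G c q' :=
  (A.run G).toOuterMeasure.mono fun _ ho => ⟨ho.1, ho.2.trans h⟩

end AvgDeg

theorem theorem1p2 :
    -- an algorithm with query cost `Õ(ε⁻² min(d, (n/d)^(1/4)))`
    (∃ (C : ℝ) (k : ℕ), ∀ (n : ℕ) (ε : ℝ), 0 < ε → ε < 1 →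
      ∃ A : AvgDeg.Alg AvgDeg.advancedModel, ∀ G : AvgDeg.Graph, G.n = n →
        99 / 100 < AvgDeg.successProb A G (1 + ε)
          (C * Real.log n ^ k * (ε⁻¹ ^ 2 *
            min G.avgDeg (((n : ℝ) / G.avgDeg) ^ (1 / 4 : ℝ))))) ∧
    -- in particular, an algorithm with query cost `Õ(ε⁻² n^(1/5))`
    (∃ (C : ℝ) (k : ℕ), ∀ (n : ℕ) (ε : ℝ), 0 < ε → ε < 1 →
      ∃ A : AvgDeg.Alg AvgDeg.advancedModel, ∀ G : AvgDeg.Graph, G.n = n →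
        99 / 100 < AvgDeg.successProb A G (1 + ε)
          (C * Real.log n ^ k * (ε⁻¹ ^ 2 * (n : ℝ) ^ (1 / 5 : ℝ)))) ∧
    -- constant factor approximation needs `Ω(n^(1/5))`, even with full neighbourhood access
    (∀ (c : ℝ) (p : ENNReal), 1 ≤ c → 1 / 2 < p →
      ∃ (κ : ℝ) (N : ℕ), 0 < κ ∧ ∀ n : ℕ, N ≤ n →
        ∀ (A : AvgDeg.Alg AvgDeg.fullNbrModel) (q : ℝ),
          (∀ G : AvgDeg.Graph, G.n = n → p ≤ AvgDeg.successProb A G c q) →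
            κ * (n : ℝ) ^ (1 / 5 : ℝ) ≤ q) := by
  obtain ⟨C, k, hC, h⟩ := AvgDeg.query_upper_bound
  refine ⟨⟨C, k, h⟩, ⟨C, k, fun n ε hε0 hε1 => ?_⟩, AvgDeg.query_lower_bound⟩
  obtain ⟨A, hA⟩ := h n ε hε0 hε1
  refine ⟨A, fun G hG => (hA G hG).trans_le (AvgDeg.successProb_mono A G _ ?_)⟩
  have hlog : 0 ≤ Real.log n := Real.log_natCast_nonneg n
  have hn : (0 : ℝ) < n := by rw [← hG]; exact_mod_cast G.n_pos
  gcongr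
  exact AvgDeg.min_le_rpow hn (by linarith [G.one_le_avgDeg])
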